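/- **Notation.** Let $\langle x\rangle=(1+x^2)^{1/2}$. The space $L^{2,1}(\mathbb R)$ consists of the functions $f:\mathbb R\to\mathbb C$ with $\|f\|_{L^{2,1}}=\|\langle\cdot\rangle f\|_{L^2}<\infty$, and $H^{1,1}(\mathbb R)=\{u\in L^{2,1}(\mathbb R):\ \partial_xu\in L^{2,1}(\mathbb R)\}$ (weak derivative) with norm $\|u\|_{L^{2,1}}+\|\partial_xu\|_{L^{2,1}}$; $H^1(\mathbb R)$ and $H^2(\mathbb R)$ are the usual Sobolev spaces, and intersections carry the sum of the norms. For $u\in H^{1,1}(\mathbb R)$ let $Q(u)=\begin{pmatrix}0&u\\-\bar u&0\end{pmatrix}$, and for $\lambda\in\mathbb R\cup i\mathbb R$ let $\varphi_\pm(\cdot;\lambda),\phi_\pm(\cdot;\lambda)\in L^\infty(\mathbb R;\mathbb C^2)$ be the Jost functions of the Kaup–Newell problem $\partial_x\psi=[-i\lambda^2\sigma_3+\lambda Q(u)]\psi$, that is, the solutions of $$\varphi_\pm(x;\lambda)=e_1+\lambda\int_{\pm\infty}^x\begin{pmatrix}1&0\\0&e^{2i\lambda^2(x-y)}\end{pmatrix}Q(u(y))\varphi_\pm(y;\lambda)\,dy,$$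 $$\phi_\pm(x;\lambda)=e_2+\lambda\int_{\pm\infty}^x\begin{pmatrix}e^{-2i\lambda^2(x-y)}&0\\0&1\end{pmatrix}Q(u(y))\phi_\pm(y;\lambda)\,dy .$$ The scattering coefficients $a(\lambda),b(\lambda)\in\mathbb C$ are defined by $$\varphi_-(x;\lambda)=a(\lambda)\varphi_+(x;\lambda)+b(\lambda)e^{2i\lambda^2x}\phi_+(x;\lambda),\qquad x\in\mathbb R,$$ and, with $z=\lambda^2\in\mathbb R$, the scattering data are $$r_+(z)=-\frac{b(\lambda)}{2i\lambda a(\lambda)},\qquad r_-(z)=\frac{2i\lambda b(\lambda)}{a(\lambda)}$$ (as elements of spaces of functions of $z\in\mathbb R$ defined almost everywhere, so that the value at $z=0$ is irrelevant). **Lemma.** For every $u\in H^{1,1}(\mathbb R)$ the following holds. 0. For every $\lambda\in\mathbb R\cup i\mathbb R$ the pair $(a(\lambda),b(\lambda))$ exists and is unique, and for $z\ne0$ the values $r_\pm(z)$ do not depend on the choice of the square root $\lambda$ of $z$. 1. If there is $A>0$ with $|a(\lambda)|\ge A$ for all $\lambda\in\mathbb R\cup i\mathbb R$, then $r_+,r_-\in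 H^1(\mathbb R)$. 2. If, in addition, $u\in H^2(\mathbb R)\cap H^{1,1}(\mathbb R)$, then $r_+,r_-\in L^{2,1}(\mathbb R)$. Moreover, the map $u\mapsto(r_+,r_-)$ from $H^2(\mathbb R)\cap H^{1,1}(\mathbb R)$ to $H^1(\mathbb R)\cap L^{2,1}(\mathbb R)$ is Lipschitz continuous on bounded sets in the following sense: 3. For all $A>0$ and $U\geq 0$ there is a constant $C=C(A,U)$ such that for all $u,\tilde u\in H^2(\mathbb R)\cap H^{1,1}(\mathbb R)$ with $\|u\|_{H^2\cap H^{1,1}},\|\tilde u\|_{H^2\cap H^{1,1}}\le U$ whose coefficients satisfy $|a(\lambda)|\ge A$ and $|\tilde a(\lambda)|\ge A$ for all $\lambda\in\mathbb R\cup i\mathbb R$, $$\|r_+-\tilde r_+\|_{H^1\cap L^{2,1}}+\|r_--\tilde r_-\|_{H^1\cap L^{2,1}}\le C\,\|u-\tilde u\|_{H^2\cap H^{1,1}} .$$ -/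

import Mathlib

open MeasureTheory Complex
open scoped Matrix NNReal ENNReal ComplexConjugate

namespace DNLS

/-! ### Function spaces on the real line -/

/-- `g` is the weak derivative of `f` on `ℝ`. -/
def HasWeakDeriv (f g : ℝ → ℂ) : Prop :=
  LocallyIntegrable f volume ∧ LocallyIntegrable g volume ∧
    ∀ η : ℝ → ℝ, ContDiff ℝ ((⊤ : ℕ∞) : WithTop ℕ∞) η → HasCompactSupport η →
      ∫ x, deriv η x • f x = - ∫ x, η x • g x

/-- Weak derivatives are unique up to null sets. -/
theorem HasWeakDeriv.ae_unique {f g h : ℝ → ℂ} (hg : HasWeakDeriv f g)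
    (hh : HasWeakDeriv f h) : g =ᵐ[volume] h := by
  refine ae_eq_of_integral_contDiff_smul_eq hg.2.1 hh.2.1 (fun η hη hc => ?_)
  have h1 := hg.2.2 η hη hc
  have h2 := hh.2.2 η hη hc
  exact neg_injective (h1.symm.trans h2)

open Classical in
/-- The weak derivative, as a function chosen in its almost-everywhere class
(and `0` if there is none). -/
noncomputable def weakDeriv (f : ℝ → ℂ) : ℝ → ℂ :=
  if h : ∃ g, HasWeakDeriv f g then h.choose else 0

/-- The chosen weak derivative is a weak derivative whenever there is one. -/
theorem hasWeakDeriv_weakDeriv {f g : ℝ → ℂ} (h : HasWeakDeriv f g) :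
    HasWeakDeriv f (weakDeriv f) := by
  have h' : ∃ g, HasWeakDeriv f g := ⟨g, h⟩
  rw [weakDeriv, dif_pos h']
  exact h'.choose_spec

/-- The function `⟨x⟩ f(x)`, where `⟨x⟩ = (1 + x²)^{1/2}`. -/
noncomputable def weighted (f : ℝ → ℂ) : ℝ → ℂ := fun x => Real.sqrt (1 + x ^ 2) • f x

/-- `f ∈ L^{2,1}(ℝ)`, that is, `⟨x⟩ f ∈ L²(ℝ)`. -/
def MemL21 (f : ℝ → ℂ) : Prop := MemLp (weighted f) 2 volume

/-- `f ∈ H¹(ℝ)`. -/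
def MemH1 (f : ℝ → ℂ) : Prop :=
  MemLp f 2 volume ∧ ∃ g, HasWeakDeriv f g ∧ MemLp g 2 volume

/-- `f ∈ H²(ℝ)`. -/
def MemH2 (f : ℝ → ℂ) : Prop :=
  MemLp f 2 volume ∧ ∃ g, HasWeakDeriv f g ∧ MemH1 g

/-- `f ∈ H^{1,1}(ℝ)`: both `f` and its weak derivative are in `L^{2,1}(ℝ)`. -/
def MemH11 (f : ℝ → ℂ) : Prop :=
  MemL21 f ∧ ∃ g, HasWeakDeriv f g ∧ MemL21 g

/-- The norm of `L^{2,1}(ℝ)`. -/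
noncomputable def normL21 (f : ℝ → ℂ) : ℝ≥0∞ := eLpNorm (weighted f) 2 volume

/-- The norm of `H¹(ℝ)` (for `f` in that space). -/
noncomputable def normH1 (f : ℝ → ℂ) : ℝ≥0∞ :=
  eLpNorm f 2 volume + eLpNorm (weakDeriv f) 2 volume

/-- The norm of `H²(ℝ)` (for `f` in that space). -/
noncomputable def normH2 (f : ℝ → ℂ) : ℝ≥0∞ :=
  eLpNorm f 2 volume + normH1 (weakDeriv f)

/-- The norm of `H^{1,1}(ℝ)` (for `f` in that space). -/
noncomputable def normH11 (f : ℝ → ℂ) : ℝ≥0∞ := normL21 f + normL21 (weakDeriv f)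

/-! ### The Kaup–Newell spectral problem -/

/-- The union of the real and the imaginary axis in the `λ`-plane. -/
def axes : Set ℂ := {l | l.im = 0 ∨ l.re = 0}

/-- The matrix potential at a point where `u` has the value `w`. -/
def potential (w : ℂ) : Matrix (Fin 2) (Fin 2) ℂ := !![0, w; -conj w, 0]

/-- `φ` is the Jost function `φ₋(·;l)`: it is in `L^∞` and
`φ(x) = e₁ + l ∫_{-∞}^x diag(1, e^{2 i l² (x-y)}) Q(u(y)) φ(y) dy`. -/
def IsJostFirstMinus (u : ℝ → ℂ) (l : ℂ) (φ : ℝ → Fin 2 → ℂ) : Prop :=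
  MemLp φ ⊤ volume ∧ ∀ x : ℝ, φ x = ![1, 0] + l • ∫ y in Set.Iic x,
    !![1, 0; 0, exp (2 * I * l ^ 2 * (x - y))] *ᵥ (potential (u y) *ᵥ φ y)

/-- `φ` is the Jost function `φ₊(·;l)`: it is in `L^∞` and
`φ(x) = e₁ + l ∫_{+∞}^x diag(1, e^{2 i l² (x-y)}) Q(u(y)) φ(y) dy`. -/
def IsJostFirstPlus (u : ℝ → ℂ) (l : ℂ) (φ : ℝ → Fin 2 → ℂ) : Prop :=
  MemLp φ ⊤ volume ∧ ∀ x : ℝ, φ x = ![1, 0] - l • ∫ y in Set.Ioi x,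
    !![1, 0; 0, exp (2 * I * l ^ 2 * (x - y))] *ᵥ (potential (u y) *ᵥ φ y)

/-- `χ` is the second Jost function normalised at `+∞`: it is in `L^∞` and
`χ(x) = e₂ + l ∫_{+∞}^x diag(e^{-2 i l² (x-y)}, 1) Q(u(y)) χ(y) dy`. -/
def IsJostSecondPlus (u : ℝ → ℂ) (l : ℂ) (χ : ℝ → Fin 2 → ℂ) : Prop :=
  MemLp χ ⊤ volume ∧ ∀ x : ℝ, χ x = ![0, 1] - l • ∫ y in Set.Ioi x,
    !![exp (-(2 * I * l ^ 2 * (x - y))), 0; 0, 1] *ᵥ (potential (u y) *ᵥ χ y)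

/-- `p = (a(l), b(l))` is the first row of the transfer matrix:
`φ₋(x;l) = a(l) φ₊(x;l) + b(l) e^{2 i l² x} χ₊(x;l)` for all real `x`, for Jost functions
`φ₋`, `φ₊`, `χ₊` of the potential `u` at the spectral parameter `l`. -/
def IsScatteringPair (u : ℝ → ℂ) (l : ℂ) (p : ℂ × ℂ) : Prop :=
  ∃ φm φp χp : ℝ → Fin 2 → ℂ,
    IsJostFirstMinus u l φm ∧ IsJostFirstPlus u l φp ∧ IsJostSecondPlus u l χp ∧
      ∀ x : ℝ, φm x = p.1 • φp x + (p.2 * exp (2 * I * l ^ 2 * x)) • χp x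

/-- The scattering coefficient `a(l)`. -/
noncomputable def scatA (u : ℝ → ℂ) (l : ℂ) : ℂ :=
  (Classical.epsilon (IsScatteringPair u l)).1

/-- The scattering coefficient `b(l)`. -/
noncomputable def scatB (u : ℝ → ℂ) (l : ℂ) : ℂ :=
  (Classical.epsilon (IsScatteringPair u l)).2

/-- The square root of a real number `z` in `[0,∞) ∪ i[0,∞)`. -/
noncomputable def root (z : ℝ) : ℂ :=
  if 0 ≤ z then (Real.sqrt z : ℂ) else I * (Real.sqrt (-z) : ℂ)

/-- `r₊(z) = - b(l) / (2 i l a(l))` with `l² = z`. -/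
noncomputable def rPlus (u : ℝ → ℂ) (z : ℝ) : ℂ :=
  -(scatB u (root z) / (2 * I * root z * scatA u (root z)))

/-- `r₋(z) = 2 i l b(l) / a(l)` with `l² = z`. -/
noncomputable def rMinus (u : ℝ → ℂ) (z : ℝ) : ℂ :=
  2 * I * root z * scatB u (root z) / scatA u (root z)

/-- The bound `|a(l)| ≥ A` for all `l` on the two axes. -/
def ABound (u : ℝ → ℂ) (A : ℝ) : Prop := ∀ l ∈ axes, A ≤ ‖scatA u l‖

end DNLS

open DNLS

/-! The obstacle is the factor `λ` in `λQ(u)`: it is unbounded, so estimates that are uniform or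
square integrable in `z = λ²` cannot be read off the spectral problem itself. The proof removes it.
Conjugating by the free phases turns the Jost equations into `T' = PT` with `P` off-diagonal, with
entries `λ u e^{2izx}` and `-λ ū e^{-2izx}`; then `(a, b)` is the first column of `T(+∞)`
(`isScatteringPair_iff`). This also gives existence and uniqueness of the pair.

Next, with `g = exp(-(i/2)∫_{-∞}^x |u|²)` and `(f, n)` the first column of `T`, put `N₁ = ḡ f` and
`N₂ = g(2iλ n - ū e^{-2izx} f)`. All terms containing `λ` cancel: `N₁' = c₀ e^{2izx} N₂` and `N₂' =
c₁ e^{-2izx} N₁`, where `c₀, c₁` are built from `u`, `∂ₓu` and `g` and lie in `L^{2,1}`. A third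
component `N₃' = c₂ e^{-2izx} N₁` satisfies `n = -λ N₃`. At `+∞` this expresses `a`, `b/λ` and `λb`
through a transfer matrix depending on `z` only (`transfer_gauge`), so `r₋` and `r₊` are, up to
gauge constants, the quotients of its entries `10` and `20` by its entry `00`, and `|a|` is the
modulus of the entry `00`.

The analytic core is a bound for `z ↦ ∫ k(s) e^{iωzs} X_z(s) ds`, where `k` is in `L¹ ∩ L²` and
`|X_z'| ≤ ν` with `ν` in `L¹` independent of `z`. Integration by parts against the tail `∫_t^∞ k
e^{iωzs} ds` leaves the Fourier transform of `k` and a `ν`-weighted superposition of tails; a tail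
is the transform of a truncation of `k`, so Plancherel and Minkowski bound everything in `L²`
(`l2Maj_integral_phase_smul`). Such integrals arise from the variation-of-constants formula
`fwdTop_sub_fwdTop` for the difference of two transfer matrices.

Changing the coefficients in that formula gives `L²` Lipschitz continuity. Changing `z` to `z + η`
amounts to multiplying the coefficients by `e^{iωηx} - 1`, which is `O(|η|)` in `L²` because `x c`
is in `L²`; combining both changes gives increments that are `O(|η|)` and Lipschitz in the potential
(`l2Maj_transfer_increment_sub`). A function whose increments are `O(|η|)` in `L²` is in `H¹`
(`exists_hasWeakDeriv_of_increment`).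

For the weight, `r₋ = 4z r₊`, so only `z r₋` needs a new estimate. One more integration by parts
writes `2iz` times the entry `10` as an oscillatory integral whose density contains `c₁'`; this uses
the second derivative of `u` (`l2Maj_mul_transfer_sub`). Membership is the Lipschitz estimate with
the zero potential as second argument, for which `a = 1` and `r₊ = r₋ = 0`. -/

namespace DNLS

open Filter Topology Set
set_option linter.unusedSectionVars false

/-! ### Calculus of absolutely continuous functions through their integrable derivatives. -/

section Primitive

variable {E F G : Type*} [NormedAddCommGroup E] [NormedSpace ℝ E]
  [NormedAddCommGroup F] [NormedSpace ℝ F] [NormedAddCommGroup G] [NormedSpace ℝ G]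

/-- `F` is a primitive of the locally integrable function `f`. -/
def IsPrim (F f : ℝ → E) : Prop :=
  (∀ a b, IntervalIntegrable f volume a b) ∧ ∀ a b, F b - F a = ∫ x in a..b, f x

theorem IsPrim.eq_add {φ f : ℝ → E} (h : IsPrim φ f) (a b : ℝ) :
    φ b = φ a + ∫ x in a..b, f x := by rw [← h.2 a b]; abel

theorem IsPrim.continuous {φ f : ℝ → E} (h : IsPrim φ f) : Continuous φ := by
  have : φ = fun b => φ 0 + ∫ x in (0 : ℝ)..b, f x := funext fun b => h.eq_add 0 b
  rw [this]
  exact continuous_const.add (intervalIntegral.continuous_primitive h.1 0)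

theorem IsPrim.congr {φ f g : ℝ → E} (h : IsPrim φ f) (hfg : ∀ x, f x = g x) : IsPrim φ g := by
  obtain rfl : f = g := funext hfg
  exact h

theorem IsPrim.congr_left {φ ψ f : ℝ → E} (h : IsPrim φ f) (hfg : ∀ x, φ x = ψ x) :
    IsPrim ψ f := by
  obtain rfl : φ = ψ := funext hfg
  exact h

theorem isPrim_const (c : E) : IsPrim (fun _ => c) (fun _ => 0) :=
  ⟨fun a b => by simp, fun a b => by simp⟩

theorem IsPrim.add {φ f ψ g : ℝ → E} (h : IsPrim φ f) (h' : IsPrim ψ g) :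
    IsPrim (fun x => φ x + ψ x) (fun x => f x + g x) := by
  refine ⟨fun a b => (h.1 a b).add (h'.1 a b), fun a b => ?_⟩
  rw [intervalIntegral.integral_add (h.1 a b) (h'.1 a b), ← h.2, ← h'.2]
  exact add_sub_add_comm _ _ _ _

theorem IsPrim.neg {φ f : ℝ → E} (h : IsPrim φ f) :
    IsPrim (fun x => -φ x) (fun x => -f x) := by
  refine ⟨fun a b => (h.1 a b).neg, fun a b => ?_⟩
  rw [intervalIntegral.integral_neg, ← h.2]
  exact neg_sub_neg _ _ |>.trans (neg_sub _ _).symm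

theorem IsPrim.sub {φ f ψ g : ℝ → E} (h : IsPrim φ f) (h' : IsPrim ψ g) :
    IsPrim (fun x => φ x - ψ x) (fun x => f x - g x) := by
  simpa only [sub_eq_add_neg] using h.add h'.neg

theorem IsPrim.clm [CompleteSpace E] [CompleteSpace F] {φ f : ℝ → E} (h : IsPrim φ f)
    (L : E →L[ℝ] F) : IsPrim (fun x => L (φ x)) (fun x => L (f x)) := by
  refine ⟨fun a b => ⟨L.integrable_comp (h.1 a b).1, L.integrable_comp (h.1 a b).2⟩,
    fun a b => ?_⟩
  rw [L.intervalIntegral_comp_comm (h.1 a b), ← h.2, map_sub]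

theorem isPrim_of_hasDerivAt [CompleteSpace E] {φ f : ℝ → E} (h : ∀ x, HasDerivAt φ (f x) x)
    (hf : Continuous f) : IsPrim φ f :=
  ⟨fun a b => hf.intervalIntegrable a b, fun a b =>
    (intervalIntegral.integral_eq_sub_of_hasDerivAt (fun x _ => h x)
      (hf.intervalIntegrable a b)).symm⟩

theorem IsPrim.const_of_zero {φ : ℝ → E} (h : IsPrim φ (fun _ => 0)) (a b : ℝ) : φ a = φ b := by
  simpa [sub_eq_zero, eq_comm] using h.2 a b

/-- The product rule for primitives and a continuous bilinear map. -/
theorem IsPrim.bilin [CompleteSpace E] [CompleteSpace F] [CompleteSpace G]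
    (B : E →L[ℝ] F →L[ℝ] G) {φ f : ℝ → E} {ψ g : ℝ → F} (h : IsPrim φ f) (h' : IsPrim ψ g) :
    IsPrim (fun x => B (φ x) (ψ x)) (fun x => B (f x) (ψ x) + B (φ x) (g x)) := by
  have hint1 : ∀ a b, IntervalIntegrable (fun x => B (f x) (ψ x)) volume a b := by
    intro a b
    obtain ⟨C, hC⟩ := (isCompact_uIcc (a := a) (b := b)).exists_bound_of_continuousOn
      h'.continuous.continuousOn
    refine ((h.1 a b).norm.const_mul (‖B‖ * C)).mono_fun' ?_ ?_
    · exact B.aestronglyMeasurable_comp₂ (intervalIntegrable_iff.1 (h.1 a b)).aestronglyMeasurable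
        h'.continuous.aestronglyMeasurable
    · refine (ae_restrict_iff' measurableSet_uIoc).2 (.of_forall fun x hx => ?_)
      refine (B.le_opNorm₂ _ _).trans ?_
      have := hC x (uIoc_subset_uIcc hx)
      have h1 : ‖B‖ * ‖f x‖ * ‖ψ x‖ ≤ ‖B‖ * ‖f x‖ * C := by gcongr
      linarith
  have hint2 : ∀ a b, IntervalIntegrable (fun x => B (φ x) (g x)) volume a b := by
    intro a b
    obtain ⟨C, hC⟩ := (isCompact_uIcc (a := a) (b := b)).exists_bound_of_continuousOn
      h.continuous.continuousOn
    refine ((h'.1 a b).norm.const_mul (‖B‖ * C)).mono_fun' ?_ ?_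
    · exact B.aestronglyMeasurable_comp₂ h.continuous.aestronglyMeasurable
        (intervalIntegrable_iff.1 (h'.1 a b)).aestronglyMeasurable
    · refine (ae_restrict_iff' measurableSet_uIoc).2 (.of_forall fun x hx => ?_)
      refine (B.le_opNorm₂ _ _).trans ?_
      have := hC x (uIoc_subset_uIcc hx)
      have h1 : ‖B‖ * ‖φ x‖ * ‖g x‖ ≤ ‖B‖ * C * ‖g x‖ := by gcongr
      linarith
  refine ⟨fun a b => (hint1 a b).add (hint2 a b), ?_⟩
  have key : ∀ a b, a ≤ b → B (φ b) (ψ b) - B (φ a) (ψ a) =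
      ∫ x in a..b, (B (f x) (ψ x) + B (φ x) (g x)) := by
    intro a b hab
    set μ : Measure ℝ := volume.restrict (Ioc a b) with hμ
    have hf : Integrable f μ := (h.1 a b).1
    have hg : Integrable g μ := (h'.1 a b).1
    -- The derivatives are merely integrable, so the product rule is proved by Fubini: integrate `B
    -- (f x) (g y)` over the square and split it along the diagonal. The two triangles give the two
    -- terms of the rule, up to boundary values at `a`.
    have hprod : Integrable (fun p : ℝ × ℝ => B (f p.1) (g p.2)) (μ.prod μ) :=
      hf.op_fst_snd (op := fun x y => B x y) (by fun_prop) ⟨‖B‖, B.le_opNorm₂⟩ hg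
    have hT : MeasurableSet {p : ℝ × ℝ | p.2 ≤ p.1} := measurableSet_le measurable_snd measurable_fst
    have hI1 := hprod.indicator hT
    have hI2 := hprod.indicator hT.compl
    have hsplit : ∫ p, B (f p.1) (g p.2) ∂(μ.prod μ) =
        (∫ p, {p : ℝ × ℝ | p.2 ≤ p.1}.indicator (fun p => B (f p.1) (g p.2)) p ∂(μ.prod μ)) +
        ∫ p, {p : ℝ × ℝ | p.2 ≤ p.1}ᶜ.indicator (fun p => B (f p.1) (g p.2)) p ∂(μ.prod μ) := by
      rw [← integral_add hI1 hI2]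
      refine integral_congr_ae (.of_forall fun p => ?_)
      exact (congrFun (indicator_self_add_compl {p : ℝ × ℝ | p.2 ≤ p.1}
        (fun p => B (f p.1) (g p.2))) p).symm
    have e1 : (∫ p, {p : ℝ × ℝ | p.2 ≤ p.1}.indicator (fun p => B (f p.1) (g p.2)) p ∂(μ.prod μ))
        = ∫ x in a..b, B (f x) (ψ x - ψ a) := by
      rw [integral_prod _ hI1, intervalIntegral.integral_of_le hab]
      refine integral_congr_ae ((ae_restrict_iff' measurableSet_Ioc).2 (.of_forall fun x hx => ?_))
      have : (fun y => {p : ℝ × ℝ | p.2 ≤ p.1}.indicator (fun p => B (f p.1) (g p.2)) (x, y)) =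
          (Iic x).indicator fun y => B (f x) (g y) := by
        ext y; simp [indicator]
      simp only [this]
      rw [integral_indicator measurableSet_Iic, hμ, Measure.restrict_restrict measurableSet_Iic,
        Iic_inter_Ioc_of_le hx.2, h'.2 a x,
        intervalIntegral.integral_of_le hx.1.le, (B (f x)).integral_comp_comm]
      exact (h'.1 a x).1
    have e2 : (∫ p, {p : ℝ × ℝ | p.2 ≤ p.1}ᶜ.indicator (fun p => B (f p.1) (g p.2)) p ∂(μ.prod μ))
        = ∫ y in a..b, B (φ y - φ a) (g y) := by
      rw [integral_prod_symm _ hI2, intervalIntegral.integral_of_le hab]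
      refine integral_congr_ae ((ae_restrict_iff' measurableSet_Ioc).2 (.of_forall fun y hy => ?_))
      have : (fun x => {p : ℝ × ℝ | p.2 ≤ p.1}ᶜ.indicator (fun p => B (f p.1) (g p.2)) (x, y)) =
          (Iio y).indicator fun x => B.flip (g y) (f x) := by
        ext x; simp [indicator]
      simp only [this]
      rw [integral_indicator measurableSet_Iio, hμ, Measure.restrict_restrict measurableSet_Iio,
        h.2 a y, intervalIntegral.integral_of_le hy.1.le, integral_Ioc_eq_integral_Ioo,
        show Iio y ∩ Ioc a b = Ioo a y by
          ext t; simp only [mem_inter_iff, mem_Iio, mem_Ioc, mem_Ioo]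
          exact ⟨fun H => ⟨H.2.1, H.1⟩, fun H => ⟨H.2, H.1, H.2.le.trans hy.2⟩⟩,
        (B.flip (g y)).integral_comp_comm]
      · simp
      · exact ((h.1 a y).1).mono_set Ioo_subset_Ioc_self
    have e0 : ∫ p, B (f p.1) (g p.2) ∂(μ.prod μ) = B (φ b - φ a) (ψ b - ψ a) := by
      rw [integral_prod _ hprod, h.2, h'.2, intervalIntegral.integral_of_le hab,
        intervalIntegral.integral_of_le hab]
      simp only [ContinuousLinearMap.integral_comp_comm _ hg]
      exact (B.flip (∫ y, g y ∂μ)).integral_comp_comm hf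
    rw [e0, e1, e2] at hsplit
    have i1 : IntervalIntegrable (fun x => B (f x) (ψ a)) volume a b :=
      ((h.clm (B.flip (ψ a))).1 a b)
    have i2 : IntervalIntegrable (fun x => B (φ a) (g x)) volume a b :=
      ((h'.clm (B (φ a))).1 a b)
    have j1 : ∫ x in a..b, B (f x) (ψ a) = B (φ b - φ a) (ψ a) := by
      have := (h.clm (B.flip (ψ a))).2 a b
      simp only [ContinuousLinearMap.flip_apply] at this
      rw [← this]; simp
    have j2 : ∫ x in a..b, B (φ a) (g x) = B (φ a) (ψ b - ψ a) := by
      rw [← (h'.clm (B (φ a))).2 a b]; simp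
    simp only [map_sub, _root_.sub_apply] at hsplit j1 j2
    rw [intervalIntegral.integral_sub (hint1 a b) i1, intervalIntegral.integral_sub (hint2 a b) i2,
      j1, j2] at hsplit
    rw [intervalIntegral.integral_add (hint1 a b) (hint2 a b)]
    rw [← sub_eq_zero] at hsplit ⊢
    rw [← hsplit]
    abel
  intro a b
  rcases le_total a b with hab | hab
  · exact key a b hab
  · rw [intervalIntegral.integral_symm, ← key b a hab]; abel

theorem IsPrim.mul {A : Type*} [NormedRing A] [NormedAlgebra ℝ A] [CompleteSpace A]
    {φ f ψ g : ℝ → A} (h : IsPrim φ f) (h' : IsPrim ψ g) :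
    IsPrim (fun x => φ x * ψ x) (fun x => f x * ψ x + φ x * g x) :=
  h.bilin (ContinuousLinearMap.mul ℝ A) h'

theorem IsPrim.integral_Ioi {φ f : ℝ → E} (h : IsPrim φ f) (hf : Integrable f) (x : ℝ) :
    Tendsto φ atTop (𝓝 (φ x + ∫ y in Ioi x, f y)) := by
  have : φ = fun b => φ x + ∫ y in x..b, f y := funext fun b => h.eq_add x b
  conv => enter [1]; rw [this]
  exact tendsto_const_nhds.add
    (intervalIntegral_tendsto_integral_Ioi x hf.integrableOn tendsto_id)

theorem IsPrim.integral_Iic {φ f : ℝ → E} (h : IsPrim φ f) (hf : Integrable f) (x : ℝ) :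
    Tendsto φ atBot (𝓝 (φ x - ∫ y in Iic x, f y)) := by
  have : φ = fun b => φ x - ∫ y in b..x, f y := funext fun b => by rw [← h.2 b x]; abel
  conv => enter [1]; rw [this]
  exact tendsto_const_nhds.sub
    (intervalIntegral_tendsto_integral_Iic x hf.integrableOn tendsto_id)

theorem IsPrim.eq_integral_Iic {φ f : ℝ → E} {e : E} (h : IsPrim φ f) (hf : Integrable f)
    (he : Tendsto φ atBot (𝓝 e)) (x : ℝ) : φ x = e + ∫ y in Iic x, f y := by
  rw [tendsto_nhds_unique he (h.integral_Iic hf x)]; abel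

theorem IsPrim.eq_integral_Ioi {φ f : ℝ → E} {e : E} (h : IsPrim φ f) (hf : Integrable f)
    (he : Tendsto φ atTop (𝓝 e)) (x : ℝ) : φ x = e - ∫ y in Ioi x, f y := by
  rw [tendsto_nhds_unique he (h.integral_Ioi hf x)]; abel

theorem IsPrim.integral_eq {φ f : ℝ → E} {e e' : E} (h : IsPrim φ f) (hf : Integrable f)
    (he : Tendsto φ atBot (𝓝 e)) (he' : Tendsto φ atTop (𝓝 e')) : ∫ y, f y = e' - e := by
  have h1 := h.eq_integral_Iic hf he 0
  have h2 := h.eq_integral_Ioi hf he' 0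
  rw [← intervalIntegral.integral_Iic_add_Ioi (b := 0) hf.integrableOn hf.integrableOn]
  rw [h1] at h2
  rw [← sub_eq_zero] at h2 ⊢
  rw [← h2]; abel

theorem isPrim_integral_Iic {f : ℝ → E} (hf : Integrable f) :
    IsPrim (fun x => ∫ y in Iic x, f y) f :=
  ⟨fun _ _ => hf.intervalIntegrable, fun _ _ =>
    intervalIntegral.integral_Iic_sub_Iic hf.integrableOn hf.integrableOn⟩

theorem tendsto_integral_Iic_atBot {f : ℝ → E} (hf : Integrable f) :
    Tendsto (fun x => ∫ y in Iic x, f y) atBot (𝓝 0) := by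
  simpa using (isPrim_integral_Iic hf).integral_Iic hf 0

theorem isPrim_integral_Ioi {f : ℝ → E} (hf : Integrable f) :
    IsPrim (fun x => ∫ y in Ioi x, f y) (fun x => -f x) := by
  have h : ∀ x, (∫ y, f y) - ∫ y in Iic x, f y = ∫ y in Ioi x, f y := fun x => by
    rw [← intervalIntegral.integral_Iic_add_Ioi (b := x) hf.integrableOn hf.integrableOn]; abel
  simpa using ((isPrim_const (∫ y, f y)).sub (isPrim_integral_Iic hf)).congr_left h

theorem tendsto_integral_Ioi_atTop {f : ℝ → E} (hf : Integrable f) :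
    Tendsto (fun x => ∫ y in Ioi x, f y) atTop (𝓝 0) := by
  simpa [integral_neg] using (isPrim_integral_Ioi hf).integral_Ioi hf.neg 0

theorem tendsto_integral_Ioi_atBot {f : ℝ → E} (hf : Integrable f) :
    Tendsto (fun x => ∫ y in Ioi x, f y) atBot (𝓝 (∫ y, f y)) := by
  have h := (isPrim_integral_Ioi hf).integral_Iic hf.neg 0
  rwa [integral_neg, sub_neg_eq_add, add_comm,
    intervalIntegral.integral_Iic_add_Ioi hf.integrableOn hf.integrableOn] at h

end Primitive

/-! ### Linear Volterra equations on the line with integrable coefficient. -/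

section Volterra

variable {E F G : Type*} [NormedAddCommGroup E] [NormedSpace ℝ E]
  [NormedAddCommGroup F] [NormedSpace ℝ F] [NormedAddCommGroup G] [NormedSpace ℝ G]

theorem integrable_bilin {α : Type*} [MeasurableSpace α] {μ : Measure α}
    (B : E →L[ℝ] F →L[ℝ] G) {f : α → E} {g : α → F} {C : ℝ} (hf : Integrable f μ)
    (hg : AEStronglyMeasurable g μ) (hC : ∀ x, ‖g x‖ ≤ C) :
    Integrable (fun x => B (f x) (g x)) μ := by
  refine (hf.norm.const_mul (‖B‖ * C)).mono' (B.aestronglyMeasurable_comp₂ hf.1 hg)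
    (.of_forall fun x => (B.le_opNorm₂ _ _).trans ?_)
  have h1 : ‖B‖ * ‖f x‖ * ‖g x‖ ≤ ‖B‖ * ‖f x‖ * C := by gcongr; exact hC x
  linarith

theorem integrable_clm_apply {L : ℝ → E →L[ℝ] F} {g : ℝ → E} {C : ℝ} (hL : Integrable L)
    (hg : Continuous g) (hC : ∀ x, ‖g x‖ ≤ C) : Integrable (fun x => L x (g x)) :=
  integrable_bilin (ContinuousLinearMap.id ℝ (E →L[ℝ] F)) hL hg.aestronglyMeasurable hC

theorem integral_Iic_mono {h : ℝ → ℝ} (hh : Integrable h) (h0 : ∀ x, 0 ≤ h x) (x : ℝ) :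
    0 ≤ ∫ y in Iic x, h y ∧ ∫ y in Iic x, h y ≤ ∫ y, h y :=
  ⟨integral_nonneg h0, setIntegral_le_integral hh (.of_forall h0)⟩

/-- `∫_{-∞}^x h Hⁿ = Hⁿ⁺¹ / (n+1)` for `H(x) = ∫_{-∞}^x h`. -/
theorem integral_mul_primitive_pow {h : ℝ → ℝ} (hh : Integrable h) (h0 : ∀ x, 0 ≤ h x) (n : ℕ) :
    Integrable (fun y => h y * (∫ t in Iic y, h t) ^ n) ∧
    ∀ x, ∫ y in Iic x, h y * (∫ t in Iic y, h t) ^ n = (∫ t in Iic x, h t) ^ (n + 1) / (n + 1) := by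
  set H : ℝ → ℝ := fun x => ∫ t in Iic x, h t with hH
  have hp : IsPrim H h := isPrim_integral_Iic hh
  have hpow : ∀ n : ℕ, IsPrim (fun x => H x ^ (n + 1)) (fun x => (n + 1) * (h x * H x ^ n)) := by
    intro n
    induction n with
    | zero => simpa using hp
    | succ n ih =>
      refine ((ih.mul hp).congr fun x => ?_).congr_left fun x => ?_
      · push_cast; ring
      · ring
  have hint : Integrable (fun y => h y * H y ^ n) := by
    refine integrable_bilin (ContinuousLinearMap.mul ℝ ℝ) (C := (∫ y, h y) ^ n) hh
      (hp.continuous.pow n).aestronglyMeasurable fun x => ?_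
    have := integral_Iic_mono hh h0 x
    rw [norm_pow, Real.norm_of_nonneg this.1]
    exact pow_le_pow_left₀ this.1 this.2 n
  refine ⟨hint, fun x => ?_⟩
  have hlim : Tendsto (fun x => H x ^ (n + 1)) atBot (𝓝 0) := by
    simpa using (tendsto_integral_Iic_atBot hh).pow (n + 1)
  have := (hpow n).eq_integral_Iic (hint.const_mul _) hlim x
  rw [integral_const_mul, zero_add] at this
  rw [eq_div_iff (by positivity)]
  simp only [hH] at this ⊢
  linarith

/-- Picard iterates of `F(x) = e + ∫_{-∞}^x L F`. -/
noncomputable def picard (L : ℝ → E →L[ℝ] E) (e : E) : ℕ → ℝ → E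
  | 0 => fun _ => e
  | n + 1 => fun x => ∫ y in Iic x, L y (picard L e n y)

/-- The solution of `F(x) = e + ∫_{-∞}^x L F`. -/
noncomputable def volterra (L : ℝ → E →L[ℝ] E) (e : E) (x : ℝ) : E := ∑' n, picard L e n x

/-- One Picard step gains a factor of the exponential series. It serves twice: for the convergence
of the iterates, and for uniqueness, where a solution of the homogeneous equation is bounded by
every term of the series and hence vanishes. -/
theorem norm_integral_Iic_le_pow {L : ℝ → E →L[ℝ] E} (hL : Integrable L) {g : ℝ → E} {K : ℝ}
    {n : ℕ} (hg : ∀ x, ‖g x‖ ≤ K * ((∫ y in Iic x, ‖L y‖) ^ n / n.factorial)) (x : ℝ) :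
    ‖∫ y in Iic x, L y (g y)‖ ≤ K * ((∫ y in Iic x, ‖L y‖) ^ (n + 1) / (n + 1).factorial) := by
  obtain ⟨hi, he⟩ := integral_mul_primitive_pow hL.norm (fun x => norm_nonneg _) n
  have hstep : ‖∫ y in Iic x, L y (g y)‖ ≤
      ∫ y in Iic x, (K / n.factorial) * (‖L y‖ * (∫ t in Iic y, ‖L t‖) ^ n) := by
    refine norm_integral_le_of_norm_le (hi.const_mul _).integrableOn (.of_forall fun y => ?_)
    refine ((L y).le_opNorm _).trans ?_
    calc ‖L y‖ * ‖g y‖ ≤ ‖L y‖ * (K * ((∫ y in Iic y, ‖L y‖) ^ n / n.factorial)) := by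
          gcongr; exact hg y
      _ = _ := by ring
  refine hstep.trans (le_of_eq ?_)
  rw [integral_const_mul, he, Nat.factorial_succ]
  push_cast
  field_simp

variable {L : ℝ → E →L[ℝ] E} {e : E}

theorem picard_spec (hL : Integrable L) (e : E) (n : ℕ) :
    Continuous (picard L e n) ∧
      ∀ x, ‖picard L e n x‖ ≤ ‖e‖ * ((∫ y in Iic x, ‖L y‖) ^ n / n.factorial) := by
  induction n with
  | zero => exact ⟨continuous_const, fun x => by simp [picard]⟩
  | succ n ih =>
    refine ⟨?_, fun x => norm_integral_Iic_le_pow hL ih.2 x⟩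
    refine (isPrim_integral_Iic (integrable_clm_apply hL ih.1 (C := ‖e‖ *
      ((∫ y, ‖L y‖) ^ n / n.factorial)) fun x => (ih.2 x).trans ?_)).continuous
    have := integral_Iic_mono hL.norm (fun x => norm_nonneg _) x
    have h2 := pow_le_pow_left₀ this.1 this.2 n
    gcongr

theorem summable_picard_bound (L : ℝ → E →L[ℝ] E) (e : E) :
    HasSum (fun n : ℕ => ‖e‖ * ((∫ y, ‖L y‖) ^ n / n.factorial))
      (‖e‖ * Real.exp (∫ y, ‖L y‖)) := by
  have := (NormedSpace.expSeries_div_hasSum_exp (∫ y, ‖L y‖)).mul_left ‖e‖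
  rwa [← Real.exp_eq_exp_ℝ] at this

theorem picard_le (hL : Integrable L) (e : E) (n : ℕ) (x : ℝ) :
    ‖picard L e n x‖ ≤ ‖e‖ * ((∫ y, ‖L y‖) ^ n / n.factorial) := by
  refine ((picard_spec hL e n).2 x).trans ?_
  have := integral_Iic_mono hL.norm (fun x => norm_nonneg _) x
  have h2 := pow_le_pow_left₀ this.1 this.2 n
  gcongr

theorem norm_volterra_le (hL : Integrable L) (e : E) (x : ℝ) :
    ‖volterra L e x‖ ≤ ‖e‖ * Real.exp (∫ y, ‖L y‖) :=
  tsum_of_norm_bounded (summable_picard_bound L e) fun n => picard_le hL e n x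

variable [CompleteSpace E]

/-- The series of iterates is dominated by an exponential series uniformly in `x`, so it may be
integrated term by term; this only shifts the index of summation. -/
theorem volterra_eq (hL : Integrable L) (e : E) (x : ℝ) :
    volterra L e x = e + ∫ y in Iic x, L y (volterra L e y) := by
  have hsum : ∀ y, Summable fun n => picard L e n y := fun y =>
    Summable.of_norm_bounded (summable_picard_bound L e).summable fun n => picard_le hL e n y
  have hint : ∀ n, Integrable (fun y => L y (picard L e n y)) := fun n =>
    integrable_clm_apply hL (picard_spec hL e n).1 (picard_le hL e n)
  have key := hasSum_integral_of_summable_integral_norm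
    (μ := volume.restrict (Iic x)) (F := fun n y => L y (picard L e n y))
    (fun n => (hint n).integrableOn) (by
      refine Summable.of_nonneg_of_le (fun n => integral_nonneg fun _ => norm_nonneg _)
        (fun n => ?_) ((summable_picard_bound L e).summable.mul_left (∫ y, ‖L y‖))
      rw [← integral_mul_const]
      refine (setIntegral_le_integral (hint n).norm (.of_forall fun _ => norm_nonneg _)).trans ?_
      refine integral_mono (hint n).norm (hL.norm.mul_const _) fun y => ?_
      refine ((L y).le_opNorm _).trans ?_
      gcongr
      exact picard_le hL e n y)
  have e1 : ∀ y, ∑' n, L y (picard L e n y) = L y (volterra L e y) := fun y =>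
    ((L y).map_tsum (hsum y)).symm
  simp only [e1] at key
  rw [← key.tsum_eq, volterra, (hsum x).tsum_eq_zero_add]
  rfl

theorem integrable_volterra (hL : Integrable L) (e : E) :
    Integrable fun y => L y (volterra L e y) := by
  refine integrable_bilin (ContinuousLinearMap.id ℝ (E →L[ℝ] E)) hL ?_ (norm_volterra_le hL e)
  refine aestronglyMeasurable_of_tendsto_ae atTop
    (f := fun n y => ∑ i ∈ Finset.range n, picard L e i y) (fun n => ?_) (.of_forall fun y => ?_)
  · exact (continuous_finsetSum _ fun i _ => (picard_spec hL e i).1).aestronglyMeasurable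
  · exact (Summable.of_norm_bounded (summable_picard_bound L e).summable
      fun n => picard_le hL e n y).hasSum.tendsto_sum_nat

theorem isPrim_volterra (hL : Integrable L) (e : E) :
    IsPrim (volterra L e) (fun y => L y (volterra L e y)) := by
  have := (isPrim_const e).add (isPrim_integral_Iic (integrable_volterra hL e))
  simp only [zero_add] at this
  exact this.congr_left fun x => (volterra_eq hL e x).symm

theorem tendsto_volterra_atBot (hL : Integrable L) (e : E) :
    Tendsto (volterra L e) atBot (𝓝 e) := by
  have := (tendsto_integral_Iic_atBot (integrable_volterra hL e)).const_add e
  rw [add_zero] at this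
  exact this.congr fun x => (volterra_eq hL e x).symm

/-- A bounded solution of `F' = L F` vanishing at `-∞` is zero. -/
theorem IsPrim.eq_zero_of_tendsto (hL : Integrable L) {D : ℝ → E} {K : ℝ}
    (hD : IsPrim D fun x => L x (D x)) (hK : ∀ x, ‖D x‖ ≤ K) (h0 : Tendsto D atBot (𝓝 0))
    (x : ℝ) : D x = 0 := by
  have hint := integrable_clm_apply hL hD.continuous hK
  have heq : ∀ x, D x = ∫ y in Iic x, L y (D y) := fun x => by
    simpa using hD.eq_integral_Iic hint h0 x
  have hb : ∀ n : ℕ, ∀ x, ‖D x‖ ≤ K * ((∫ y in Iic x, ‖L y‖) ^ n / n.factorial) := by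
    intro n
    induction n with
    | zero => simpa using hK
    | succ n ih =>
      intro x
      rw [heq x]
      exact norm_integral_Iic_le_pow hL ih x
  have hlim := (FloorSemiring.tendsto_pow_div_factorial_atTop (∫ y in Iic x, ‖L y‖)).const_mul K
  rw [mul_zero] at hlim
  exact norm_le_zero_iff.1 (ge_of_tendsto' hlim fun n => hb n x)

theorem IsPrim.eq_of_tendsto (hL : Integrable L) {D D' : ℝ → E} {K K' : ℝ}
    (hD : IsPrim D fun x => L x (D x)) (hD' : IsPrim D' fun x => L x (D' x))
    (hK : ∀ x, ‖D x‖ ≤ K) (hK' : ∀ x, ‖D' x‖ ≤ K')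
    (h0 : Tendsto D atBot (𝓝 e)) (h0' : Tendsto D' atBot (𝓝 e)) (x : ℝ) : D x = D' x := by
  have h := (hD.sub hD').congr (g := fun x => L x (D x - D' x)) fun x => (map_sub _ _ _).symm
  refine sub_eq_zero.1 (h.eq_zero_of_tendsto hL (K := K + K') (fun x => ?_) ?_ x)
  · exact (norm_sub_le _ _).trans (add_le_add (hK x) (hK' x))
  · simpa using h0.sub h0'

end Volterra

/-! ### Propagators in a Banach algebra, their inverses and their limits at infinity. -/

section Propagator

variable {A : Type*} [NormedRing A] [NormedAlgebra ℝ A] [NormOneClass A]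

/-- The solution of `T' = P T` with `T → 1` at `-∞`. -/
noncomputable def fwd (P : ℝ → A) : ℝ → A :=
  volterra (fun x => ContinuousLinearMap.mul ℝ A (P x)) 1

/-- The solution of `S' = -S P` with `S → 1` at `-∞`. -/
noncomputable def bwd (P : ℝ → A) : ℝ → A :=
  volterra (fun x => (ContinuousLinearMap.mul ℝ A).flip (-P x)) 1

/-- The limit of `fwd P` at `+∞`. -/
noncomputable def fwdTop (P : ℝ → A) : A := 1 + ∫ x, P x * fwd P x

/-- The limit of `bwd P` at `+∞`. -/
noncomputable def bwdTop (P : ℝ → A) : A := 1 - ∫ x, bwd P x * P x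

variable {P : ℝ → A}

theorem integrable_mulLeft (hP : Integrable P) :
    Integrable fun x => ContinuousLinearMap.mul ℝ A (P x) :=
  (ContinuousLinearMap.mul ℝ A).integrable_comp hP

theorem integrable_mulRight (hP : Integrable P) :
    Integrable fun x => (ContinuousLinearMap.mul ℝ A).flip (-P x) :=
  (ContinuousLinearMap.mul ℝ A).flip.integrable_comp hP.neg

theorem norm_fwd_le (hP : Integrable P) {M : ℝ} (hM : ∫ x, ‖P x‖ ≤ M) (x : ℝ) :
    ‖fwd P x‖ ≤ Real.exp M := by
  refine (norm_volterra_le (integrable_mulLeft hP) 1 x).trans ?_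
  rw [norm_one, one_mul]
  refine Real.exp_le_exp.2 (le_trans ?_ hM)
  exact integral_mono (integrable_mulLeft hP).norm hP.norm fun x =>
    ContinuousLinearMap.opNorm_mul_apply_le ℝ A (P x)

theorem norm_bwd_le (hP : Integrable P) {M : ℝ} (hM : ∫ x, ‖P x‖ ≤ M) (x : ℝ) :
    ‖bwd P x‖ ≤ Real.exp M := by
  refine (norm_volterra_le (integrable_mulRight hP) 1 x).trans ?_
  rw [norm_one, one_mul]
  refine Real.exp_le_exp.2 (le_trans ?_ hM)
  refine integral_mono (integrable_mulRight hP).norm hP.norm fun x => ?_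
  refine ContinuousLinearMap.opNorm_le_bound _ (norm_nonneg _) fun y => ?_
  simpa [mul_comm] using norm_mul_le y (P x)

variable [CompleteSpace A]

theorem isPrim_fwd (hP : Integrable P) : IsPrim (fwd P) fun x => P x * fwd P x :=
  isPrim_volterra (integrable_mulLeft hP) 1

theorem isPrim_bwd (hP : Integrable P) : IsPrim (bwd P) fun x => -(bwd P x * P x) :=
  (isPrim_volterra (integrable_mulRight hP) 1).congr fun x => by simp [bwd]

theorem tendsto_fwd_atBot (hP : Integrable P) : Tendsto (fwd P) atBot (𝓝 1) :=
  tendsto_volterra_atBot (integrable_mulLeft hP) 1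

theorem tendsto_bwd_atBot (hP : Integrable P) : Tendsto (bwd P) atBot (𝓝 1) :=
  tendsto_volterra_atBot (integrable_mulRight hP) 1

theorem integrable_mul_fwd (hP : Integrable P) : Integrable fun x => P x * fwd P x :=
  integrable_volterra (integrable_mulLeft hP) 1

theorem integrable_bwd_mul (hP : Integrable P) : Integrable fun x => bwd P x * P x := by
  simpa [bwd] using (integrable_volterra (integrable_mulRight hP) 1).neg

theorem tendsto_fwd_atTop (hP : Integrable P) : Tendsto (fwd P) atTop (𝓝 (fwdTop P)) := by
  have h := (isPrim_fwd hP).integral_Ioi (integrable_mul_fwd hP) 0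
  have h2 := (isPrim_fwd hP).eq_integral_Iic (integrable_mul_fwd hP) (tendsto_fwd_atBot hP) 0
  rwa [h2, add_assoc, intervalIntegral.integral_Iic_add_Ioi
    (integrable_mul_fwd hP).integrableOn (integrable_mul_fwd hP).integrableOn] at h

theorem tendsto_bwd_atTop (hP : Integrable P) : Tendsto (bwd P) atTop (𝓝 (bwdTop P)) := by
  have hi : Integrable fun x => -(bwd P x * P x) := (integrable_bwd_mul hP).neg
  have h := (isPrim_bwd hP).integral_Ioi hi 0
  have h2 := (isPrim_bwd hP).eq_integral_Iic hi (tendsto_bwd_atBot hP) 0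
  rwa [h2, add_assoc, intervalIntegral.integral_Iic_add_Ioi hi.integrableOn hi.integrableOn,
    integral_neg, ← sub_eq_add_neg] at h

/-- The product has derivative zero and tends to `1` at `-∞`. -/
theorem bwd_mul_fwd (hP : Integrable P) (x : ℝ) : bwd P x * fwd P x = 1 := by
  have h := ((isPrim_bwd hP).mul (isPrim_fwd hP)).congr (g := fun _ => 0) fun x => by
    simp [mul_assoc]
  have hlim := (tendsto_bwd_atBot hP).mul (tendsto_fwd_atBot hP)
  rw [mul_one] at hlim
  exact tendsto_nhds_unique (tendsto_const_nhds.congr fun y => h.const_of_zero x y) hlim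

/-- In this order the derivative does not vanish identically, and in a general Banach algebra a left
inverse need not be a right inverse. Instead the product solves `D' = PD - DP`, as does the constant
`1`, and bounded solutions with the same limit at `-∞` agree. -/
theorem fwd_mul_bwd (hP : Integrable P) (x : ℝ) : fwd P x * bwd P x = 1 := by
  have hL : Integrable fun x => ContinuousLinearMap.mul ℝ A (P x) -
      (ContinuousLinearMap.mul ℝ A).flip (P x) := by
    refine (integrable_mulLeft hP).sub ?_
    exact (ContinuousLinearMap.mul ℝ A).flip.integrable_comp hP
  have h := ((isPrim_fwd hP).mul (isPrim_bwd hP)).congr (g := fun x =>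
    (ContinuousLinearMap.mul ℝ A (P x) - (ContinuousLinearMap.mul ℝ A).flip (P x))
      (fwd P x * bwd P x)) fun x => by simp [mul_assoc, sub_eq_add_neg]
  have h1 := (isPrim_const (1 : A)).congr (g := fun x =>
    (ContinuousLinearMap.mul ℝ A (P x) - (ContinuousLinearMap.mul ℝ A).flip (P x)) 1)
      fun x => by simp
  have hlim := (tendsto_fwd_atBot hP).mul (tendsto_bwd_atBot hP)
  rw [mul_one] at hlim
  refine h.eq_of_tendsto hL h1 (K := Real.exp (∫ x, ‖P x‖) * Real.exp (∫ x, ‖P x‖)) (K' := 1)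
    (fun x => ?_) (fun x => by simp) hlim tendsto_const_nhds x
  refine (norm_mul_le _ _).trans ?_
  gcongr
  exacts [norm_fwd_le hP le_rfl x, norm_bwd_le hP le_rfl x]

theorem norm_fwdTop_le (hP : Integrable P) {M : ℝ} (hM : ∫ x, ‖P x‖ ≤ M) :
    ‖fwdTop P‖ ≤ Real.exp M :=
  le_of_tendsto' (tendsto_fwd_atTop hP).norm fun x => norm_fwd_le hP hM x

theorem bwdTop_mul_fwdTop (hP : Integrable P) : bwdTop P * fwdTop P = 1 :=
  tendsto_nhds_unique ((tendsto_bwd_atTop hP).mul (tendsto_fwd_atTop hP))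
    (tendsto_const_nhds.congr fun x => (bwd_mul_fwd hP x).symm)

theorem fwdTop_mul_bwdTop (hP : Integrable P) : fwdTop P * bwdTop P = 1 :=
  tendsto_nhds_unique ((tendsto_fwd_atTop hP).mul (tendsto_bwd_atTop hP))
    (tendsto_const_nhds.congr fun x => (fwd_mul_bwd hP x).symm)

/-! ### Dependence on the coefficient -/

theorem integrable_bwd_mul_mul_fwd {P₁ P₂ R : ℝ → A} (h1 : Integrable P₁) (h2 : Integrable P₂)
    (hR : Integrable R) : Integrable fun x => bwd P₁ x * R x * fwd P₂ x := by
  have i1 : Integrable fun x => bwd P₁ x * R x :=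
    integrable_bilin (ContinuousLinearMap.mul ℝ A).flip hR
      (isPrim_bwd h1).continuous.aestronglyMeasurable (norm_bwd_le h1 le_rfl)
  exact integrable_bilin (ContinuousLinearMap.mul ℝ A) i1
      (isPrim_fwd h2).continuous.aestronglyMeasurable (norm_fwd_le h2 le_rfl)

/-- Variation of constants: `S₁T₂` has derivative `S₁(P₂ - P₁)T₂`, which is integrated from `-∞` and
multiplied by `T₁`. -/
theorem fwd_sub_fwd {P₁ P₂ : ℝ → A} (h1 : Integrable P₁) (h2 : Integrable P₂) (x : ℝ) :
    fwd P₁ x - fwd P₂ x = fwd P₁ x * ∫ y in Iic x, -(bwd P₁ y * (P₂ y - P₁ y) * fwd P₂ y) := by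
  have h := ((isPrim_bwd h1).mul (isPrim_fwd h2)).congr
    (g := fun x => bwd P₁ x * (P₂ x - P₁ x) * fwd P₂ x) fun x => by noncomm_ring
  have hlim := (tendsto_bwd_atBot h1).mul (tendsto_fwd_atBot h2)
  rw [mul_one] at hlim
  have := h.eq_integral_Iic (integrable_bwd_mul_mul_fwd h1 h2 (h2.sub h1)) hlim x
  rw [integral_neg, ← sub_eq_iff_eq_add'.2 this, mul_neg, mul_sub, ← mul_assoc, fwd_mul_bwd h1]
  simp

/-- The same identity integrated over the whole line. Every `L²` estimate of differences of transfer
matrices starts from it. -/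
theorem fwdTop_sub_fwdTop {P₁ P₂ : ℝ → A} (h1 : Integrable P₁) (h2 : Integrable P₂) :
    fwdTop P₁ - fwdTop P₂ = fwdTop P₁ * ∫ y, bwd P₁ y * (P₁ y - P₂ y) * fwd P₂ y := by
  have h := ((isPrim_bwd h1).mul (isPrim_fwd h2)).congr
    (g := fun x => -(bwd P₁ x * (P₁ x - P₂ x) * fwd P₂ x)) fun x => by noncomm_ring
  have hlim := (tendsto_bwd_atBot h1).mul (tendsto_fwd_atBot h2)
  rw [mul_one] at hlim
  have hlim' := (tendsto_bwd_atTop h1).mul (tendsto_fwd_atTop h2)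
  have := h.integral_eq (integrable_bwd_mul_mul_fwd h1 h2 (h1.sub h2)).neg hlim hlim'
  rw [integral_neg] at this
  rw [neg_eq_iff_eq_neg.1 this, neg_sub, mul_sub, ← mul_assoc, fwdTop_mul_bwdTop h1]
  simp

theorem norm_fwd_sub_fwd_le {P₁ P₂ : ℝ → A} (h1 : Integrable P₁) (h2 : Integrable P₂) {M δ : ℝ}
    (hM1 : ∫ x, ‖P₁ x‖ ≤ M) (hM2 : ∫ x, ‖P₂ x‖ ≤ M) (hδ : ∫ x, ‖P₁ x - P₂ x‖ ≤ δ) (x : ℝ) :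
    ‖fwd P₁ x - fwd P₂ x‖ ≤ Real.exp M ^ 3 * δ := by
  have hI : ‖∫ y in Iic x, -(bwd P₁ y * (P₂ y - P₁ y) * fwd P₂ y)‖ ≤
      ∫ y in Iic x, Real.exp M ^ 2 * ‖P₁ y - P₂ y‖ := by
    refine norm_integral_le_of_norm_le ((h1.sub h2).norm.const_mul _).integrableOn
      (.of_forall fun y => ?_)
    rw [norm_neg, norm_sub_rev (P₁ y)]
    calc ‖bwd P₁ y * (P₂ y - P₁ y) * fwd P₂ y‖ ≤ ‖bwd P₁ y‖ * ‖P₂ y - P₁ y‖ * ‖fwd P₂ y‖ :=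
          norm_mul₃_le
      _ ≤ Real.exp M * ‖P₂ y - P₁ y‖ * Real.exp M := by
          gcongr
          exacts [norm_bwd_le h1 hM1 y, norm_fwd_le h2 hM2 y]
      _ = _ := by ring
  have hJ : ∫ y in Iic x, Real.exp M ^ 2 * ‖P₁ y - P₂ y‖ ≤ Real.exp M ^ 2 * δ := by
    rw [integral_const_mul]
    gcongr
    exact (integral_Iic_mono (h1.sub h2).norm (fun x => norm_nonneg _) x).2.trans hδ
  rw [fwd_sub_fwd h1 h2]
  calc _ ≤ ‖fwd P₁ x‖ * ‖∫ y in Iic x, -(bwd P₁ y * (P₂ y - P₁ y) * fwd P₂ y)‖ := norm_mul_le _ _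
    _ ≤ Real.exp M * (Real.exp M ^ 2 * δ) := by
        gcongr
        exacts [norm_fwd_le h1 hM1 x, hI.trans hJ]
    _ = _ := by ring

theorem norm_bwd_sub_bwd_le {P₁ P₂ : ℝ → A} (h1 : Integrable P₁) (h2 : Integrable P₂) {M δ : ℝ}
    (hM1 : ∫ x, ‖P₁ x‖ ≤ M) (hM2 : ∫ x, ‖P₂ x‖ ≤ M) (hδ : ∫ x, ‖P₁ x - P₂ x‖ ≤ δ) (x : ℝ) :
    ‖bwd P₁ x - bwd P₂ x‖ ≤ Real.exp M ^ 5 * δ := by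
  have e : bwd P₁ x - bwd P₂ x = -(bwd P₁ x * (fwd P₁ x - fwd P₂ x) * bwd P₂ x) := by
    rw [mul_sub, sub_mul, bwd_mul_fwd h1, mul_assoc _ _ (bwd P₂ x), fwd_mul_bwd h2]; simp
  rw [e, norm_neg]
  calc _ ≤ ‖bwd P₁ x‖ * ‖fwd P₁ x - fwd P₂ x‖ * ‖bwd P₂ x‖ := norm_mul₃_le
    _ ≤ Real.exp M * (Real.exp M ^ 3 * δ) * Real.exp M := by
        have h3 := norm_fwd_sub_fwd_le h1 h2 hM1 hM2 hδ x
        have h4 := (norm_nonneg _).trans h3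
        gcongr
        exacts [norm_bwd_le h1 hM1 x, norm_bwd_le h2 hM2 x]
    _ = _ := by ring

theorem norm_fwdTop_sub_fwdTop_le {P₁ P₂ : ℝ → A} (h1 : Integrable P₁) (h2 : Integrable P₂)
    {M δ : ℝ} (hM1 : ∫ x, ‖P₁ x‖ ≤ M) (hM2 : ∫ x, ‖P₂ x‖ ≤ M) (hδ : ∫ x, ‖P₁ x - P₂ x‖ ≤ δ) :
    ‖fwdTop P₁ - fwdTop P₂‖ ≤ Real.exp M ^ 3 * δ :=
  le_of_tendsto' ((tendsto_fwd_atTop h1).sub (tendsto_fwd_atTop h2)).norm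
    fun x => norm_fwd_sub_fwd_le h1 h2 hM1 hM2 hδ x

end Propagator

/-! ### Plancherel's theorem for Fourier integrals over lines and half lines. -/

section Plancherel

open FourierTransform SchwartzMap

/-- The `L²` Fourier transform of a function in `L¹ ∩ L²` is given by the Fourier integral. -/
theorem fourier_toLp_ae_eq {k : ℝ → ℂ} (hk : Integrable k) (hk2 : MemLp k 2) :
    (𝓕 (hk2.toLp k) : Lp ℂ 2 (volume : Measure ℝ)) =ᵐ[volume] 𝓕 k := by
  have hcont : Continuous (𝓕 k) :=
    VectorFourier.fourierIntegral_continuous (L := innerₗ ℝ) Real.continuous_fourierChar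
      (by exact continuous_inner) hk
  refine ae_eq_of_integral_contDiff_smul_eq
    ((Lp.memLp _).locallyIntegrable (by norm_num)) hcont.locallyIntegrable fun g hg hc => ?_
  have hg₁ : HasCompactSupport (Complex.ofRealCLM ∘ g) := hc.comp_left rfl
  have hg₂ : ContDiff ℝ ((⊤ : ℕ∞) : WithTop ℕ∞) (Complex.ofRealCLM ∘ g) := by fun_prop
  set γ : 𝓢(ℝ, ℂ) := hg₁.toSchwartzMap hg₂ with hγ
  have e1 : ∫ x, g x • (𝓕 (hk2.toLp k) : Lp ℂ 2 (volume : Measure ℝ)) x =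
      Lp.toTemperedDistribution (𝓕 (hk2.toLp k)) γ := by
    rw [Lp.toTemperedDistribution_apply]; simp [hγ]
  have e2 : ∫ x, g x • 𝓕 k x = ∫ x, γ x • 𝓕 k x := by simp [hγ]
  -- Tested against `γ`, the transform passes to `γ` on both sides: by duality of tempered
  -- distributions for the `L²` transform, by Fubini for the integral.
  rw [e1, e2, ← Lp.fourier_toTemperedDistribution_eq, TemperedDistribution.fourier_apply,
    Lp.toTemperedDistribution_apply]
  have e3 : ∫ x, (𝓕 γ) x • (hk2.toLp k) x = ∫ x, (𝓕 γ) x • k x :=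
    integral_congr_ae (hk2.coeFn_toLp.mono fun x hx => by simp only [hx])
  rw [e3]
  have := VectorFourier.integral_fourierIntegral_smul_eq_flip (L := innerₗ ℝ)
    (μ := volume) (ν := volume) Real.continuous_fourierChar
      (by exact continuous_inner) γ.integrable hk
  simpa using! this

theorem eLpNorm_fourier_eq {k : ℝ → ℂ} (hk : Integrable k) (hk2 : MemLp k 2) :
    eLpNorm (𝓕 k) 2 = eLpNorm k 2 := by
  rw [← eLpNorm_congr_ae (fourier_toLp_ae_eq hk hk2), ← eLpNorm_congr_ae hk2.coeFn_toLp]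
  have h := Lp.norm_fourier_eq (hk2.toLp k)
  rw [Lp.norm_def, Lp.norm_def] at h
  exact (ENNReal.toReal_eq_toReal_iff' (Lp.memLp _).2.ne (Lp.memLp _).2.ne).1 h

/-- The Fourier integral over a half line. -/
noncomputable def tailFT (k : ℝ → ℂ) (ω t z : ℝ) : ℂ :=
  ∫ s in Ioi t, k s * exp (I * (ω * z * s))

/-- The Fourier integral over the line. -/
noncomputable def fullFT (k : ℝ → ℂ) (ω z : ℝ) : ℂ :=
  ∫ s, k s * exp (I * (ω * z * s))

theorem norm_exp_I_mul (a b c : ℝ) : ‖exp (I * (a * b * c))‖ = 1 := by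
  have := Complex.norm_exp_I_mul_ofReal (a * b * c)
  push_cast at this
  exact this

theorem integrable_mul_phase {k : ℝ → ℂ} (hk : Integrable k) (ω z : ℝ) :
    Integrable fun s : ℝ => k s * exp (I * (ω * z * s)) :=
  integrable_bilin (ContinuousLinearMap.mul ℝ ℂ) (C := 1) hk
    (Continuous.aestronglyMeasurable (by fun_prop)) fun x => (norm_exp_I_mul _ _ _).le

theorem fullFT_eq_fourier (k : ℝ → ℂ) (ω z : ℝ) :
    fullFT k ω z = 𝓕 k (-(ω / (2 * Real.pi)) * z) := by
  rw [fullFT, Real.fourier_real_eq_integral_exp_smul]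
  congr 1; ext s
  rw [smul_eq_mul, mul_comm]
  congr 2
  have := Real.pi_ne_zero
  push_cast
  field_simp

theorem continuous_fullFT {k : ℝ → ℂ} (hk : Integrable k) (ω : ℝ) : Continuous (fullFT k ω) := by
  have hcont : Continuous (𝓕 k) :=
    VectorFourier.fourierIntegral_continuous (L := innerₗ ℝ) Real.continuous_fourierChar
      (by exact continuous_inner) hk
  have : fullFT k ω = fun z => 𝓕 k (-(ω / (2 * Real.pi)) * z) :=
    funext fun z => fullFT_eq_fourier k ω z
  rw [this]
  exact hcont.comp (continuous_const_mul _)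

/-- In the normalisation of `𝓕` the frequency is rescaled by `|ω| / 2π = 1 / π`; the rescaling
multiplies the `L²` norm by `√π`, which is at most `2`. -/
theorem eLpNorm_fullFT_le {k : ℝ → ℂ} (hk : Integrable k) (hk2 : MemLp k 2) {ω : ℝ}
    (hω : |ω| = 2) : eLpNorm (fullFT k ω) 2 ≤ 2 * eLpNorm k 2 := by
  have hc : -(ω / (2 * Real.pi)) ≠ 0 := by
    have := Real.pi_ne_zero
    have : ω ≠ 0 := by rintro rfl; norm_num at hω
    simp [*]
  have hcont : Continuous (𝓕 k) :=
    VectorFourier.fourierIntegral_continuous (L := innerₗ ℝ) Real.continuous_fourierChar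
      (by exact continuous_inner) hk
  have e : fullFT k ω = 𝓕 k ∘ (-(ω / (2 * Real.pi)) * ·) :=
    funext fun z => fullFT_eq_fourier k ω z
  rw [e, ← eLpNorm_map_measure hcont.aestronglyMeasurable (measurable_const_mul _).aemeasurable,
    Real.map_volume_mul_left hc, eLpNorm_smul_measure_of_ne_top (by norm_num),
    eLpNorm_fourier_eq hk hk2, smul_eq_mul]
  gcongr
  have : |(-(ω / (2 * Real.pi)))⁻¹| = Real.pi := by
    rw [abs_inv, abs_neg, abs_div, hω, abs_of_pos (by positivity)]
    field_simp
  rw [this, show ((1 : ℝ≥0∞) / 2).toReal = 1 / 2 by simp, show (2 : ℝ≥0∞) = ENNReal.ofReal 2 by simp,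
    ENNReal.ofReal_rpow_of_pos Real.pi_pos]
  refine ENNReal.ofReal_le_ofReal ?_
  rw [← Real.sqrt_eq_rpow]
  exact Real.sqrt_le_iff.2 ⟨by norm_num, by nlinarith [Real.pi_lt_four]⟩

theorem tailFT_eq_fullFT (k : ℝ → ℂ) (ω t z : ℝ) :
    tailFT k ω t z = fullFT ((Ioi t).indicator k) ω z := by
  rw [tailFT, fullFT, ← integral_indicator measurableSet_Ioi]
  congr 1; ext s
  by_cases h : s ∈ Ioi t <;> simp [h]

/-- A tail is the full transform of a truncated function, so Plancherel gives a bound that is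
uniform in `t`. -/
theorem eLpNorm_tailFT_le {k : ℝ → ℂ} (hk : Integrable k) (hk2 : MemLp k 2) {ω : ℝ}
    (hω : |ω| = 2) (t : ℝ) : eLpNorm (tailFT k ω t) 2 ≤ 2 * eLpNorm k 2 := by
  have e : tailFT k ω t = fullFT ((Ioi t).indicator k) ω :=
    funext fun z => tailFT_eq_fullFT k ω t z
  rw [e]
  refine (eLpNorm_fullFT_le (hk.indicator measurableSet_Ioi)
    (hk2.indicator measurableSet_Ioi) hω).trans ?_
  gcongr
  exact eLpNorm_indicator_le _

theorem measurable_tailFT {k : ℝ → ℂ} (hk : StronglyMeasurable k) (ω : ℝ) :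
    Measurable fun p : ℝ × ℝ => tailFT k ω p.1 p.2 := by
  have e : (fun p : ℝ × ℝ => tailFT k ω p.1 p.2) = fun p : ℝ × ℝ =>
      ∫ s, {q : (ℝ × ℝ) × ℝ | q.1.1 < q.2}.indicator
        (fun q : (ℝ × ℝ) × ℝ => k q.2 * exp (I * (ω * q.1.2 * q.2))) (p, s) := by
    ext p
    rw [tailFT, ← integral_indicator measurableSet_Ioi]
    congr 1
  rw [e]
  refine StronglyMeasurable.measurable (StronglyMeasurable.integral_prod_right' ?_)
  refine StronglyMeasurable.indicator ?_ (measurableSet_lt (by fun_prop) (by fun_prop))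
  refine (hk.comp_measurable measurable_snd).mul (Continuous.stronglyMeasurable ?_)
  fun_prop

end Plancherel

/-! ### Oscillatory integrals with amplitudes of bounded variation. -/

section Majorant

theorem eLpNorm_two_sq {α ε : Type*} [MeasurableSpace α] [TopologicalSpace ε]
    [ContinuousENorm ε] (f : α → ε) (μ : Measure α) :
    eLpNorm f 2 μ ^ 2 = ∫⁻ x, ‖f x‖ₑ ^ 2 ∂μ := by
  have := eLpNorm_nnreal_pow_eq_lintegral (f := f) (μ := μ) (p := 2) two_ne_zero
  simpa using this

/-- Cauchy–Schwarz for the splitting `ν φ = ν^{1/2} · (ν^{1/2} φ)`. -/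
theorem sq_lintegral_mul_le {α : Type*} [MeasurableSpace α] {μ : Measure α} {ν φ : α → ℝ≥0∞}
    (hν : Measurable ν) (hφ : Measurable φ) :
    (∫⁻ t, ν t * φ t ∂μ) ^ 2 ≤ (∫⁻ t, ν t ∂μ) * ∫⁻ t, ν t * φ t ^ 2 ∂μ := by
  have h := ENNReal.lintegral_mul_le_Lp_mul_Lq μ Real.HolderConjugate.two_two
    (f := fun t => ν t ^ (1 / 2 : ℝ)) (g := fun t => ν t ^ (1 / 2 : ℝ) * φ t)
    (by fun_prop) (by fun_prop)
  have e0 : ∀ x : ℝ≥0∞, x ^ (1 / 2 : ℝ) * x ^ (1 / 2 : ℝ) = x := fun x => by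
    rw [← ENNReal.rpow_add_of_nonneg _ _ (by norm_num) (by norm_num)]; norm_num
  have e1 : ∀ x : ℝ≥0∞, (x ^ (1 / 2 : ℝ)) ^ (2 : ℝ) = x := fun x => by
    rw [← ENNReal.rpow_mul]; norm_num
  simp only [Pi.mul_apply, ← mul_assoc, e0, e1, ENNReal.mul_rpow_of_nonneg _ _ zero_le_two] at h
  refine (pow_le_pow_left' h 2).trans (le_of_eq ?_)
  rw [mul_pow, ← ENNReal.rpow_natCast, ← ENNReal.rpow_natCast]
  simp only [Nat.cast_ofNat, e1, ENNReal.rpow_two]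

/-- Minkowski's inequality for a weighted family of functions that are bounded in `L²`. -/
theorem eLpNorm_lintegral_le {ν : ℝ → ℝ≥0∞} (hν : Measurable ν) {φ : ℝ → ℝ → ℝ≥0∞}
    (hφ : Measurable fun p : ℝ × ℝ => φ p.1 p.2) {K : ℝ≥0∞}
    (hK : ∀ t, eLpNorm (φ t) 2 volume ≤ K) :
    eLpNorm (fun z => ∫⁻ t, ν t * φ t z) 2 volume ≤ (∫⁻ t, ν t) * K := by
  have hsq : eLpNorm (fun z => ∫⁻ t, ν t * φ t z) 2 volume ^ 2 ≤ ((∫⁻ t, ν t) * K) ^ 2 := by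
    rw [eLpNorm_two_sq]
    calc ∫⁻ z, ‖∫⁻ t, ν t * φ t z‖ₑ ^ 2 ≤ ∫⁻ z, (∫⁻ t, ν t) * ∫⁻ t, ν t * φ t z ^ 2 := by
          refine lintegral_mono fun z => ?_
          exact sq_lintegral_mul_le hν (hφ.comp (measurable_id.prodMk measurable_const))
      _ = (∫⁻ t, ν t) * ∫⁻ z, ∫⁻ t, ν t * φ t z ^ 2 := by
          refine lintegral_const_mul _ (Measurable.lintegral_prod_right' (f := fun p : ℝ × ℝ =>
            ν p.2 * φ p.2 p.1 ^ 2) ?_)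
          exact (hν.comp measurable_snd).mul ((hφ.comp measurable_swap).pow_const 2)
      _ = (∫⁻ t, ν t) * ∫⁻ t, ∫⁻ z, ν t * φ t z ^ 2 := by
          rw [lintegral_lintegral_swap]
          exact ((hν.comp measurable_snd).mul ((hφ.comp measurable_swap).pow_const 2)).aemeasurable
      _ ≤ (∫⁻ t, ν t) * ∫⁻ t, ν t * K ^ 2 := by
          gcongr with t
          have hm : Measurable (φ t) := hφ.comp (measurable_const.prodMk measurable_id)
          rw [lintegral_const_mul _ (hm.pow_const 2)]
          gcongr
          have := pow_le_pow_left' (hK t) 2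
          rwa [eLpNorm_two_sq] at this
      _ = _ := by rw [lintegral_mul_const _ hν]; ring
  exact le_of_not_gt fun hlt => (ENNReal.pow_lt_pow_left two_ne_zero hlt).not_ge hsq

/-- The majorant of an oscillatory integral `∫ k e^{iωzs} X ds` for an amplitude `X` with
`‖X(-∞)‖ ≤ C₀` and `‖X'‖ ≤ ν`. -/
noncomputable def oscMajorant (k : ℝ → ℂ) (ω C₀ : ℝ) (ν : ℝ → ℝ) (z : ℝ) : ℝ≥0∞ :=
  ENNReal.ofReal C₀ * ‖fullFT k ω z‖ₑ + ∫⁻ t, ENNReal.ofReal (ν t) * ‖tailFT k ω t z‖ₑ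

theorem measurable_oscMajorant {k : ℝ → ℂ} (hk : Integrable k) (hkm : StronglyMeasurable k)
    (ω C₀ : ℝ) {ν : ℝ → ℝ} (hν : Measurable ν) : Measurable (oscMajorant k ω C₀ ν) := by
  refine ((continuous_fullFT hk ω).measurable.enorm.const_mul _).add ?_
  refine Measurable.lintegral_prod_right' (f := fun p : ℝ × ℝ =>
    ENNReal.ofReal (ν p.2) * ‖tailFT k ω p.2 p.1‖ₑ) ?_
  exact (hν.comp measurable_snd).ennreal_ofReal.mul
    ((measurable_tailFT hkm ω).comp measurable_swap).enorm

theorem eLpNorm_oscMajorant_le {k : ℝ → ℂ} (hk : Integrable k) (hk2 : MemLp k 2)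
    (hkm : StronglyMeasurable k) {ω C₀ V : ℝ} (hω : |ω| = 2) (hC : 0 ≤ C₀) {ν : ℝ → ℝ}
    (hν : Measurable ν) (hνi : Integrable ν) (hν0 : ∀ t, 0 ≤ ν t) (hV : ∫ t, ν t ≤ V) :
    eLpNorm (oscMajorant k ω C₀ ν) 2 volume ≤ ENNReal.ofReal (2 * (C₀ + V)) * eLpNorm k 2 := by
  have h1 : eLpNorm (fun z => ENNReal.ofReal C₀ * ‖fullFT k ω z‖ₑ) 2 volume ≤
      ENNReal.ofReal C₀ * (2 * eLpNorm k 2) := by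
    have : eLpNorm (fun z => ENNReal.ofReal C₀ * ‖fullFT k ω z‖ₑ) 2 volume =
        eLpNorm (fun z => C₀ • fullFT k ω z) 2 volume := by
      refine eLpNorm_congr_enorm_ae (.of_forall fun z => ?_)
      rw [enorm_smul, Real.enorm_of_nonneg hC]; rfl
    rw [this]
    refine (eLpNorm_const_smul_le (c := C₀)).trans ?_
    rw [Real.enorm_of_nonneg hC]
    gcongr
    exact eLpNorm_fullFT_le hk hk2 hω
  have h2 := eLpNorm_lintegral_le hν.ennreal_ofReal (φ := fun t z => ‖tailFT k ω t z‖ₑ)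
    (measurable_tailFT hkm ω).enorm (K := 2 * eLpNorm k 2) fun t => by
      rw [eLpNorm_enorm]; exact eLpNorm_tailFT_le hk hk2 hω t
  have h3 : ∫⁻ t, ENNReal.ofReal (ν t) ≤ ENNReal.ofReal V := by
    rw [← ofReal_integral_eq_lintegral_ofReal hνi (.of_forall hν0)]
    exact ENNReal.ofReal_le_ofReal hV
  have hV0 : 0 ≤ V := (integral_nonneg hν0).trans hV
  have m1 : Measurable fun z => ENNReal.ofReal C₀ * ‖fullFT k ω z‖ₑ :=
    (continuous_fullFT hk ω).measurable.enorm.const_mul _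
  have m2 : Measurable fun z => ∫⁻ t, ENNReal.ofReal (ν t) * ‖tailFT k ω t z‖ₑ := by
    refine Measurable.lintegral_prod_right' (f := fun p : ℝ × ℝ =>
      ENNReal.ofReal (ν p.2) * ‖tailFT k ω p.2 p.1‖ₑ) ?_
    exact (hν.comp measurable_snd).ennreal_ofReal.mul
      ((measurable_tailFT hkm ω).comp measurable_swap).enorm
  refine (eLpNorm_add_le m1.aestronglyMeasurable m2.aestronglyMeasurable one_le_two).trans ?_
  · calc _ ≤ ENNReal.ofReal C₀ * (2 * eLpNorm k 2) + ENNReal.ofReal V * (2 * eLpNorm k 2) := by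
          gcongr
          exact h2.trans (by gcongr)
      _ = _ := by
          rw [ENNReal.ofReal_mul zero_le_two, ENNReal.ofReal_add hC hV0, ENNReal.ofReal_ofNat]
          ring

variable {X : Type*} [NormedAddCommGroup X] [NormedSpace ℂ X] [CompleteSpace X]

theorem IsPrim.norm_le {φ f : ℝ → X} {e : X} {ν : ℝ → ℝ} {C₀ V : ℝ} (h : IsPrim φ f)
    (hf : Integrable f) (he : Tendsto φ atBot (𝓝 e)) (heC : ‖e‖ ≤ C₀) (hνi : Integrable ν)
    (hν : ∀ t, ‖f t‖ ≤ ν t) (hV : ∫ t, ν t ≤ V) (x : ℝ) : ‖φ x‖ ≤ C₀ + V := by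
  rw [h.eq_integral_Iic hf he x]
  refine (norm_add_le _ _).trans (add_le_add heC ?_)
  refine (norm_integral_le_of_norm_le hνi.integrableOn (.of_forall hν)).trans ?_
  exact (integral_Iic_mono hνi (fun t => (norm_nonneg _).trans (hν t)) x).2.trans hV

/-- The oscillatory integral of an amplitude of bounded variation. -/
theorem enorm_integral_phase_smul_le {k : ℝ → ℂ} (hk : Integrable k) (ω z : ℝ) {φ f : ℝ → X}
    {e : X} {ν : ℝ → ℝ} {C₀ : ℝ} (h : IsPrim φ f) (hf : Integrable f)
    (he : Tendsto φ atBot (𝓝 e)) (heC : ‖e‖ ≤ C₀) (hνi : Integrable ν) (hν : ∀ t, ‖f t‖ ≤ ν t) :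
    ‖∫ s, (k s * exp (I * (ω * z * s))) • φ s‖ₑ ≤ oscMajorant k ω C₀ ν z := by
  have hki := integrable_mul_phase hk ω z
  have hΦ : IsPrim (fun t => tailFT k ω t z) _ := isPrim_integral_Ioi hki
  have hX := h.norm_le hf he heC hνi hν le_rfl
  have hΦle : ∀ t, ‖tailFT k ω t z‖ ≤ ∫ s, ‖k s‖ := fun t => by
    refine (norm_integral_le_integral_norm _).trans
      ((setIntegral_le_integral hki.norm (.of_forall fun _ => norm_nonneg _)).trans ?_)
    simp [norm_exp_I_mul]
  have i1 : Integrable fun s : ℝ => (k s * exp (I * (ω * z * s))) • φ s :=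
    integrable_bilin (ContinuousLinearMap.lsmul ℝ ℂ) hki h.continuous.aestronglyMeasurable hX
  have i2 : Integrable fun s : ℝ => tailFT k ω s z • f s :=
    integrable_bilin (ContinuousLinearMap.lsmul ℝ ℂ).flip hf
      hΦ.continuous.aestronglyMeasurable hΦle
  have hprod := hΦ.bilin (ContinuousLinearMap.lsmul ℝ ℂ) h
  simp only [ContinuousLinearMap.lsmul_apply, neg_smul] at hprod
  have hbot := (tendsto_integral_Ioi_atBot hki).smul he
  have htop := (tendsto_integral_Ioi_atTop hki).smul (h.integral_Ioi hf 0)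
  rw [zero_smul] at htop
  have i3 : Integrable fun s : ℝ => -((k s * exp (I * (ω * z * s))) • φ s) := i1.neg
  -- Integration by parts with the tail as primitive of minus the oscillating density. At `+∞` the
  -- tail vanishes; at `-∞` it equals the full transform, and the amplitude tends to `e`.
  have key := hprod.integral_eq (i3.add i2) hbot htop
  rw [integral_add i3 i2, integral_neg] at key
  have key2 : ∫ s, (k s * exp (I * (ω * z * s))) • φ s =
      fullFT k ω z • e + ∫ s, tailFT k ω s z • f s := by
    rw [zero_sub, neg_add_eq_iff_eq_add] at key
    rw [key, fullFT]; abel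
  rw [key2, oscMajorant]
  refine (enorm_add_le _ _).trans (add_le_add ?_ ?_)
  · rw [enorm_smul, mul_comm]
    gcongr
    rw [← ofReal_norm]
    exact ENNReal.ofReal_le_ofReal heC
  · refine (enorm_integral_le_lintegral_enorm _).trans (lintegral_mono fun t => ?_)
    rw [enorm_smul, mul_comm]
    gcongr
    rw [← ofReal_norm]
    exact ENNReal.ofReal_le_ofReal (hν t)

end Majorant

theorem le_of_pow_two_le {a b : ℝ≥0∞} (h : a ^ 2 ≤ b ^ 2) : a ≤ b :=
  le_of_not_gt fun hlt => (ENNReal.pow_lt_pow_left two_ne_zero hlt).not_ge h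

/-! ### `L²` bounds through measurable majorants, which spare measurability proofs for the functions
of `z` themselves. -/

section L2Bound

variable {X Y Z : Type*} [NormedAddCommGroup X] [NormedAddCommGroup Y] [NormedAddCommGroup Z]

/-- `F` is dominated by a measurable function whose `L²` norm is at most `K`. -/
def L2Maj (F : ℝ → X) (K : ℝ) : Prop :=
  0 ≤ K ∧ ∃ G : ℝ → ℝ≥0∞, Measurable G ∧ (∀ z, ‖F z‖ₑ ≤ G z) ∧
    eLpNorm G 2 volume ≤ ENNReal.ofReal K

theorem L2Maj.eLpNorm_le {F : ℝ → X} {K : ℝ} (h : L2Maj F K) :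
    eLpNorm F 2 volume ≤ ENNReal.ofReal K := by
  obtain ⟨-, G, -, hG, hK⟩ := h
  exact (eLpNorm_mono_enorm hG).trans hK

theorem L2Maj.memLp {F : ℝ → X} {K : ℝ} (h : L2Maj F K) (hF : AEStronglyMeasurable F volume) :
    MemLp F 2 volume :=
  ⟨hF, h.eLpNorm_le.trans_lt ENNReal.ofReal_lt_top⟩

theorem L2Maj.mono {F : ℝ → X} {F' : ℝ → Y} {K : ℝ} (h : L2Maj F K)
    (hF : ∀ z, ‖F' z‖ ≤ ‖F z‖) : L2Maj F' K := by
  obtain ⟨h0, G, hm, hG, hK⟩ := h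
  exact ⟨h0, G, hm, fun z => (enorm_le_iff_norm_le.2 (hF z)).trans (hG z), hK⟩

theorem L2Maj.mono_const {F : ℝ → X} {K K' : ℝ} (h : L2Maj F K) (hK : K ≤ K') : L2Maj F K' := by
  obtain ⟨h0, G, hm, hG, hK'⟩ := h
  exact ⟨h0.trans hK, G, hm, hG, hK'.trans (ENNReal.ofReal_le_ofReal hK)⟩

theorem L2Maj.of_le_mul {F : ℝ → X} {F' : ℝ → Y} {K C : ℝ} (h : L2Maj F K) (hC : 0 ≤ C)
    (hF : ∀ z, ‖F' z‖ ≤ C * ‖F z‖) : L2Maj F' (C * K) := by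
  obtain ⟨h0, G, hm, hG, hK⟩ := h
  refine ⟨mul_nonneg hC h0, fun z => ENNReal.ofReal C * G z, hm.const_mul _, fun z => ?_, ?_⟩
  · rw [← ofReal_norm]
    refine (ENNReal.ofReal_le_ofReal (hF z)).trans ?_
    rw [ENNReal.ofReal_mul hC, ofReal_norm]
    exact mul_le_mul_right (hG z) _
  · rw [ENNReal.ofReal_mul hC]
    refine le_trans (le_of_pow_two_le ?_) (mul_le_mul_right hK _)
    rw [mul_pow, eLpNorm_two_sq, eLpNorm_two_sq, ← lintegral_const_mul _ (hm.enorm.pow_const 2)]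
    simp [mul_pow]

theorem L2Maj.of_le_add {F : ℝ → X} {F' : ℝ → Y} {F'' : ℝ → Z} {K K' : ℝ} (h : L2Maj F K)
    (h' : L2Maj F' K') (hF : ∀ z, ‖F'' z‖ ≤ ‖F z‖ + ‖F' z‖) : L2Maj F'' (K + K') := by
  obtain ⟨h0, G, hm, hG, hK⟩ := h
  obtain ⟨h0', G', hm', hG', hK'⟩ := h'
  refine ⟨add_nonneg h0 h0', fun z => G z + G' z, hm.add hm', fun z => ?_, ?_⟩
  · rw [← ofReal_norm]
    refine (ENNReal.ofReal_le_ofReal (hF z)).trans ?_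
    rw [ENNReal.ofReal_add (norm_nonneg _) (norm_nonneg _), ofReal_norm, ofReal_norm]
    exact add_le_add (hG z) (hG' z)
  · rw [ENNReal.ofReal_add h0 h0']
    exact (eLpNorm_add_le hm.aestronglyMeasurable hm'.aestronglyMeasurable one_le_two).trans
      (add_le_add hK hK')

theorem L2Maj.of_le_mul_add_mul {F : ℝ → X} {F' : ℝ → Y} {F'' : ℝ → Z} {K K' C C' : ℝ}
    (h : L2Maj F K) (h' : L2Maj F' K') (hC : 0 ≤ C) (hC' : 0 ≤ C')
    (hF : ∀ z, ‖F'' z‖ ≤ C * ‖F z‖ + C' * ‖F' z‖) : L2Maj F'' (C * K + C' * K') := by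
  refine (h.of_le_mul (F' := fun z => C * ‖F z‖) hC fun z => ?_).of_le_add
    (h'.of_le_mul (F' := fun z => C' * ‖F' z‖) hC' fun z => ?_) fun z => ?_
  · rw [Real.norm_of_nonneg (by positivity)]
  · rw [Real.norm_of_nonneg (by positivity)]
  · rw [Real.norm_of_nonneg (by positivity), Real.norm_of_nonneg (by positivity)]
    exact hF z

theorem L2Maj.add {F F' : ℝ → X} {K K' : ℝ} (h : L2Maj F K) (h' : L2Maj F' K') :
    L2Maj (fun z => F z + F' z) (K + K') :=
  h.of_le_add h' fun _ => norm_add_le _ _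

theorem l2Maj_zero : L2Maj (fun _ : ℝ => (0 : X)) 0 :=
  ⟨le_rfl, fun _ => 0, measurable_const, by simp, by simp⟩

theorem L2Maj.sum {ι : Type*} {s : Finset ι} {F : ι → ℝ → X} {K : ι → ℝ}
    (h : ∀ i ∈ s, L2Maj (F i) (K i)) : L2Maj (fun z => ∑ i ∈ s, F i z) (∑ i ∈ s, K i) := by
  classical
  induction s using Finset.induction_on with
  | empty => simpa using l2Maj_zero
  | insert a s ha ih =>
    simp only [Finset.sum_insert ha]
    exact (h a (Finset.mem_insert_self a s)).add
      (ih fun i hi => h i (Finset.mem_insert_of_mem hi))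

/-- Fatou's lemma for `L2Maj`. -/
theorem L2Maj.of_tendsto {F : ℕ → ℝ → X} {F' : ℝ → X} {K : ℝ} (h : ∀ n, L2Maj (F n) K)
    (hlim : ∀ z, Tendsto (fun n => F n z) atTop (𝓝 (F' z))) : L2Maj F' K := by
  choose h0 G hm hG hK using h
  -- The lower limit of the majorants is a measurable majorant of the limit, and Fatou's lemma
  -- bounds its norm.
  refine ⟨h0 0, fun z => liminf (fun n => G n z) atTop, Measurable.liminf hm, fun z => ?_, ?_⟩
  · rw [← ((hlim z).enorm).liminf_eq]
    exact liminf_le_liminf (.of_forall fun n => hG n z)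
  · have hsq : eLpNorm (fun z => liminf (fun n => G n z) atTop) 2 volume ^ 2 ≤
        ENNReal.ofReal K ^ 2 := by
      rw [eLpNorm_two_sq]
      calc ∫⁻ z, ‖liminf (fun n => G n z) atTop‖ₑ ^ 2
          ≤ ∫⁻ z, liminf (fun n => G n z ^ 2) atTop := by
            refine lintegral_mono fun z => ?_
            rw [enorm_eq_self]
            have hmono : Monotone fun x : ℝ≥0∞ => x ^ 2 := fun a b h => pow_le_pow_left' h 2
            exact (hmono.map_liminf_of_continuousAt (fun n => G n z)
              (ENNReal.continuous_pow 2).continuousAt).le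
        _ ≤ liminf (fun n => ∫⁻ z, G n z ^ 2) atTop :=
            lintegral_liminf_le fun n => (hm n).pow_const 2
        _ ≤ ENNReal.ofReal K ^ 2 := by
            refine liminf_le_of_le (by isBoundedDefault) fun b hb => ?_
            obtain ⟨n, hn⟩ := hb.exists
            refine hn.trans ?_
            have := pow_le_pow_left' (hK n) 2
            rwa [eLpNorm_two_sq] at this
    exact le_of_pow_two_le hsq

variable [NormedSpace ℂ X] [CompleteSpace X]

/-- An oscillatory integral with an amplitude of bounded variation, uniformly in the frequency,
is bounded in `L²`. -/
theorem l2Maj_integral_phase_smul {k : ℝ → ℂ} {B : ℝ} (hk : Integrable k)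
    (hkm : StronglyMeasurable k) (hB : 0 ≤ B) (hkB : eLpNorm k 2 volume ≤ ENNReal.ofReal B)
    {ω : ℝ} (hω : |ω| = 2) {φ f : ℝ → ℝ → X} {e : ℝ → X} {ν : ℝ → ℝ} {C₀ V : ℝ}
    (h : ∀ z, IsPrim (φ z) (f z)) (he : ∀ z, Tendsto (φ z) atBot (𝓝 (e z)))
    (heC : ∀ z, ‖e z‖ ≤ C₀) (hf : ∀ z, AEStronglyMeasurable (f z) volume) (hνm : Measurable ν)
    (hνi : Integrable ν) (hν : ∀ z t, ‖f z t‖ ≤ ν t) (hV : ∫ t, ν t ≤ V) :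
    L2Maj (fun z => ∫ s, (k s * exp (I * (ω * z * s))) • φ z s) (2 * (C₀ + V) * B) := by
  have hν0 : ∀ t, 0 ≤ ν t := fun t => (norm_nonneg _).trans (hν 0 t)
  have hC : 0 ≤ C₀ := (norm_nonneg _).trans (heC 0)
  have hV0 : 0 ≤ V := (integral_nonneg hν0).trans hV
  refine ⟨by positivity, oscMajorant k ω C₀ ν, measurable_oscMajorant hk hkm ω C₀ hνm,
    fun z => ?_, ?_⟩
  · exact enorm_integral_phase_smul_le hk ω z (h z)
      (hνi.mono' (hf z) (.of_forall (hν z))) (he z) (heC z) hνi (hν z)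
  · rw [ENNReal.ofReal_mul (by positivity)]
    refine (eLpNorm_oscMajorant_le hk ⟨hkm.aestronglyMeasurable,
      hkB.trans_lt ENNReal.ofReal_lt_top⟩ hkm hω hC hνm hνi hν0 hV).trans ?_
    gcongr

end L2Bound

/-! ### The space `L^{2,1}`: embedding in `L¹` and the gain from the weight. -/

section Weighted

theorem one_le_sqrt_one_add_sq (x : ℝ) : 1 ≤ Real.sqrt (1 + x ^ 2) :=
  Real.one_le_sqrt.2 (by nlinarith [sq_nonneg x])

theorem abs_le_sqrt_one_add_sq (x : ℝ) : |x| ≤ Real.sqrt (1 + x ^ 2) :=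
  Real.abs_le_sqrt (by linarith)

theorem sqrt_one_add_sq_le (x : ℝ) : Real.sqrt (1 + x ^ 2) ≤ 1 + |x| := by
  refine Real.sqrt_le_iff.2 ⟨by positivity, ?_⟩
  nlinarith [abs_nonneg x, sq_abs x]

theorem norm_weighted (f : ℝ → ℂ) (x : ℝ) : ‖weighted f x‖ = Real.sqrt (1 + x ^ 2) * ‖f x‖ := by
  rw [weighted, norm_smul, Real.norm_of_nonneg (Real.sqrt_nonneg _)]

theorem eLpNorm_le_normL21 (f : ℝ → ℂ) : eLpNorm f 2 volume ≤ normL21 f := by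
  refine eLpNorm_mono fun x => ?_
  rw [norm_weighted]
  exact le_mul_of_one_le_left (norm_nonneg _) (one_le_sqrt_one_add_sq x)

theorem eLpNorm_smul_self_le_normL21 (f : ℝ → ℂ) :
    eLpNorm (fun x => x • f x) 2 volume ≤ normL21 f := by
  refine eLpNorm_mono fun x => ?_
  rw [norm_weighted, norm_smul]
  exact mul_le_mul_of_nonneg_right (abs_le_sqrt_one_add_sq x) (norm_nonneg _)

theorem aestronglyMeasurable_weighted {f : ℝ → ℂ} (hf : AEStronglyMeasurable f volume) :
    AEStronglyMeasurable (weighted f) volume := by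
  have h : Continuous fun x : ℝ => Real.sqrt (1 + x ^ 2) := by fun_prop
  exact h.aestronglyMeasurable.smul hf

/-- Hölder's inequality with `⟨x⟩⁻¹`, whose `L²` norm is `√π ≤ 2`. -/
theorem eLpNorm_one_le_normL21 {f : ℝ → ℂ} (hf : AEStronglyMeasurable f volume) :
    eLpNorm f 1 volume ≤ 2 * normL21 f := by
  have hcont : Continuous fun x : ℝ => (Real.sqrt (1 + x ^ 2))⁻¹ :=
    Continuous.inv₀ (by fun_prop) fun x => by
      have := one_le_sqrt_one_add_sq x; positivity
  have h : f = (fun x : ℝ => (Real.sqrt (1 + x ^ 2))⁻¹) • weighted f := by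
    ext x
    rw [Pi.smul_apply', weighted, smul_smul,
      inv_mul_cancel₀ (by have := one_le_sqrt_one_add_sq x; positivity), one_smul]
  have hφ : eLpNorm (fun x : ℝ => (Real.sqrt (1 + x ^ 2))⁻¹) 2 volume ≤ 2 := by
    have hsq : eLpNorm (fun x : ℝ => (Real.sqrt (1 + x ^ 2))⁻¹) 2 volume ^ 2 ≤ 2 ^ 2 := by
      rw [eLpNorm_two_sq]
      have : ∀ x : ℝ, ‖(Real.sqrt (1 + x ^ 2))⁻¹‖ₑ ^ 2 = ENNReal.ofReal (1 + x ^ 2)⁻¹ := fun x => by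
        rw [Real.enorm_of_nonneg (by positivity), ← ENNReal.ofReal_pow (by positivity), inv_pow,
          Real.sq_sqrt (by positivity)]
      simp only [this]
      rw [← ofReal_integral_eq_lintegral_ofReal integrable_inv_one_add_sq
        (.of_forall fun x => by positivity), integral_univ_inv_one_add_sq]
      rw [show (2 : ℝ≥0∞) ^ 2 = ENNReal.ofReal 4 by norm_num]
      exact ENNReal.ofReal_le_ofReal Real.pi_lt_four.le
    exact le_of_pow_two_le hsq
  calc eLpNorm f 1 volume ≤ _ * eLpNorm (weighted f) 2 volume := by
        conv_lhs => rw [h]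
        exact eLpNorm_smul_le_mul_eLpNorm (p := 2) (q := 2) (aestronglyMeasurable_weighted hf)
          hcont.aestronglyMeasurable
    _ ≤ 2 * normL21 f := by gcongr; rfl

theorem integrable_of_normL21_le {f : ℝ → ℂ} {M : ℝ} (hf : AEStronglyMeasurable f volume)
    (hM : normL21 f ≤ ENNReal.ofReal M) : Integrable f := by
  rw [← memLp_one_iff_integrable]
  refine ⟨hf, (eLpNorm_one_le_normL21 hf).trans_lt ?_⟩
  exact ENNReal.mul_lt_top (by simp) (hM.trans_lt ENNReal.ofReal_lt_top)

theorem integral_norm_le_of_normL21_le {f : ℝ → ℂ} {M : ℝ} (hf : AEStronglyMeasurable f volume)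
    (hM0 : 0 ≤ M) (hM : normL21 f ≤ ENNReal.ofReal M) : ∫ x, ‖f x‖ ≤ 2 * M := by
  rw [integral_norm_eq_lintegral_enorm hf, ← eLpNorm_one_eq_lintegral_enorm]
  refine ENNReal.toReal_le_of_le_ofReal (by positivity) ((eLpNorm_one_le_normL21 hf).trans ?_)
  rw [ENNReal.ofReal_mul zero_le_two, ENNReal.ofReal_ofNat]
  gcongr

theorem norm_exp_I_mul_sub_one_le (a b c : ℝ) : ‖exp (I * (a * b * c)) - 1‖ ≤ |a * b| * |c| := by
  have := Real.norm_exp_I_mul_ofReal_sub_one_le (x := a * b * c)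
  push_cast at this
  rwa [Real.norm_eq_abs, abs_mul] at this

/-- Since `|e^{iωhx} - 1| ≤ 2|h||x|`, the weight of `L^{2,1}` is traded for a factor `|h|`. This is
the source of differentiability in the spectral parameter. -/
theorem eLpNorm_mul_phase_sub_one_le {f : ℝ → ℂ} {M ω h : ℝ} (hω : |ω| = 2)
    (hM : normL21 f ≤ ENNReal.ofReal M) :
    eLpNorm (fun x : ℝ => f x * (exp (I * (ω * h * x)) - 1)) 2 volume ≤
      ENNReal.ofReal (2 * |h| * M) := by
  rw [ENNReal.ofReal_mul (by positivity)]
  refine (eLpNorm_le_mul_eLpNorm_of_ae_le_mul (g := fun x : ℝ => x • f x) (c := 2 * |h|)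
    (.of_forall fun x => ?_) 2).trans ?_
  · have h1 := norm_exp_I_mul_sub_one_le ω h x
    rw [abs_mul, hω] at h1
    calc ‖f x * (exp (I * (ω * h * x)) - 1)‖ = ‖f x‖ * ‖exp (I * (ω * h * x)) - 1‖ := norm_mul _ _
      _ ≤ ‖f x‖ * (2 * |h| * |x|) := mul_le_mul_of_nonneg_left h1 (norm_nonneg _)
      _ = 2 * |h| * ‖x • f x‖ := by rw [norm_smul, Real.norm_eq_abs]; ring
  · gcongr
    exact (eLpNorm_smul_self_le_normL21 f).trans hM

end Weighted

/-! ### The amplitudes in the variation-of-constants formula: bounds for their derivatives and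
differences. -/

section Amplitude

variable {A : Type*} [NormedRing A] [NormedAlgebra ℂ A] [NormOneClass A] [CompleteSpace A]

/-- The amplitude `S₁ E T₂` of the first order dependence of the propagator on its coefficient. -/
noncomputable def amp (P₁ P₂ : ℝ → A) (E : A) (x : ℝ) : A := bwd P₁ x * E * fwd P₂ x

/-- The derivative of `amp`. -/
noncomputable def ampDeriv (P₁ P₂ : ℝ → A) (E : A) (x : ℝ) : A :=
  -(bwd P₁ x * P₁ x) * E * fwd P₂ x + bwd P₁ x * E * (P₂ x * fwd P₂ x)

variable {P₁ P₂ Q₁ Q₂ : ℝ → A} {E : A}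

theorem isPrim_amp (h1 : Integrable P₁) (h2 : Integrable P₂) (E : A) :
    IsPrim (amp P₁ P₂ E) (ampDeriv P₁ P₂ E) := by
  refine ((((isPrim_bwd h1).mul (isPrim_const E)).mul (isPrim_fwd h2)).congr fun x => ?_)
  simp [ampDeriv]

theorem tendsto_amp (h1 : Integrable P₁) (h2 : Integrable P₂) (E : A) :
    Tendsto (amp P₁ P₂ E) atBot (𝓝 E) := by
  have := ((tendsto_bwd_atBot h1).mul_const E).mul (tendsto_fwd_atBot h2)
  rwa [one_mul, mul_one] at this

theorem aestronglyMeasurable_ampDeriv (h1 : Integrable P₁) (h2 : Integrable P₂) (E : A) :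
    AEStronglyMeasurable (ampDeriv P₁ P₂ E) volume := by
  have b := (isPrim_bwd h1).continuous.aestronglyMeasurable (μ := volume)
  have f := (isPrim_fwd h2).continuous.aestronglyMeasurable (μ := volume)
  exact ((((b.mul h1.1).neg.mul aestronglyMeasurable_const).mul f)).add
    ((b.mul aestronglyMeasurable_const).mul (h2.1.mul f))

theorem integral_norm_le_of_le {P : ℝ → A} {p : ℝ → ℝ} {M : ℝ} (h : Integrable P)
    (hp : Integrable p) (hP : ∀ x, ‖P x‖ ≤ p x) (hM : ∫ x, p x ≤ M) : ∫ x, ‖P x‖ ≤ M :=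
  (integral_mono h.norm hp hP).trans hM

variable {p q : ℝ → ℝ} {M δ : ℝ}

theorem norm_ampDeriv_le (h1 : Integrable P₁) (h2 : Integrable P₂) (hE : ‖E‖ ≤ 1)
    (hp : Integrable p) (hpM : ∫ x, p x ≤ M) (hp1 : ∀ x, ‖P₁ x‖ ≤ p x) (hp2 : ∀ x, ‖P₂ x‖ ≤ p x)
    (x : ℝ) : ‖ampDeriv P₁ P₂ E x‖ ≤ 2 * Real.exp M ^ 2 * p x := by
  have hb := norm_bwd_le h1 (integral_norm_le_of_le h1 hp hp1 hpM) x
  have hf := norm_fwd_le h2 (integral_norm_le_of_le h2 hp hp2 hpM) x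
  have hp0 : 0 ≤ p x := (norm_nonneg _).trans (hp1 x)
  have e1 : ‖-(bwd P₁ x * P₁ x) * E * fwd P₂ x‖ ≤ Real.exp M * p x * 1 * Real.exp M := by
    refine norm_mul₃_le.trans ?_
    rw [norm_neg]
    gcongr
    refine (norm_mul_le _ _).trans ?_
    gcongr
    exact hp1 x
  have e2 : ‖bwd P₁ x * E * (P₂ x * fwd P₂ x)‖ ≤ Real.exp M * 1 * (p x * Real.exp M) := by
    refine norm_mul₃_le.trans ?_
    gcongr
    refine (norm_mul_le _ _).trans ?_
    gcongr
    exact hp2 x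
  calc _ ≤ _ := norm_add_le _ _
    _ ≤ Real.exp M * p x * 1 * Real.exp M + Real.exp M * 1 * (p x * Real.exp M) := add_le_add e1 e2
    _ = _ := by ring

theorem norm_mul₄_le (a b c d : A) : ‖a * b * c * d‖ ≤ ‖a‖ * ‖b‖ * ‖c‖ * ‖d‖ :=
  (norm_mul_le _ _).trans (mul_le_mul_of_nonneg_right norm_mul₃_le (norm_nonneg _))

theorem norm_ampDeriv_sub_le (h1 : Integrable P₁) (h2 : Integrable P₂) (g1 : Integrable Q₁)
    (g2 : Integrable Q₂) (hE : ‖E‖ ≤ 1) (hp : Integrable p) (hpM : ∫ x, p x ≤ M)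
    (hp1 : ∀ x, ‖P₁ x‖ ≤ p x) (hp2 : ∀ x, ‖P₂ x‖ ≤ p x) (gp1 : ∀ x, ‖Q₁ x‖ ≤ p x)
    (gp2 : ∀ x, ‖Q₂ x‖ ≤ p x) (hq : Integrable q) (hqδ : ∫ x, q x ≤ δ)
    (hq1 : ∀ x, ‖P₁ x - Q₁ x‖ ≤ q x) (hq2 : ∀ x, ‖P₂ x - Q₂ x‖ ≤ q x) (x : ℝ) :
    ‖ampDeriv P₁ P₂ E x - ampDeriv Q₁ Q₂ E x‖ ≤ 4 * Real.exp M ^ 6 * (δ * p x + q x) := by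
  have hM1 := integral_norm_le_of_le h1 hp hp1 hpM
  have hM2 := integral_norm_le_of_le h2 hp hp2 hpM
  have gM1 := integral_norm_le_of_le g1 hp gp1 hpM
  have gM2 := integral_norm_le_of_le g2 hp gp2 hpM
  have hδ1 := integral_norm_le_of_le (h1.sub g1) hq hq1 hqδ
  have hδ2 := integral_norm_le_of_le (h2.sub g2) hq hq2 hqδ
  have b := norm_bwd_le g1 gM1 x
  have f := norm_fwd_le h2 hM2 x
  have f' := norm_fwd_le g2 gM2 x
  have db := norm_bwd_sub_bwd_le h1 g1 hM1 gM1 hδ1 x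
  have df := norm_fwd_sub_fwd_le h2 g2 hM2 gM2 hδ2 x
  have hp0 : 0 ≤ p x := (norm_nonneg _).trans (hp1 x)
  have hq0 : 0 ≤ q x := (norm_nonneg _).trans (hq1 x)
  have hM : 0 ≤ M := (integral_nonneg fun x => (norm_nonneg _).trans (hp1 x)).trans hpM
  have hδ : 0 ≤ δ := (integral_nonneg fun x => (norm_nonneg _).trans (hq1 x)).trans hqδ
  set K := Real.exp M with hK
  have hK1 : 1 ≤ K := Real.one_le_exp hM
  -- Telescoping: in each of the two terms of the derivative the three factors that vary are
  -- exchanged one at a time.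
  have e : ampDeriv P₁ P₂ E x - ampDeriv Q₁ Q₂ E x =
      -((bwd P₁ x - bwd Q₁ x) * P₁ x * E * fwd P₂ x + bwd Q₁ x * (P₁ x - Q₁ x) * E * fwd P₂ x +
        bwd Q₁ x * Q₁ x * E * (fwd P₂ x - fwd Q₂ x)) +
      ((bwd P₁ x - bwd Q₁ x) * E * P₂ x * fwd P₂ x + bwd Q₁ x * E * (P₂ x - Q₂ x) * fwd P₂ x +
        bwd Q₁ x * E * Q₂ x * (fwd P₂ x - fwd Q₂ x)) := by
    simp only [ampDeriv]; noncomm_ring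
  have t1 : ‖(bwd P₁ x - bwd Q₁ x) * P₁ x * E * fwd P₂ x‖ ≤ (K ^ 5 * δ) * p x * 1 * K := by
    refine (norm_mul₄_le _ _ _ _).trans ?_
    gcongr
    exact hp1 x
  have t2 : ‖bwd Q₁ x * (P₁ x - Q₁ x) * E * fwd P₂ x‖ ≤ K * q x * 1 * K := by
    refine (norm_mul₄_le _ _ _ _).trans ?_
    gcongr
    exact hq1 x
  have t3 : ‖bwd Q₁ x * Q₁ x * E * (fwd P₂ x - fwd Q₂ x)‖ ≤ K * p x * 1 * (K ^ 3 * δ) := by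
    refine (norm_mul₄_le _ _ _ _).trans ?_
    gcongr
    exact gp1 x
  have t4 : ‖(bwd P₁ x - bwd Q₁ x) * E * P₂ x * fwd P₂ x‖ ≤ (K ^ 5 * δ) * 1 * p x * K := by
    refine (norm_mul₄_le _ _ _ _).trans ?_
    gcongr
    exact hp2 x
  have t5 : ‖bwd Q₁ x * E * (P₂ x - Q₂ x) * fwd P₂ x‖ ≤ K * 1 * q x * K := by
    refine (norm_mul₄_le _ _ _ _).trans ?_
    gcongr
    exact hq2 x
  have t6 : ‖bwd Q₁ x * E * Q₂ x * (fwd P₂ x - fwd Q₂ x)‖ ≤ K * 1 * p x * (K ^ 3 * δ) := by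
    refine (norm_mul₄_le _ _ _ _).trans ?_
    gcongr
    exact gp2 x
  have k2 : K ^ 2 ≤ K ^ 6 := pow_le_pow_right₀ hK1 (by norm_num)
  have k4 : K ^ 4 ≤ K ^ 6 := pow_le_pow_right₀ hK1 (by norm_num)
  rw [e]
  calc _ ≤ ((K ^ 5 * δ) * p x * 1 * K + K * q x * 1 * K + K * p x * 1 * (K ^ 3 * δ)) +
        ((K ^ 5 * δ) * 1 * p x * K + K * 1 * q x * K + K * 1 * p x * (K ^ 3 * δ)) := by
        refine (norm_add_le _ _).trans (add_le_add ?_ ?_)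
        · rw [norm_neg]
          exact norm_add₃_le.trans (add_le_add (add_le_add t1 t2) t3)
        · exact norm_add₃_le.trans (add_le_add (add_le_add t4 t5) t6)
    _ = 2 * K ^ 6 * (δ * p x) + 2 * K ^ 2 * q x + 2 * K ^ 4 * (δ * p x) := by ring
    _ ≤ 2 * K ^ 6 * (δ * p x) + 4 * K ^ 6 * q x + 2 * K ^ 6 * (δ * p x) := by
        have : 2 * K ^ 2 ≤ 4 * K ^ 6 := by nlinarith [pow_nonneg (zero_le_one.trans hK1) 6]
        gcongr
    _ = _ := by ring

end Amplitude

/-! ### `L²` bounds for oscillatory integrals with these amplitudes. -/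

section AmplitudeL2

variable {A : Type*} [NormedRing A] [NormedAlgebra ℂ A] [NormOneClass A] [CompleteSpace A]
  {P₁ P₂ Q₁ Q₂ : ℝ → ℝ → A} {E : A} {p q : ℝ → ℝ} {M δ : ℝ} {k : ℝ → ℂ} {B ω : ℝ}

theorem l2Maj_integral_phase_smul_amp (hk : Integrable k) (hkm : StronglyMeasurable k)
    (hB : 0 ≤ B) (hkB : eLpNorm k 2 volume ≤ ENNReal.ofReal B) (hω : |ω| = 2)
    (h1 : ∀ z, Integrable (P₁ z)) (h2 : ∀ z, Integrable (P₂ z)) (hE : ‖E‖ ≤ 1)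
    (hpm : Measurable p) (hp : Integrable p) (hpM : ∫ x, p x ≤ M)
    (hp1 : ∀ z x, ‖P₁ z x‖ ≤ p x) (hp2 : ∀ z x, ‖P₂ z x‖ ≤ p x) :
    L2Maj (fun z => ∫ s, (k s * exp (I * (ω * z * s))) • amp (P₁ z) (P₂ z) E s)
      (2 * (1 + 2 * Real.exp M ^ 2 * M) * B) := by
  refine l2Maj_integral_phase_smul hk hkm hB hkB hω (fun z => isPrim_amp (h1 z) (h2 z) E)
    (fun z => tendsto_amp (h1 z) (h2 z) E) (fun _ => hE)
    (fun z => aestronglyMeasurable_ampDeriv (h1 z) (h2 z) E) (hpm.const_mul _) (hp.const_mul _)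
    (fun z => norm_ampDeriv_le (h1 z) (h2 z) hE hp hpM (hp1 z) (hp2 z)) ?_
  rw [integral_const_mul]
  gcongr

/-- Both amplitudes tend to `E` at `-∞`, so their difference starts from `0`, and its derivative is
of size `δ p + q`. Hence the bound is proportional to `δ`. -/
theorem l2Maj_integral_phase_smul_amp_sub (hk : Integrable k) (hkm : StronglyMeasurable k)
    (hB : 0 ≤ B) (hkB : eLpNorm k 2 volume ≤ ENNReal.ofReal B) (hω : |ω| = 2)
    (h1 : ∀ z, Integrable (P₁ z)) (h2 : ∀ z, Integrable (P₂ z)) (g1 : ∀ z, Integrable (Q₁ z))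
    (g2 : ∀ z, Integrable (Q₂ z)) (hE : ‖E‖ ≤ 1) (hpm : Measurable p) (hp : Integrable p)
    (hpM : ∫ x, p x ≤ M) (hp1 : ∀ z x, ‖P₁ z x‖ ≤ p x) (hp2 : ∀ z x, ‖P₂ z x‖ ≤ p x)
    (gp1 : ∀ z x, ‖Q₁ z x‖ ≤ p x) (gp2 : ∀ z x, ‖Q₂ z x‖ ≤ p x) (hqm : Measurable q)
    (hq : Integrable q) (hqδ : ∫ x, q x ≤ δ) (hq1 : ∀ z x, ‖P₁ z x - Q₁ z x‖ ≤ q x)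
    (hq2 : ∀ z x, ‖P₂ z x - Q₂ z x‖ ≤ q x) :
    L2Maj (fun z => ∫ s, (k s * exp (I * (ω * z * s))) •
      (amp (P₁ z) (P₂ z) E s - amp (Q₁ z) (Q₂ z) E s))
      (8 * Real.exp M ^ 6 * (M + 1) * δ * B) := by
  have hδ : 0 ≤ δ := (integral_nonneg fun x => (norm_nonneg _).trans (hq1 0 x)).trans hqδ
  have := l2Maj_integral_phase_smul (C₀ := 0) (V := 4 * Real.exp M ^ 6 * (δ * M + δ))
    (ν := fun x => 4 * Real.exp M ^ 6 * (δ * p x + q x)) (e := fun _ => 0) hk hkm hB hkB hω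
    (fun z => (isPrim_amp (h1 z) (h2 z) E).sub (isPrim_amp (g1 z) (g2 z) E))
    (fun z => by simpa using (tendsto_amp (h1 z) (h2 z) E).sub (tendsto_amp (g1 z) (g2 z) E))
    (fun _ => by simp)
    (fun z => (aestronglyMeasurable_ampDeriv (h1 z) (h2 z) E).sub
      (aestronglyMeasurable_ampDeriv (g1 z) (g2 z) E))
    (((hpm.const_mul _).add hqm).const_mul _) (((hp.const_mul _).add hq).const_mul _)
    (fun z => norm_ampDeriv_sub_le (h1 z) (h2 z) (g1 z) (g2 z) hE hp hpM (hp1 z) (hp2 z) (gp1 z)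
      (gp2 z) hq hqδ (hq1 z) (hq2 z)) (by
        rw [integral_const_mul, integral_add (hp.const_mul _) hq, integral_const_mul]
        gcongr)
  refine this.mono_const (le_of_eq ?_)
  ring

end AmplitudeL2

/-! ### Transfer matrices of oscillating coefficients: Lipschitz bounds and increments in the
spectral parameter. -/

section Oscillating

variable {A : Type*} [NormedRing A] [NormedAlgebra ℂ A] [NormOneClass A] [CompleteSpace A]
  {ι : Type*} [Fintype ι]

/-- The coefficient `∑ₖ cₖ(x) e^{iωₖzx} Eₖ`. -/
noncomputable def osc (E : ι → A) (ω : ι → ℝ) (c : ι → ℝ → ℂ) (z x : ℝ) : A :=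
  ∑ k, (c k x * exp (I * (ω k * z * x))) • E k

/-- The `L¹` envelope of `osc`. -/
noncomputable def env (c : ι → ℝ → ℂ) (x : ℝ) : ℝ := ∑ k, ‖c k x‖

/-- The coefficients `cₖ` are measurable with norm at most `M` in `L^{2,1}`. -/
structure CoeffBound (c : ι → ℝ → ℂ) (M : ℝ) : Prop where
  nonneg : 0 ≤ M
  meas : ∀ k, StronglyMeasurable (c k)
  norm_le : ∀ k, normL21 (c k) ≤ ENNReal.ofReal M

variable {E : ι → A} {ω : ι → ℝ} {c d : ι → ℝ → ℂ} {M Δ : ℝ}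

theorem CoeffBound.integrable (h : CoeffBound c M) (k : ι) : Integrable (c k) :=
  integrable_of_normL21_le (h.meas k).aestronglyMeasurable (h.norm_le k)

theorem CoeffBound.integrable_env (h : CoeffBound c M) : Integrable (env c) :=
  integrable_finsetSum _ fun k _ => (h.integrable k).norm

theorem CoeffBound.measurable_env (h : CoeffBound c M) : Measurable (env c) :=
  Finset.measurable_fun_sum _ fun k _ => (h.meas k).norm.measurable

theorem CoeffBound.integral_env_le (h : CoeffBound c M) :
    ∫ x, env c x ≤ Fintype.card ι * (2 * M) := by
  simp only [env]
  rw [integral_finsetSum _ fun k _ => (h.integrable k).norm]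
  refine (Finset.sum_le_card_nsmul _ _ (2 * M) fun k _ =>
    integral_norm_le_of_normL21_le (h.meas k).aestronglyMeasurable h.nonneg (h.norm_le k)).trans ?_
  simp [Finset.card_univ]

theorem integrable_osc (E : ι → A) (ω : ι → ℝ) (hc : ∀ k, Integrable (c k)) (z : ℝ) :
    Integrable (osc E ω c z) :=
  integrable_finsetSum _ fun k _ => (integrable_mul_phase (hc k) (ω k) z).smul_const (E k)

theorem norm_osc_le (hE : ∀ k, ‖E k‖ ≤ 1) (ω : ι → ℝ) (c : ι → ℝ → ℂ) (z x : ℝ) :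
    ‖osc E ω c z x‖ ≤ env c x := by
  refine (norm_sum_le _ _).trans (Finset.sum_le_sum fun k _ => ?_)
  rw [norm_smul, norm_mul, norm_exp_I_mul, mul_one]
  exact mul_le_of_le_one_right (norm_nonneg _) (hE k)

theorem osc_sub (E : ι → A) (ω : ι → ℝ) (c d : ι → ℝ → ℂ) (z x : ℝ) :
    osc E ω c z x - osc E ω d z x = osc E ω (fun k x => c k x - d k x) z x := by
  simp only [osc, ← Finset.sum_sub_distrib, ← sub_smul, sub_mul]

/-- The coefficients of the increment of `osc` in the spectral parameter. -/
noncomputable def phaseDiff (ω : ι → ℝ) (h : ℝ) (c : ι → ℝ → ℂ) (k : ι) (x : ℝ) : ℂ :=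
  c k x * (exp (I * (ω k * h * x)) - 1)

/-- A shift of the spectral parameter acts as a change of the coefficients at fixed `z`, so the
variation-of-constants formula treats both kinds of difference alike. -/
theorem osc_add_sub (E : ι → A) (ω : ι → ℝ) (c : ι → ℝ → ℂ) (z h x : ℝ) :
    osc E ω c (z + h) x - osc E ω c z x = osc E ω (phaseDiff ω h c) z x := by
  simp only [osc, ← Finset.sum_sub_distrib, ← sub_smul, phaseDiff]
  refine Finset.sum_congr rfl fun k _ => ?_
  congr 1
  have : I * (ω k * ((z + h : ℝ) : ℂ) * x) = I * (ω k * h * x) + I * (ω k * z * x) := by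
    push_cast; ring
  rw [this, Complex.exp_add]
  ring

theorem phaseDiff_sub (ω : ι → ℝ) (h : ℝ) (c d : ι → ℝ → ℂ) (k : ι) (x : ℝ) :
    phaseDiff ω h c k x - phaseDiff ω h d k x = phaseDiff ω h (fun k x => c k x - d k x) k x := by
  simp only [phaseDiff]; ring

theorem stronglyMeasurable_phaseDiff (hc : ∀ k, StronglyMeasurable (c k)) (ω : ι → ℝ) (h : ℝ)
    (k : ι) : StronglyMeasurable (phaseDiff ω h c k) :=
  (hc k).mul (Continuous.stronglyMeasurable (by fun_prop))

theorem norm_phaseDiff_le (ω : ι → ℝ) (h : ℝ) (c : ι → ℝ → ℂ) (k : ι) (x : ℝ) :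
    ‖phaseDiff ω h c k x‖ ≤ 2 * ‖c k x‖ := by
  rw [phaseDiff, norm_mul, mul_comm]
  gcongr
  refine (norm_sub_le _ _).trans ?_
  rw [norm_exp_I_mul, norm_one]
  norm_num

theorem CoeffBound.integrable_phaseDiff (h : CoeffBound c M) (ω : ι → ℝ) (η : ℝ) (k : ι) :
    Integrable (phaseDiff ω η c k) :=
  ((h.integrable k).norm.const_mul 2).mono'
    (stronglyMeasurable_phaseDiff h.meas ω η k).aestronglyMeasurable
    (.of_forall (norm_phaseDiff_le ω η c k))

theorem integrable_phase_smul_amp {P₁ P₂ : ℝ → A} {k : ℝ → ℂ} (hk : Integrable k)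
    (h1 : Integrable P₁) (h2 : Integrable P₂) (E : A) (ω z : ℝ) :
    Integrable fun s : ℝ => (k s * exp (I * (ω * z * s))) • amp P₁ P₂ E s := by
  refine integrable_bilin (ContinuousLinearMap.lsmul ℝ ℂ) (integrable_mul_phase hk ω z)
    (isPrim_amp h1 h2 E).continuous.aestronglyMeasurable
    (C := Real.exp (∫ x, ‖P₁ x‖) * ‖E‖ * Real.exp (∫ x, ‖P₂ x‖)) fun x => ?_
  refine norm_mul₃_le.trans ?_
  gcongr
  exacts [norm_bwd_le h1 le_rfl x, norm_fwd_le h2 le_rfl x]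

theorem integral_bwd_mul_osc_mul_fwd {P₁ P₂ : ℝ → A} (h1 : Integrable P₁) (h2 : Integrable P₂)
    (hc : ∀ k, Integrable (c k)) (z : ℝ) :
    ∫ x, bwd P₁ x * osc E ω c z x * fwd P₂ x =
      ∑ k, ∫ s, (c k s * exp (I * (ω k * z * s))) • amp P₁ P₂ (E k) s := by
  rw [← integral_finsetSum _ fun k _ => integrable_phase_smul_amp (hc k) h1 h2 (E k) (ω k) z]
  congr 1; ext x
  simp only [osc, Finset.mul_sum, Finset.sum_mul, amp]
  refine Finset.sum_congr rfl fun k _ => ?_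
  rw [mul_smul_comm, smul_mul_assoc]

variable (E ω)

/-- The transfer matrix `T(+∞)` of the oscillating coefficient. -/
noncomputable def transfer (c : ι → ℝ → ℂ) (z : ℝ) : A := fwdTop (osc E ω c z)

variable {E ω}

/-- The sum is a common envelope, independent of `z`, for the generators of both systems. -/
theorem CoeffBound.integral_env_add_le (hc : CoeffBound c M) (hd : CoeffBound d M) :
    Integrable (fun x => env c x + env d x) ∧
      ∫ x, (env c x + env d x) ≤ 4 * Fintype.card ι * M := by
  refine ⟨hc.integrable_env.add hd.integrable_env, ?_⟩
  rw [integral_add hc.integrable_env hd.integrable_env]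
  linarith [hc.integral_env_le, hd.integral_env_le]

theorem env_nonneg (c : ι → ℝ → ℂ) (x : ℝ) : 0 ≤ env c x :=
  Finset.sum_nonneg fun _ _ => norm_nonneg _

theorem norm_transfer_le (hE : ∀ k, ‖E k‖ ≤ 1) (hc : CoeffBound c M) (z : ℝ) :
    ‖transfer E ω c z‖ ≤ Real.exp (4 * Fintype.card ι * M) := by
  obtain ⟨h, h'⟩ := hc.integral_env_add_le hc
  exact norm_fwdTop_le (integrable_osc E ω hc.integrable z)
    (integral_norm_le_of_le (integrable_osc E ω hc.integrable z) h
      (fun x => (norm_osc_le hE ω c z x).trans (le_add_of_nonneg_right (env_nonneg c x))) h')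

theorem norm_transfer_sub_le (hE : ∀ k, ‖E k‖ ≤ 1) (hc : CoeffBound c M) (hd : CoeffBound d M)
    (hcd : CoeffBound (fun k x => c k x - d k x) Δ) (z : ℝ) :
    ‖transfer E ω c z - transfer E ω d z‖ ≤
      Real.exp (4 * Fintype.card ι * M) ^ 3 * (Fintype.card ι * (2 * Δ)) := by
  obtain ⟨h, h'⟩ := hc.integral_env_add_le hd
  have ic := integrable_osc E ω hc.integrable z
  have id := integrable_osc E ω hd.integrable z
  refine norm_fwdTop_sub_fwdTop_le ic id
    (integral_norm_le_of_le ic h (fun x => (norm_osc_le hE ω c z x).trans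
      (le_add_of_nonneg_right (env_nonneg d x))) h')
    (integral_norm_le_of_le id h (fun x => (norm_osc_le hE ω d z x).trans
      (le_add_of_nonneg_left (env_nonneg c x))) h')
    (integral_norm_le_of_le (ic.sub id) hcd.integrable_env (fun x => ?_) hcd.integral_env_le)
  rw [osc_sub]
  exact norm_osc_le hE ω _ z x

/-- `L²` Lipschitz continuity of the transfer matrix. -/
theorem l2Maj_transfer_sub (hE : ∀ k, ‖E k‖ ≤ 1) (hω : ∀ k, |ω k| = 2) (hc : CoeffBound c M)
    (hd : CoeffBound d M) (hcd : CoeffBound (fun k x => c k x - d k x) Δ) :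
    L2Maj (fun z => transfer E ω c z - transfer E ω d z)
      (Real.exp (4 * Fintype.card ι * M) * (Fintype.card ι *
        (2 * (1 + 2 * Real.exp (4 * Fintype.card ι * M) ^ 2 * (4 * Fintype.card ι * M)))) * Δ) := by
  obtain ⟨h, h'⟩ := hc.integral_env_add_le hd
  have ic := integrable_osc E ω hc.integrable
  have id := integrable_osc E ω hd.integrable
  have hsum := L2Maj.sum (s := Finset.univ) fun k _ => l2Maj_integral_phase_smul_amp
    (hcd.integrable k) (hcd.meas k) hcd.nonneg ((eLpNorm_le_normL21 _).trans (hcd.norm_le k))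
    (hω k) ic id (hE k) (hc.measurable_env.add hd.measurable_env) h h'
    (fun z x => (norm_osc_le hE ω c z x).trans (le_add_of_nonneg_right (env_nonneg d x)))
    (fun z x => (norm_osc_le hE ω d z x).trans (le_add_of_nonneg_left (env_nonneg c x)))
  refine (hsum.of_le_mul (Real.exp_pos (4 * Fintype.card ι * M)).le fun z => ?_).mono_const ?_
  · rw [transfer, transfer, fwdTop_sub_fwdTop (ic z) (id z)]
    simp only [osc_sub]
    rw [integral_bwd_mul_osc_mul_fwd (ic z) (id z) hcd.integrable]
    refine (norm_mul_le _ _).trans ?_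
    gcongr
    exact norm_transfer_le hE hc z
  · rw [Finset.sum_const, Finset.card_univ, nsmul_eq_mul]
    exact le_of_eq (by ring)

/-- `L²` Lipschitz continuity of the increments of the transfer matrix. -/
theorem l2Maj_transfer_increment_sub (hE : ∀ k, ‖E k‖ ≤ 1) (hω : ∀ k, |ω k| = 2) (hM : 0 ≤ M) :
    ∃ C : ℝ, 0 ≤ C ∧ ∀ (c d : ι → ℝ → ℂ) (Δ η : ℝ), CoeffBound c M → CoeffBound d M →
      CoeffBound (fun k x => c k x - d k x) Δ →
      L2Maj (fun z => (transfer E ω c (z + η) - transfer E ω c z) -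
        (transfer E ω d (z + η) - transfer E ω d z)) (C * Δ * |η|) := by
  set N : ℝ := (Fintype.card ι : ℝ) with hN
  set M' : ℝ := 4 * N * M with hM'
  set K := Real.exp M' with hK
  set C₁ : ℝ := 2 * (1 + 2 * K ^ 2 * M') with hC₁
  set C₂ : ℝ := 8 * K ^ 6 * (M' + 1) with hC₂
  have hK0 : 0 ≤ K := (Real.exp_pos _).le
  refine ⟨K ^ 3 * (N * 2) * (N * (C₁ * (2 * M))) + K * (N * (C₁ * 2 + C₂ * (N * 2) * (2 * M))),
    by positivity, fun c d Δ η hc hd hcd => ?_⟩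
  obtain ⟨h, h'⟩ := hc.integral_env_add_le hd
  have ic := integrable_osc E ω hc.integrable
  have id := integrable_osc E ω hd.integrable
  have pc : ∀ z x, ‖osc E ω c z x‖ ≤ env c x + env d x := fun z x =>
    (norm_osc_le hE ω c z x).trans (le_add_of_nonneg_right (env_nonneg d x))
  have pd : ∀ z x, ‖osc E ω d z x‖ ≤ env c x + env d x := fun z x =>
    (norm_osc_le hE ω d z x).trans (le_add_of_nonneg_left (env_nonneg c x))
  have qcd : ∀ z x, ‖osc E ω c z x - osc E ω d z x‖ ≤ env (fun k x => c k x - d k x) x :=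
    fun z x => by rw [osc_sub]; exact norm_osc_le hE ω _ z x
  have hpm := hc.measurable_env.add hd.measurable_env
  have hΔ := hcd.nonneg
  -- `I1` bounds the integral `J` that produces the increment for `c`. `I2` bounds `J - J'`,
  -- separated into the change of the density with the amplitude for `c` fixed, and the change of
  -- the amplitude with the density for `d` fixed.
  have I1 := L2Maj.sum (s := Finset.univ) fun k _ => l2Maj_integral_phase_smul_amp
    (hc.integrable_phaseDiff ω η k) (stronglyMeasurable_phaseDiff hc.meas ω η k)
    (by positivity) (eLpNorm_mul_phase_sub_one_le (hω k) (hc.norm_le k))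
    (hω k) (fun z => ic (z + η)) ic (hE k) hpm h h' (fun z => pc (z + η)) pc
  have I2 := L2Maj.sum (s := Finset.univ) fun k _ => (l2Maj_integral_phase_smul_amp
    (hcd.integrable_phaseDiff ω η k) (stronglyMeasurable_phaseDiff hcd.meas ω η k)
    (by positivity) (eLpNorm_mul_phase_sub_one_le (hω k) (hcd.norm_le k))
    (hω k) (fun z => ic (z + η)) ic (hE k) hpm h h' (fun z => pc (z + η)) pc).add
    (l2Maj_integral_phase_smul_amp_sub
    (hd.integrable_phaseDiff ω η k) (stronglyMeasurable_phaseDiff hd.meas ω η k)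
    (by positivity) (eLpNorm_mul_phase_sub_one_le (hω k) (hd.norm_le k))
    (hω k) (fun z => ic (z + η)) ic (fun z => id (z + η)) id (hE k) hpm h h'
    (fun z => pc (z + η)) pc (fun z => pd (z + η)) pd hcd.measurable_env hcd.integrable_env
    hcd.integral_env_le (fun z => qcd (z + η)) qcd)
  refine (I1.of_le_mul_add_mul I2 (C := K ^ 3 * (N * (2 * Δ))) (C' := K) (by positivity) hK0
    fun z => ?_).mono_const ?_
  · have ec : transfer E ω c (z + η) - transfer E ω c z = transfer E ω c (z + η) *
        ∑ k, ∫ s, (phaseDiff ω η c k s * exp (I * (ω k * z * s))) •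
          amp (osc E ω c (z + η)) (osc E ω c z) (E k) s := by
      rw [transfer, transfer, fwdTop_sub_fwdTop (ic _) (ic _)]
      simp only [osc_add_sub]
      rw [integral_bwd_mul_osc_mul_fwd (ic _) (ic _) (hc.integrable_phaseDiff ω η)]
    have ed : transfer E ω d (z + η) - transfer E ω d z = transfer E ω d (z + η) *
        ∑ k, ∫ s, (phaseDiff ω η d k s * exp (I * (ω k * z * s))) •
          amp (osc E ω d (z + η)) (osc E ω d z) (E k) s := by
      rw [transfer, transfer, fwdTop_sub_fwdTop (id _) (id _)]
      simp only [osc_add_sub]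
      rw [integral_bwd_mul_osc_mul_fwd (id _) (id _) (hd.integrable_phaseDiff ω η)]
    have edi : (∑ k, ∫ s, (phaseDiff ω η c k s * exp (I * (ω k * z * s))) •
          amp (osc E ω c (z + η)) (osc E ω c z) (E k) s) -
        (∑ k, ∫ s, (phaseDiff ω η d k s * exp (I * (ω k * z * s))) •
          amp (osc E ω d (z + η)) (osc E ω d z) (E k) s) =
        ∑ k, ((∫ s, (phaseDiff ω η (fun k x => c k x - d k x) k s *
          exp (I * (ω k * z * s))) • amp (osc E ω c (z + η)) (osc E ω c z) (E k) s) +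
        ∫ s, (phaseDiff ω η d k s * exp (I * (ω k * z * s))) •
          (amp (osc E ω c (z + η)) (osc E ω c z) (E k) s -
          amp (osc E ω d (z + η)) (osc E ω d z) (E k) s)) := by
      rw [← Finset.sum_sub_distrib]
      refine Finset.sum_congr rfl fun k _ => ?_
      have i1 := integrable_phase_smul_amp (hc.integrable_phaseDiff ω η k) (ic (z + η)) (ic z)
        (E k) (ω k) z
      have i2 := integrable_phase_smul_amp (hd.integrable_phaseDiff ω η k) (id (z + η)) (id z)
        (E k) (ω k) z
      have i3 := integrable_phase_smul_amp (hd.integrable_phaseDiff ω η k) (ic (z + η)) (ic z)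
        (E k) (ω k) z
      have i4 := integrable_phase_smul_amp (hcd.integrable_phaseDiff ω η k) (ic (z + η)) (ic z)
        (E k) (ω k) z
      simp only [smul_sub]
      rw [integral_sub i3 i2, ← add_sub_assoc, ← integral_add i4 i3]
      congr 2; ext s
      rw [← phaseDiff_sub, ← add_smul]
      congr 1
      ring
    rw [ec, ed]
    set J := ∑ k, ∫ s, (phaseDiff ω η c k s * exp (I * (ω k * z * s))) •
          amp (osc E ω c (z + η)) (osc E ω c z) (E k) s
    set J' := ∑ k, ∫ s, (phaseDiff ω η d k s * exp (I * (ω k * z * s))) •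
          amp (osc E ω d (z + η)) (osc E ω d z) (E k) s
    -- In the first product the transfer matrices differ by `O(Δ)` uniformly in `z` and `J` is
    -- `O(|η|)` in `L²`; in the second the matrix is bounded and `J - J'` is `O(Δ|η|)` in `L²`.
    rw [← edi, show transfer E ω c (z + η) * J - transfer E ω d (z + η) * J' =
      (transfer E ω c (z + η) - transfer E ω d (z + η)) * J + transfer E ω d (z + η) * (J - J')
      by noncomm_ring]
    refine (norm_add_le _ _).trans (add_le_add ((norm_mul_le _ _).trans ?_)
      ((norm_mul_le _ _).trans ?_))
    · gcongr
      exact norm_transfer_sub_le hE hc hd hcd _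
    · gcongr
      exact norm_transfer_le hE hd _
  · simp only [Finset.sum_const, Finset.card_univ, nsmul_eq_mul, ← hN, ← hM', ← hK]
    simp only [hC₁, hC₂]
    exact le_of_eq (by ring)

/-- The generators converge in `L¹` by dominated convergence, and the transfer matrix is Lipschitz
in `L¹`. Continuity is what makes the reflection coefficients measurable. -/
theorem continuous_transfer (E : ι → A) (ω : ι → ℝ) (hc : ∀ k, Integrable (c k))
    (hE : ∀ k, ‖E k‖ ≤ 1) : Continuous (transfer E ω c) := by
  have henv : Integrable (env c) := integrable_finsetSum _ fun k _ => (hc k).norm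
  have ic := integrable_osc E ω hc
  refine continuous_iff_continuousAt.2 fun z => ?_
  rw [ContinuousAt, tendsto_iff_norm_sub_tendsto_zero]
  have hlim : Tendsto (fun w => ∫ x, ‖osc E ω c w x - osc E ω c z x‖) (𝓝 z) (𝓝 0) := by
    have h0 : ∫ x, ‖osc E ω c z x - osc E ω c z x‖ = 0 := by simp
    rw [← h0]
    refine tendsto_integral_filter_of_dominated_convergence (fun x => env c x + env c x)
      (.of_forall fun w => ((ic w).sub (ic z)).1.norm) (.of_forall fun w => .of_forall fun x => ?_)
      (henv.add henv) (.of_forall fun x => ?_)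
    · rw [norm_norm]
      exact (norm_sub_le _ _).trans (add_le_add (norm_osc_le hE ω c w x) (norm_osc_le hE ω c z x))
    · refine Continuous.tendsto (f := fun w => ‖osc E ω c w x - osc E ω c z x‖) ?_ z
      simp only [osc]
      fun_prop
  have hlim' := hlim.const_mul (Real.exp (∫ x, env c x) ^ 3)
  rw [mul_zero] at hlim'
  refine squeeze_zero (fun _ => norm_nonneg _) (fun w => ?_) hlim'
  exact norm_fwdTop_sub_fwdTop_le (ic w) (ic z)
    (integral_norm_le_of_le (ic w) henv (norm_osc_le hE ω c w) le_rfl)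
    (integral_norm_le_of_le (ic z) henv (norm_osc_le hE ω c z) le_rfl) le_rfl

theorem transfer_zero (E : ι → A) (ω : ι → ℝ) (z : ℝ) : transfer E ω (fun _ _ => 0) z = 1 := by
  have : osc E ω (fun _ _ => 0) z = fun _ => 0 := by ext x; simp [osc]
  simp [transfer, fwdTop, this]

end Oscillating

/-! ### Characterisation of `H¹` by difference quotients. -/

section DifferenceQuotient

open scoped Convolution

/-- A function in `L²` whose increments are `O(h)` in `L²` has a weak derivative in `L²`. -/
theorem exists_hasWeakDeriv_of_increment {f : ℝ → ℂ} {C : ℝ} (hC : 0 ≤ C) (hf : MemLp f 2 volume)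
    (h : ∀ t : ℝ, eLpNorm (fun x => f (x + t) - f x) 2 volume ≤ ENNReal.ofReal (C * |t|)) :
    ∃ g, HasWeakDeriv f g ∧ MemLp g 2 volume ∧ eLpNorm g 2 volume ≤ ENNReal.ofReal C := by
  have hmem : ∀ t : ℝ, MemLp (fun x => f (x + t) - f x) 2 volume := fun t =>
    (hf.comp_measurePreserving (measurePreserving_add_right volume t)).sub hf
  set τ : ℕ → ℝ := fun n => 1 / ((n : ℝ) + 1) with hτ
  have hτpos : ∀ n, 0 < τ n := fun n => by positivity
  set D : ℕ → Lp ℂ 2 (volume : Measure ℝ) := fun n =>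
    ((τ n)⁻¹ : ℂ) • (hmem (τ n)).toLp _ with hD
  have hDnorm : ∀ n, ‖D n‖ ≤ C := fun n => by
    have h1 : ‖(hmem (τ n)).toLp _‖ ≤ C * τ n := by
      rw [Lp.norm_toLp]
      refine ENNReal.toReal_le_of_le_ofReal (mul_nonneg hC (hτpos n).le) ?_
      simpa [abs_of_pos (hτpos n)] using h (τ n)
    rw [hD, norm_smul, norm_inv, Complex.norm_real, Real.norm_of_nonneg (hτpos n).le,
      inv_mul_le_iff₀ (hτpos n)]
    linarith
  set Λ : ℕ → WeakDual ℂ (Lp ℂ 2 (volume : Measure ℝ)) := fun n =>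
    StrongDual.toWeakDual (InnerProductSpace.toDual ℂ (Lp ℂ 2 (volume : Measure ℝ)) (D n)) with hΛ
  have hcomp := WeakDual.isCompact_closedBall (𝕜 := ℂ) (E := Lp ℂ 2 (volume : Measure ℝ)) 0 C
  -- The difference quotients, viewed as functionals, stay in a weak-* compact ball; a limit along a
  -- free ultrafilter replaces the extraction of a subsequence.
  obtain ⟨L, hL, hlim⟩ := hcomp.ultrafilter_le_nhds ((hyperfilter ℕ : Ultrafilter ℕ).map Λ) (by
    rw [le_principal_iff]
    refine Filter.mem_map.2 (Filter.univ_mem' fun n => ?_)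
    simpa [hΛ] using hDnorm n)
  have hlim' : ∀ φ, Tendsto (fun n => inner ℂ (D n) φ) (hyperfilter ℕ : Filter ℕ) (𝓝 (L φ)) :=
    fun φ => ((WeakDual.eval_continuous φ).tendsto L).comp hlim
  set G := (InnerProductSpace.toDual ℂ (Lp ℂ 2 (volume : Measure ℝ))).symm
    (WeakDual.toStrongDual L) with hG
  have hGL : ∀ φ, inner ℂ G φ = L φ := fun φ => by
    rw [hG, InnerProductSpace.toDual_symm_apply]; rfl
  have hGnorm : ‖G‖ ≤ C := by
    rw [hG, LinearIsometryEquiv.norm_map]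
    simpa using hL
  refine ⟨G, ⟨hf.locallyIntegrable one_le_two, (Lp.memLp G).locallyIntegrable one_le_two,
    fun η hη hc => ?_⟩, Lp.memLp G, ?_⟩
  · have hηc : Continuous η := hη.continuous
    have hηm : MemLp (fun x => (η x : ℂ)) 2 volume :=
      (Complex.continuous_ofReal.comp hηc).memLp_of_hasCompactSupport
        (hc.comp_left (g := fun x : ℝ => (x : ℂ)) Complex.ofReal_zero)
    have hinner : ∀ (g : ℝ → ℂ) (hg : MemLp g 2 volume),
        inner ℂ (hηm.toLp _) (hg.toLp g) = ∫ x, η x • g x := by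
      intro g hg
      rw [L2.inner_def]
      refine integral_congr_ae ?_
      filter_upwards [hηm.coeFn_toLp, hg.coeFn_toLp] with x h1 h2
      rw [h1, h2]
      simp [mul_comm]
    -- The pairing of `η` with the translate of `f` by `t` is the convolution of `f` with the
    -- reflected test function, evaluated at `t`. It is differentiable at `0`, so the pairings with
    -- the difference quotients converge to `-∫ η' f`.
    set ζ : ℝ → ℝ := fun x => η (-x) with hζ
    have hζc : HasCompactSupport ζ := hc.comp_homeomorph (Homeomorph.neg ℝ)
    have hζd : ContDiff ℝ 1 ζ := (hη.of_le (by exact_mod_cast le_top)).comp contDiff_neg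
    have hderivζ : ∀ x, deriv ζ x = -deriv η (-x) := fun x => by rw [hζ, deriv_comp_neg]
    have hconv := hζc.hasDerivAt_convolution_right (ContinuousLinearMap.lsmul ℝ ℝ).flip
      (hf.locallyIntegrable one_le_two) hζd (μ := volume) 0
    have hF : ∀ t, (f ⋆[(ContinuousLinearMap.lsmul ℝ ℝ).flip] ζ) t = ∫ x, η x • f (x + t) := by
      intro t
      rw [convolution_def, ← integral_add_right_eq_self _ t]
      simp [hζ]
    have hF' : (f ⋆[(ContinuousLinearMap.lsmul ℝ ℝ).flip] (deriv ζ)) 0 = -∫ x, deriv η x • f x := by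
      rw [convolution_def, ← integral_neg]
      simp [hderivζ]
    have hslope := hconv.tendsto_slope_zero
    rw [hF'] at hslope
    have hτlim : Tendsto τ (hyperfilter ℕ : Filter ℕ) (𝓝[≠] 0) := by
      refine tendsto_nhdsWithin_iff.2 ⟨?_, .of_forall fun n => (hτpos n).ne'⟩
      exact tendsto_one_div_add_atTop_nhds_zero_nat.mono_left Nat.hyperfilter_le_atTop
    have h1 := hslope.comp hτlim
    have h2 : ∀ n, inner ℂ (hηm.toLp _) (D n) = (τ n)⁻¹ •
        ((f ⋆[(ContinuousLinearMap.lsmul ℝ ℝ).flip] ζ) (0 + τ n) -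
          (f ⋆[(ContinuousLinearMap.lsmul ℝ ℝ).flip] ζ) 0) := by
      intro n
      rw [hD, inner_smul_right, hinner, hF, hF, zero_add, ← integral_sub]
      · simp only [add_zero, smul_sub, Complex.real_smul, Complex.ofReal_inv]
      · have := (hf.comp_measurePreserving (measurePreserving_add_right volume (τ n)))
        exact (this.locallyIntegrable one_le_two).integrable_smul_left_of_hasCompactSupport hηc hc
      · simpa using
          (hf.locallyIntegrable one_le_two).integrable_smul_left_of_hasCompactSupport hηc hc
    have h3 : Tendsto (fun n => inner ℂ (hηm.toLp _) (D n)) (hyperfilter ℕ : Filter ℕ)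
        (𝓝 (-∫ x, deriv η x • f x)) := h1.congr fun n => (h2 n).symm
    have h4 : Tendsto (fun n => inner ℂ (hηm.toLp _) (D n)) (hyperfilter ℕ : Filter ℕ)
        (𝓝 (inner ℂ (hηm.toLp _) G)) := by
      have := (continuous_star.tendsto _).comp (hlim' (hηm.toLp _))
      rw [← hGL] at this
      simp only [Function.comp_def] at this
      refine (this.congr fun n => ?_).trans (le_of_eq ?_)
      · exact inner_conj_symm _ _
      · exact congrArg 𝓝 (inner_conj_symm _ _)
    have h5 := tendsto_nhds_unique h3 h4
    have h6 := hinner G (Lp.memLp G)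
    rw [Lp.toLp_coeFn] at h6
    rw [← h6, ← h5, neg_neg]
  · rw [Lp.norm_def] at hGnorm
    exact (ENNReal.le_ofReal_iff_toReal_le (Lp.memLp G).2.ne hC).2 hGnorm

theorem HasWeakDeriv.weakDeriv_ae {f g : ℝ → ℂ} (h : HasWeakDeriv f g) :
    weakDeriv f =ᵐ[volume] g :=
  (hasWeakDeriv_weakDeriv h).ae_unique h

theorem HasWeakDeriv.congr_ae {f f' g g' : ℝ → ℂ} (h : HasWeakDeriv f g)
    (hf : f =ᵐ[volume] f') (hg : g =ᵐ[volume] g') : HasWeakDeriv f' g' := by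
  refine ⟨h.1.congr hf, h.2.1.congr hg, fun η hη hc => ?_⟩
  rw [integral_congr_ae (g := fun x => deriv η x • f x) (hf.mono fun x hx => by simp only [hx]),
    h.2.2 η hη hc,
    integral_congr_ae (g := fun x => η x • g' x) (hg.mono fun x hx => by simp only [hx])]

end DifferenceQuotient

/-! ### Quotients and their increments. -/

section Quotient

variable {α β α' β' : ℝ → ℂ} {κ κ' : ℂ} {a K S Δ η : ℝ}

theorem norm_quotient_sub_le {a s : ℝ} {α β α' β' κ κ' : ℂ} (ha : 0 < a) (hs : 0 ≤ s)
    (hα : a ≤ ‖α‖) (hα' : a ≤ ‖α'‖) (hκ : ‖κ‖ ≤ 1) (hκ' : ‖κ'‖ ≤ 1) (hκκ : ‖κ - κ'‖ ≤ s)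
    (hαα : ‖α - α'‖ ≤ s) :
    ‖κ * β / α - κ' * β' / α'‖ ≤ a⁻¹ * ‖β - β'‖ + (s * a⁻¹ + s * a⁻¹ ^ 2) * ‖β'‖ := by
  have hα0 : α ≠ 0 := norm_pos_iff.1 (ha.trans_le hα)
  have hα0' : α' ≠ 0 := norm_pos_iff.1 (ha.trans_le hα')
  have g : ‖α⁻¹‖ ≤ a⁻¹ := by rw [norm_inv]; gcongr
  have g' : ‖α'⁻¹‖ ≤ a⁻¹ := by rw [norm_inv]; gcongr
  have e : κ * β / α - κ' * β' / α' = κ * α⁻¹ * (β - β') + ((κ - κ') * α⁻¹ * β' +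
      (-(κ' * (α - α') * α⁻¹ * α'⁻¹ * β'))) := by
    field_simp; ring
  rw [e]
  refine norm_add_le_of_le ?_ ((norm_add_le_of_le (r₁ := s * a⁻¹ * ‖β'‖)
    (r₂ := s * a⁻¹ ^ 2 * ‖β'‖) ?_ ?_).trans (le_of_eq (by ring)))
  · rw [norm_mul, norm_mul]
    gcongr
    calc ‖κ‖ * ‖α⁻¹‖ ≤ 1 * a⁻¹ := by gcongr
      _ = a⁻¹ := one_mul _
  · rw [norm_mul, norm_mul]
    gcongr
  · rw [norm_neg, norm_mul, norm_mul, norm_mul, norm_mul]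
    refine mul_le_mul_of_nonneg_right ?_ (norm_nonneg _)
    calc ‖κ'‖ * ‖α - α'‖ * ‖α⁻¹‖ * ‖α'⁻¹‖ ≤ 1 * s * a⁻¹ * a⁻¹ := by gcongr
      _ = s * a⁻¹ ^ 2 := by ring

theorem l2Maj_quotient_sub (ha : 0 < a) (hS : 0 ≤ S) (hΔ : 0 ≤ Δ)
    (hα : ∀ z, a ≤ ‖α z‖) (hα' : ∀ z, a ≤ ‖α' z‖) (hκ : ‖κ‖ ≤ 1) (hκ' : ‖κ'‖ ≤ 1)
    (hκκ : ‖κ - κ'‖ ≤ S * Δ) (hαα : ∀ z, ‖α z - α' z‖ ≤ S * Δ)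
    (hβ : L2Maj (fun z => β z - β' z) (S * Δ)) (hβ' : L2Maj β' S) :
    L2Maj (fun z => κ * β z / α z - κ' * β' z / α' z)
      (a⁻¹ * (S * Δ) + (S * Δ * a⁻¹ + S * Δ * a⁻¹ ^ 2) * S) :=
  hβ.of_le_mul_add_mul hβ' (by positivity) (by positivity) fun z =>
    norm_quotient_sub_le ha (by positivity) (hα z) (hα' z) hκ hκ' hκκ (hαα z)

/-- Only increments carry the `L²` information. All other factors are bounded uniformly in `z`, and
so are their differences between the two systems, by multiples of `Δ`. -/
theorem l2Maj_quotient_increment_sub (ha : 0 < a) (hK : 0 ≤ K) (hS : 0 ≤ S) (hΔ : 0 ≤ Δ)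
    (hα : ∀ z, a ≤ ‖α z‖) (hα' : ∀ z, a ≤ ‖α' z‖) (hκ : ‖κ‖ ≤ 1) (hκ' : ‖κ'‖ ≤ 1)
    (hβK : ∀ z, ‖β z‖ ≤ K) (hβK' : ∀ z, ‖β' z‖ ≤ K)
    (hκκ : ‖κ - κ'‖ ≤ S * Δ) (hαα : ∀ z, ‖α z - α' z‖ ≤ S * Δ) (hββ : ∀ z, ‖β z - β' z‖ ≤ S * Δ)
    (dα : L2Maj (fun z => (α (z + η) - α z) - (α' (z + η) - α' z)) (S * Δ * |η|))
    (dβ : L2Maj (fun z => (β (z + η) - β z) - (β' (z + η) - β' z)) (S * Δ * |η|))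
    (dα' : L2Maj (fun z => α' (z + η) - α' z) (S * |η|))
    (dβ' : L2Maj (fun z => β' (z + η) - β' z) (S * |η|)) :
    L2Maj (fun z => (κ * β (z + η) / α (z + η) - κ * β z / α z) -
      (κ' * β' (z + η) / α' (z + η) - κ' * β' z / α' z))
      ((a⁻¹ + a⁻¹ ^ 2 * K + (a⁻¹ + a⁻¹ ^ 2 + (a⁻¹ ^ 2 * K + a⁻¹ ^ 3 * K + a⁻¹ ^ 2 +
        a⁻¹ ^ 3 * K)) * S) * S * Δ * |η|) := by
  have h1 := dβ.of_le_mul_add_mul dα (C := a⁻¹) (C' := a⁻¹ ^ 2 * K) (by positivity) (by positivity)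
    (F'' := fun z => a⁻¹ * ‖(β (z + η) - β z) - (β' (z + η) - β' z)‖ + a⁻¹ ^ 2 * K *
      ‖(α (z + η) - α z) - (α' (z + η) - α' z)‖) fun z => by
        rw [Real.norm_of_nonneg (by positivity)]
  have h2 := dβ'.of_le_mul_add_mul dα' (C := S * Δ * (a⁻¹ + a⁻¹ ^ 2))
    (C' := S * Δ * (a⁻¹ ^ 2 * K + a⁻¹ ^ 3 * K + a⁻¹ ^ 2 + a⁻¹ ^ 3 * K))
    (by positivity) (by positivity)
    (F'' := fun z => S * Δ * (a⁻¹ + a⁻¹ ^ 2) * ‖β' (z + η) - β' z‖ +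
      S * Δ * (a⁻¹ ^ 2 * K + a⁻¹ ^ 3 * K + a⁻¹ ^ 2 + a⁻¹ ^ 3 * K) * ‖α' (z + η) - α' z‖)
      fun z => by rw [Real.norm_of_nonneg (by positivity)]
  refine (h1.of_le_add h2 fun z => ?_).mono_const (le_of_eq (by ring))
  rw [Real.norm_of_nonneg (by positivity), Real.norm_of_nonneg (by positivity)]
  have hpos : ∀ z, α z ≠ 0 := fun z => norm_pos_iff.1 (ha.trans_le (hα z))
  have hpos' : ∀ z, α' z ≠ 0 := fun z => norm_pos_iff.1 (ha.trans_le (hα' z))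
  have g : ∀ z, ‖(α z)⁻¹‖ ≤ a⁻¹ := fun z => by rw [norm_inv]; gcongr; exact hα z
  have g' : ∀ z, ‖(α' z)⁻¹‖ ≤ a⁻¹ := fun z => by rw [norm_inv]; gcongr; exact hα' z
  -- With `X = κ / a₁` and `Y = b / a` the increment of the quotient is `X (B - Y A)`, where `A`,
  -- `B` are the increments of denominator and numerator. The two such expressions are then compared
  -- factor by factor.
  have e : ∀ (κ b b₁ a a₁ : ℂ), a ≠ 0 → a₁ ≠ 0 → κ * b₁ / a₁ - κ * b / a =
      κ * a₁⁻¹ * ((b₁ - b) - b * a⁻¹ * (a₁ - a)) := by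
    intro κ b b₁ a a₁ h h1
    field_simp; ring
  rw [e _ _ _ _ _ (hpos z) (hpos _), e _ _ _ _ _ (hpos' z) (hpos' _)]
  have hX : ‖κ * (α (z + η))⁻¹‖ ≤ a⁻¹ := by
    rw [norm_mul]
    calc _ ≤ 1 * a⁻¹ := by gcongr; exact g _
      _ = _ := one_mul _
  have hY : ‖β z * (α z)⁻¹‖ ≤ K * a⁻¹ := by
    rw [norm_mul]; gcongr; exacts [hβK z, g z]
  have hY' : ‖β' z * (α' z)⁻¹‖ ≤ K * a⁻¹ := by
    rw [norm_mul]; gcongr; exacts [hβK' z, g' z]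
  have hinv : ∀ w, ‖(α w)⁻¹ - (α' w)⁻¹‖ ≤ S * Δ * a⁻¹ ^ 2 := fun w => by
    have : (α w)⁻¹ - (α' w)⁻¹ = -((α w - α' w) * (α w)⁻¹ * (α' w)⁻¹) := by
      have := hpos w; have := hpos' w
      field_simp; ring
    rw [this, norm_neg, norm_mul, norm_mul]
    calc _ ≤ S * Δ * a⁻¹ * a⁻¹ := by gcongr; exacts [hαα w, g w, g' w]
      _ = _ := by ring
  have hYY : ‖β z * (α z)⁻¹ - β' z * (α' z)⁻¹‖ ≤ S * Δ * (a⁻¹ + K * a⁻¹ ^ 2) := by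
    have : β z * (α z)⁻¹ - β' z * (α' z)⁻¹ = (β z - β' z) * (α z)⁻¹ +
      β' z * ((α z)⁻¹ - (α' z)⁻¹) := by ring
    rw [this]
    refine (norm_add_le_of_le (r₁ := S * Δ * a⁻¹) (r₂ := K * (S * Δ * a⁻¹ ^ 2)) ?_ ?_).trans
      (le_of_eq (by ring))
    · rw [norm_mul]; gcongr; exacts [hββ z, g z]
    · rw [norm_mul]; gcongr; exacts [hβK' z, hinv z]
  have hXX : ‖κ * (α (z + η))⁻¹ - κ' * (α' (z + η))⁻¹‖ ≤ S * Δ * (a⁻¹ + a⁻¹ ^ 2) := by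
    have : κ * (α (z + η))⁻¹ - κ' * (α' (z + η))⁻¹ = (κ - κ') * (α (z + η))⁻¹ +
      κ' * ((α (z + η))⁻¹ - (α' (z + η))⁻¹) := by ring
    rw [this]
    refine (norm_add_le_of_le (r₁ := S * Δ * a⁻¹) (r₂ := 1 * (S * Δ * a⁻¹ ^ 2)) ?_ ?_).trans
      (le_of_eq (by ring))
    · rw [norm_mul]; gcongr; exact g _
    · rw [norm_mul]; gcongr; exact hinv _
  generalize κ * (α (z + η))⁻¹ = X at hX hXX ⊢
  generalize κ' * (α' (z + η))⁻¹ = X' at hXX ⊢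
  generalize β z * (α z)⁻¹ = Y at hY hYY ⊢
  generalize β' z * (α' z)⁻¹ = Y' at hY' hYY ⊢
  set A := α (z + η) - α z
  set A' := α' (z + η) - α' z
  set B := β (z + η) - β z
  set B' := β' (z + η) - β' z
  rw [show X * (B - Y * A) - X' * (B' - Y' * A') =
    (X * (B - B') - X * Y * (A - A')) + (-(X * (Y - Y') * A') + (X - X') * (B' - Y' * A')) by ring]
  have s1 : ‖X * (B - B')‖ ≤ a⁻¹ * ‖B - B'‖ := by rw [norm_mul]; gcongr
  have s2 : ‖X * Y * (A - A')‖ ≤ a⁻¹ * (K * a⁻¹) * ‖A - A'‖ := by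
    rw [norm_mul, norm_mul]; gcongr
  have s3 : ‖X * (Y - Y') * A'‖ ≤ a⁻¹ * (S * Δ * (a⁻¹ + K * a⁻¹ ^ 2)) * ‖A'‖ := by
    rw [norm_mul, norm_mul]; gcongr
  have s4 : ‖(X - X') * (B' - Y' * A')‖ ≤
      (S * Δ * (a⁻¹ + a⁻¹ ^ 2)) * (‖B'‖ + K * a⁻¹ * ‖A'‖) := by
    rw [norm_mul]
    gcongr
    refine norm_sub_le_of_le le_rfl ?_
    rw [norm_mul]; gcongr
  calc _ ≤ (a⁻¹ * ‖B - B'‖ + a⁻¹ * (K * a⁻¹) * ‖A - A'‖) +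
      (a⁻¹ * (S * Δ * (a⁻¹ + K * a⁻¹ ^ 2)) * ‖A'‖ +
        (S * Δ * (a⁻¹ + a⁻¹ ^ 2)) * (‖B'‖ + K * a⁻¹ * ‖A'‖)) := by
        refine norm_add_le_of_le (norm_sub_le_of_le s1 s2) (norm_add_le_of_le ?_ s4)
        rwa [norm_neg]
    _ = _ := by ring

end Quotient

/-! ### Quotients of entries of the transfer matrix. -/

section Ratio

variable {W ι : Type*} [Fintype W] [Nonempty W] [DecidableEq W] [Fintype ι]

/-- Matrix entries of an operator on `ℂ^W`. -/
noncomputable def entry (T : (W → ℂ) →L[ℂ] (W → ℂ)) (i j : W) : ℂ := T (Pi.single j 1) i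

theorem entry_sub (T T' : (W → ℂ) →L[ℂ] (W → ℂ)) (i j : W) :
    entry (T - T') i j = entry T i j - entry T' i j := rfl

theorem norm_entry_le (T : (W → ℂ) →L[ℂ] (W → ℂ)) (i j : W) : ‖entry T i j‖ ≤ ‖T‖ := by
  refine (norm_le_pi_norm _ i).trans ((T.le_opNorm _).trans ?_)
  rw [Pi.norm_single, norm_one, mul_one]

theorem continuous_entry (i j : W) :
    Continuous fun T : (W → ℂ) →L[ℂ] (W → ℂ) => entry T i j := by
  unfold entry; fun_prop

theorem L2Maj.entry {F : ℝ → (W → ℂ) →L[ℂ] (W → ℂ)} {K : ℝ} (h : L2Maj F K) (i j : W) :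
    L2Maj (fun z => DNLS.entry (F z) i j) K :=
  h.mono fun _ => norm_entry_le _ i j

theorem coeffBound_zero {M : ℝ} (hM : 0 ≤ M) : CoeffBound (fun (_ : ι) (_ : ℝ) => (0 : ℂ)) M :=
  ⟨hM, fun _ => stronglyMeasurable_const, fun _ => by
    have : weighted (fun _ => 0) = 0 := by ext x; simp [weighted]
    simp [normL21, this]⟩

variable {E : ι → (W → ℂ) →L[ℂ] (W → ℂ)} {ω : ι → ℝ}

/-- `L²` Lipschitz continuity of the quotients of entries of the transfer matrix and of their
increments. -/
theorem l2Maj_ratio_sub (hE : ∀ k, ‖E k‖ ≤ 1) (hω : ∀ k, |ω k| = 2) {M a : ℝ} (hM : 0 ≤ M)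
    (ha : 0 < a) {i j : W} (hij : i ≠ j) :
    ∃ C : ℝ, 0 ≤ C ∧ ∀ (c d : ι → ℝ → ℂ) (κ κ' : ℂ) (Δ : ℝ), CoeffBound c M → CoeffBound d M →
      CoeffBound (fun k x => c k x - d k x) Δ → ‖κ‖ ≤ 1 → ‖κ'‖ ≤ 1 → ‖κ - κ'‖ ≤ Δ →
      (∀ z, a ≤ ‖entry (transfer E ω c z) j j‖) → (∀ z, a ≤ ‖entry (transfer E ω d z) j j‖) →
      L2Maj (fun z => κ * entry (transfer E ω c z) i j / entry (transfer E ω c z) j j -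
        κ' * entry (transfer E ω d z) i j / entry (transfer E ω d z) j j) (C * Δ) ∧
      ∀ η, L2Maj (fun z => (κ * entry (transfer E ω c (z + η)) i j /
          entry (transfer E ω c (z + η)) j j -
          κ * entry (transfer E ω c z) i j / entry (transfer E ω c z) j j) -
        (κ' * entry (transfer E ω d (z + η)) i j / entry (transfer E ω d (z + η)) j j -
          κ' * entry (transfer E ω d z) i j / entry (transfer E ω d z) j j)) (C * Δ * |η|) := by
  obtain ⟨C₁, hC₁, H₁⟩ := l2Maj_transfer_increment_sub (A := (W → ℂ) →L[ℂ] (W → ℂ)) hE hω hM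
  set N : ℝ := (Fintype.card ι : ℝ) with hN
  set K := Real.exp (4 * N * M) with hK
  set C₀ := K * (N * (2 * (1 + 2 * K ^ 2 * (4 * N * M)))) with hC₀
  have hC₀pos : 0 ≤ C₀ := by positivity
  -- A single constant above all those needed: `1` for `κ`, `K³·2N` for the uniform Lipschitz bound,
  -- `C₀` and `C₁` for the `L²` Lipschitz bounds of entries and increments, `C₀M` and `C₁M` for
  -- their sizes.
  set S : ℝ := 1 + K ^ 3 * (N * 2) + C₀ + C₀ * M + C₁ + C₁ * M with hS
  have hSpos : 0 ≤ S := by positivity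
  have hKpos : 0 ≤ K := (Real.exp_pos _).le
  have ha' : 0 ≤ a⁻¹ := (inv_pos.2 ha).le
  refine ⟨(a⁻¹ * S + (S * a⁻¹ + S * a⁻¹ ^ 2) * S) +
    (a⁻¹ + a⁻¹ ^ 2 * K + (a⁻¹ + a⁻¹ ^ 2 + (a⁻¹ ^ 2 * K + a⁻¹ ^ 3 * K + a⁻¹ ^ 2 +
        a⁻¹ ^ 3 * K)) * S) * S, by positivity,
    fun c d κ κ' Δ hc hd hcd hκ hκ' hκκ hα hα' => ?_⟩
  have hΔ := hcd.nonneg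
  have h0 := coeffBound_zero (ι := ι) hM
  have hd0 : CoeffBound (fun k x => d k x - (0 : ℂ)) M := by simpa using hd
  have p1 : 0 ≤ K ^ 3 * (N * 2) := by positivity
  have p2 : 0 ≤ C₀ * M := by positivity
  have p3 : 0 ≤ C₁ * M := by positivity
  have hsup : ∀ z k, ‖entry (transfer E ω c z) k j - entry (transfer E ω d z) k j‖ ≤ S * Δ := by
    intro z k
    rw [← entry_sub]
    refine (norm_entry_le _ _ _).trans ((norm_transfer_sub_le hE hc hd hcd z).trans ?_)
    rw [← hN, ← hK, show K ^ 3 * (N * (2 * Δ)) = K ^ 3 * (N * 2) * Δ by ring]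
    gcongr
    linarith
  have hKb : ∀ (c : ι → ℝ → ℂ), CoeffBound c M → ∀ z k, ‖entry (transfer E ω c z) k j‖ ≤ K :=
    fun c hc z k => (norm_entry_le _ _ _).trans (norm_transfer_le hE hc z)
  have hL2 : L2Maj (fun z => entry (transfer E ω c z) i j - entry (transfer E ω d z) i j)
      (S * Δ) := by
    refine ((l2Maj_transfer_sub hE hω hc hd hcd).entry i j).mono_const ?_
    rw [← hN, ← hK, ← hC₀]
    gcongr
    linarith
  -- Comparison with zero coefficients, whose transfer matrix is `1`: its entry off the diagonal is
  -- `0`, so the entry itself lies in `L²`. This is where `i ≠ j` is needed.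
  have hL2' : L2Maj (fun z => entry (transfer E ω d z) i j) S := by
    have := ((l2Maj_transfer_sub hE hω hd h0 hd0).entry i j).mono_const (K' := S) (by
      rw [← hN, ← hK, ← hC₀]; linarith)
    refine this.mono fun z => ?_
    rw [transfer_zero, entry_sub]
    simp [entry, hij]
  have hinc : ∀ k η, L2Maj (fun z => (entry (transfer E ω c (z + η)) k j -
      entry (transfer E ω c z) k j) - (entry (transfer E ω d (z + η)) k j -
      entry (transfer E ω d z) k j)) (S * Δ * |η|) := fun k η => by
    refine ((H₁ c d Δ η hc hd hcd).entry k j).mono_const ?_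
    gcongr
    linarith
  have hinc' : ∀ k η, L2Maj (fun z => entry (transfer E ω d (z + η)) k j -
      entry (transfer E ω d z) k j) (S * |η|) := fun k η => by
    have := ((H₁ d _ M η hd h0 hd0).entry k j).mono_const (K' := S * |η|) (by
      gcongr; linarith)
    refine this.mono fun z => ?_
    simp only [transfer_zero, entry_sub, sub_self, sub_zero]
    exact le_rfl
  have hκS : ‖κ - κ'‖ ≤ S * Δ := hκκ.trans (le_mul_of_one_le_left hΔ (by linarith))
  constructor
  · refine (l2Maj_quotient_sub ha hSpos hΔ hα hα' hκ hκ' hκS (fun z => hsup z j) hL2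
      hL2').mono_const ?_
    rw [show a⁻¹ * (S * Δ) + (S * Δ * a⁻¹ + S * Δ * a⁻¹ ^ 2) * S =
      (a⁻¹ * S + (S * a⁻¹ + S * a⁻¹ ^ 2) * S) * Δ by ring]
    exact mul_le_mul_of_nonneg_right (le_add_of_nonneg_right (by positivity)) hΔ
  · intro η
    refine (l2Maj_quotient_increment_sub (K := K) (S := S) (Δ := Δ) (η := η)
      (α := fun z => entry (transfer E ω c z) j j) (β := fun z => entry (transfer E ω c z) i j)
      (α' := fun z => entry (transfer E ω d z) j j) (β' := fun z => entry (transfer E ω d z) i j)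
      ha hKpos hSpos hΔ hα hα' hκ hκ'
      (fun z => hKb c hc z i) (fun z => hKb d hd z i) hκS (fun z => hsup z j)
      (fun z => hsup z i) (hinc j η) (hinc i η) (hinc' j η) (hinc' i η)).mono_const ?_
    exact mul_le_mul_of_nonneg_right (mul_le_mul_of_nonneg_right
      (le_add_of_nonneg_left (by positivity)) hΔ) (abs_nonneg η)

end Ratio

/-! ### Oscillatory integrals of entries of the propagator. -/

section Entry

variable {W ι : Type*} [Fintype W] [Nonempty W] [DecidableEq W] [Fintype ι]

/-- `entry` as a continuous linear map. -/
noncomputable def entryCLM (i j : W) : ((W → ℂ) →L[ℂ] (W → ℂ)) →L[ℝ] ℂ :=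
  (((ContinuousLinearMap.proj i : (W → ℂ) →L[ℂ] ℂ).comp
    (ContinuousLinearMap.apply ℂ (W → ℂ) (Pi.single j 1)))).restrictScalars ℝ

/-- The matrix unit `E_{ab}`. -/
noncomputable def matUnit (a b : W) : (W → ℂ) →L[ℂ] (W → ℂ) :=
  (ContinuousLinearMap.proj b : (W → ℂ) →L[ℂ] ℂ).smulRight (Pi.single a 1)

theorem norm_matUnit_le (a b : W) : ‖matUnit a b‖ ≤ 1 := by
  refine ContinuousLinearMap.opNorm_le_bound _ zero_le_one fun v => ?_
  rw [matUnit, ContinuousLinearMap.smulRight_apply, norm_smul, Pi.norm_single, norm_one, mul_one,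
    one_mul]
  exact norm_le_pi_norm v b

theorem entry_matUnit_mul (a b i j : W) (T : (W → ℂ) →L[ℂ] (W → ℂ)) :
    entry (matUnit a b * T) i j = if i = a then entry T b j else 0 := by
  simp [entry, matUnit, Pi.single_apply]

theorem entry_osc_mul (E : ι → (W → ℂ) →L[ℂ] (W → ℂ)) (ω : ι → ℝ) (c : ι → ℝ → ℂ) (z x : ℝ)
    (T : (W → ℂ) →L[ℂ] (W → ℂ)) (i j : W) :
    entry (osc E ω c z x * T) i j =
      ∑ k, c k x * exp (I * (ω k * z * x)) * entry (E k * T) i j := by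
  simp [entry, osc, Finset.sum_apply]

theorem entry_one (i j : W) : entry (1 : (W → ℂ) →L[ℂ] (W → ℂ)) i j = if i = j then 1 else 0 := by
  simp [entry, Pi.single_apply]

theorem isPrim_entry_fwd {P : ℝ → (W → ℂ) →L[ℂ] (W → ℂ)} (hP : Integrable P) (i j : W) :
    IsPrim (fun x => entry (fwd P x) i j) (fun x => entry (P x * fwd P x) i j) :=
  (isPrim_fwd hP).clm (entryCLM i j)

theorem tendsto_entry_fwd_atBot {P : ℝ → (W → ℂ) →L[ℂ] (W → ℂ)} (hP : Integrable P) (i j : W) :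
    Tendsto (fun x => entry (fwd P x) i j) atBot (𝓝 (if i = j then 1 else 0)) := by
  rw [← entry_one]
  exact ((continuous_entry i j).tendsto _).comp (tendsto_fwd_atBot hP)

theorem tendsto_entry_fwd_atTop {P : ℝ → (W → ℂ) →L[ℂ] (W → ℂ)} (hP : Integrable P) (i j : W) :
    Tendsto (fun x => entry (fwd P x) i j) atTop (𝓝 (entry (fwdTop P) i j)) :=
  ((continuous_entry i j).tendsto _).comp (tendsto_fwd_atTop hP)

variable {E : ι → (W → ℂ) →L[ℂ] (W → ℂ)} {ω : ι → ℝ} {M : ℝ}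

theorem norm_fwd_osc_le (hE : ∀ k, ‖E k‖ ≤ 1) {c : ι → ℝ → ℂ} (hc : CoeffBound c M) (z x : ℝ) :
    ‖fwd (osc E ω c z) x‖ ≤ Real.exp (2 * Fintype.card ι * M) :=
  norm_fwd_le (integrable_osc E ω hc.integrable z)
    (integral_norm_le_of_le (integrable_osc E ω hc.integrable z) hc.integrable_env
      (norm_osc_le hE ω c z) (hc.integral_env_le.trans (le_of_eq (by ring)))) x

theorem norm_fwd_osc_sub_le (hE : ∀ k, ‖E k‖ ≤ 1) {c d : ι → ℝ → ℂ} {Δ : ℝ} (hc : CoeffBound c M)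
    (hd : CoeffBound d M) (hcd : CoeffBound (fun k x => c k x - d k x) Δ) (z x : ℝ) :
    ‖fwd (osc E ω c z) x - fwd (osc E ω d z) x‖ ≤
      Real.exp (2 * Fintype.card ι * M) ^ 3 * (2 * Fintype.card ι * Δ) := by
  have ic := integrable_osc E ω hc.integrable z
  have id := integrable_osc E ω hd.integrable z
  refine norm_fwd_sub_fwd_le ic id
    (integral_norm_le_of_le ic hc.integrable_env (norm_osc_le hE ω c z)
      (hc.integral_env_le.trans (le_of_eq (by ring))))
    (integral_norm_le_of_le id hd.integrable_env (norm_osc_le hE ω d z)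
      (hd.integral_env_le.trans (le_of_eq (by ring))))
    (integral_norm_le_of_le (ic.sub id) hcd.integrable_env (fun x => ?_)
      (hcd.integral_env_le.trans (le_of_eq (by ring)))) x
  rw [osc_sub]
  exact norm_osc_le hE ω _ z x

theorem integrable_phase_smul_entry (hE : ∀ k, ‖E k‖ ≤ 1) {c : ι → ℝ → ℂ} (hc : CoeffBound c M)
    {k : ℝ → ℂ} (hk : Integrable k) (ω₀ z : ℝ) (i j : W) :
    Integrable fun s : ℝ => (k s * exp (I * (ω₀ * z * s))) • entry (fwd (osc E ω c z) s) i j :=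
  integrable_bilin (ContinuousLinearMap.lsmul ℝ ℂ) (integrable_mul_phase hk ω₀ z)
    (isPrim_entry_fwd (integrable_osc E ω hc.integrable z) i j).continuous.aestronglyMeasurable
    fun x => (norm_entry_le _ i j).trans (norm_fwd_osc_le hE hc z x)

/-- `L²` Lipschitz continuity of the oscillatory integral of an entry of the propagator. -/
theorem l2Maj_integral_entry_sub (hE : ∀ k, ‖E k‖ ≤ 1) (hM : 0 ≤ M) {ω₀ : ℝ} (hω : |ω₀| = 2)
    (i j : W) :
    ∃ C : ℝ, 0 ≤ C ∧ ∀ (c d : ι → ℝ → ℂ) (k k' : ℝ → ℂ) (Δ B δ : ℝ), CoeffBound c M →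
      CoeffBound d M → CoeffBound (fun k x => c k x - d k x) Δ → Integrable k →
      StronglyMeasurable k → Integrable k' → StronglyMeasurable k' → 0 ≤ B → 0 ≤ δ →
      eLpNorm k' 2 volume ≤ ENNReal.ofReal B →
      eLpNorm (fun x => k x - k' x) 2 volume ≤ ENNReal.ofReal δ →
      L2Maj (fun z => (∫ s, (k s * exp (I * (ω₀ * z * s))) • entry (fwd (osc E ω c z) s) i j) -
        ∫ s, (k' s * exp (I * (ω₀ * z * s))) • entry (fwd (osc E ω d z) s) i j)
        (C * (δ + Δ * B)) := by
  set N : ℝ := (Fintype.card ι : ℝ) with hN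
  set K := Real.exp (2 * N * M) with hK
  have hKpos : 0 ≤ K := (Real.exp_pos _).le
  refine ⟨2 * (1 + K * (2 * N * M)) + 2 * (K ^ 3 * (2 * N) * (2 * N * M) + K * (2 * N)),
    by positivity, fun c d k k' Δ B δ hc hd hcd hk hkm hk' hkm' hB hδ hkB hkδ => ?_⟩
  have ic := fun z => integrable_osc E ω hc.integrable z
  have id := fun z => integrable_osc E ω hd.integrable z
  have hΔ := hcd.nonneg
  have i1 : ∫ x, env c x ≤ 2 * N * M := hc.integral_env_le.trans (le_of_eq (by ring))
  have i2 : ∫ x, env (fun k x => c k x - d k x) x ≤ 2 * N * Δ :=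
    hcd.integral_env_le.trans (le_of_eq (by ring))
  have hij : ‖(if i = j then 1 else 0 : ℂ)‖ ≤ 1 := by split_ifs <;> simp
  -- `J1` treats the difference of the densities against the entry for `c`; `J2` treats the density
  -- `k'` against the difference of the entries, which starts from `0` at `-∞`.
  have J1 := l2Maj_integral_phase_smul (C₀ := 1) (V := K * (2 * N * M)) (ν := fun x => K * env c x)
    (hk.sub hk') (hkm.sub hkm') hδ hkδ hω (fun z => isPrim_entry_fwd (ic z) i j)
    (fun z => tendsto_entry_fwd_atBot (ic z) i j) (fun _ => hij)
    (fun z => (continuous_entry i j).comp_aestronglyMeasurable (integrable_mul_fwd (ic z)).1)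
    (hc.measurable_env.const_mul _) (hc.integrable_env.const_mul _)
    (fun z t => (norm_entry_le _ i j).trans ((norm_mul_le _ _).trans (by
      rw [mul_comm]
      exact mul_le_mul (norm_fwd_osc_le hE hc z t) (norm_osc_le hE ω c z t) (norm_nonneg _)
        hKpos)))
    (by rw [integral_const_mul]; gcongr)
  have J2 := l2Maj_integral_phase_smul (C₀ := 0)
    (V := K ^ 3 * (2 * N * Δ) * (2 * N * M) + K * (2 * N * Δ))
    (ν := fun x => K ^ 3 * (2 * N * Δ) * env c x + K * env (fun k x => c k x - d k x) x)
    (e := fun _ => 0) hk' hkm' hB hkB hω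
    (fun z => (isPrim_entry_fwd (ic z) i j).sub (isPrim_entry_fwd (id z) i j))
    (fun z => by
      simpa using (tendsto_entry_fwd_atBot (ic z) i j).sub (tendsto_entry_fwd_atBot (id z) i j))
    (fun _ => by simp)
    (fun z => ((continuous_entry i j).comp_aestronglyMeasurable (integrable_mul_fwd (ic z)).1).sub
      ((continuous_entry i j).comp_aestronglyMeasurable (integrable_mul_fwd (id z)).1))
    ((hc.measurable_env.const_mul _).add (hcd.measurable_env.const_mul _))
    ((hc.integrable_env.const_mul _).add (hcd.integrable_env.const_mul _))
    (fun z t => by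
      rw [← entry_sub]
      refine (norm_entry_le _ i j).trans ?_
      rw [show osc E ω c z t * fwd (osc E ω c z) t - osc E ω d z t * fwd (osc E ω d z) t =
        osc E ω c z t * (fwd (osc E ω c z) t - fwd (osc E ω d z) t) +
        (osc E ω c z t - osc E ω d z t) * fwd (osc E ω d z) t by
          rw [mul_sub, sub_mul]; abel]
      refine norm_add_le_of_le ((norm_mul_le _ _).trans ?_) ((norm_mul_le _ _).trans ?_)
      · rw [mul_comm]
        exact mul_le_mul (norm_fwd_osc_sub_le hE hc hd hcd z t) (norm_osc_le hE ω c z t)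
          (norm_nonneg _) (by positivity)
      · rw [mul_comm, osc_sub]
        exact mul_le_mul (norm_fwd_osc_le hE hd z t) (norm_osc_le hE ω _ z t)
          (norm_nonneg _) hKpos)
    (by
      rw [integral_add (hc.integrable_env.const_mul _) (hcd.integrable_env.const_mul _),
        integral_const_mul, integral_const_mul]
      gcongr)
  refine (J1.of_le_add J2 fun z => ?_).mono_const ?_
  · have a1 := integrable_phase_smul_entry (ω := ω) hE hc hk ω₀ z i j
    have a2 := integrable_phase_smul_entry (ω := ω) hE hd hk' ω₀ z i j
    have a3 := integrable_phase_smul_entry (ω := ω) hE hc hk' ω₀ z i j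
    have a4 := integrable_phase_smul_entry (ω := ω) hE hc (hk.sub hk') ω₀ z i j
    refine (le_of_eq ?_).trans (norm_add_le _ _)
    simp only [smul_sub]
    rw [integral_sub a3 a2, ← add_sub_assoc, ← integral_add a4 a3]
    congr 3; ext s
    rw [← add_smul, Pi.sub_apply]
    congr 1; ring
  · have e1 : 0 ≤ (2 * (1 + K * (2 * N * M))) * (Δ * B) := by positivity
    have e2 : 0 ≤ 2 * (K ^ 3 * (2 * N) * (2 * N * M) + K * (2 * N)) * δ := by positivity
    nlinarith

end Entry

/-! ### Products of two square integrable functions. -/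

section Hoelder

theorem integrable_mul_of_eLpNorm_two {f g : ℝ → ℂ} {a b : ℝ} (ha : 0 ≤ a) (hb : 0 ≤ b)
    (hf : AEStronglyMeasurable f volume) (hg : AEStronglyMeasurable g volume)
    (hfa : eLpNorm f 2 volume ≤ ENNReal.ofReal a) (hgb : eLpNorm g 2 volume ≤ ENNReal.ofReal b) :
    Integrable (fun x => f x * g x) ∧ ∫ x, ‖f x * g x‖ ≤ a * b := by
  have h : eLpNorm (fun x => f x * g x) 1 volume ≤ ENNReal.ofReal (a * b) := by
    refine (eLpNorm_smul_le_mul_eLpNorm (p := 2) (q := 2) hg hf).trans ?_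
    rw [ENNReal.ofReal_mul ha]
    gcongr
  have hi : Integrable (fun x => f x * g x) :=
    memLp_one_iff_integrable.1 ⟨hf.mul hg, h.trans_lt ENNReal.ofReal_lt_top⟩
  refine ⟨hi, ?_⟩
  rw [integral_norm_eq_lintegral_enorm hi.1, ← eLpNorm_one_eq_lintegral_enorm]
  exact ENNReal.toReal_le_of_le_ofReal (mul_nonneg ha hb) h

theorem norm_integral_Ioi_le {f : ℝ → ℂ} {a : ℝ} (hf : Integrable f) (ha : ∫ x, ‖f x‖ ≤ a)
    (x : ℝ) : ‖∫ y in Ioi x, f y‖ ≤ a :=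
  (norm_integral_le_integral_norm _).trans
    ((setIntegral_le_integral hf.norm (.of_forall fun _ => norm_nonneg _)).trans ha)

end Hoelder

/-! ### Decay in `z` from one more derivative of the coefficient `c₁`. -/

section Decay

/-- The matrix units of the transformed system. -/
noncomputable def sysUnit : Fin 3 → (Fin 3 → ℂ) →L[ℂ] (Fin 3 → ℂ) :=
  ![matUnit 0 1, matUnit 1 0, matUnit 2 0]

/-- The frequencies of the transformed system. -/
def sysFreq : Fin 3 → ℝ := ![2, -2, -2]

theorem norm_sysUnit_le (k : Fin 3) : ‖sysUnit k‖ ≤ 1 := by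
  fin_cases k <;> exact norm_matUnit_le _ _

theorem abs_sysFreq (k : Fin 3) : |sysFreq k| = 2 := by
  fin_cases k <;> simp [sysFreq]

/-- `b` is the derivative of the coefficient `c₁`, bounded in `L²`. -/
structure SmoothBound (c : Fin 3 → ℝ → ℂ) (b : ℝ → ℂ) (M : ℝ) : Prop extends CoeffBound c M where
  prim : IsPrim (c 1) b
  bot : Tendsto (c 1) atBot (𝓝 0)
  top : Tendsto (c 1) atTop (𝓝 0)
  meas_deriv : StronglyMeasurable b
  deriv_le : eLpNorm b 2 volume ≤ ENNReal.ofReal M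

variable {c d : Fin 3 → ℝ → ℂ} {b b' : ℝ → ℂ} {M Δ z : ℝ}

theorem CoeffBound.eLpNorm_le (h : CoeffBound c M) (k : Fin 3) :
    eLpNorm (c k) 2 volume ≤ ENNReal.ofReal M :=
  (eLpNorm_le_normL21 _).trans (h.norm_le k)

theorem CoeffBound.mul_bound (h : CoeffBound c M) :
    Integrable (fun x => c 0 x * c 1 x) ∧ ∫ x, ‖c 0 x * c 1 x‖ ≤ M * M :=
  integrable_mul_of_eLpNorm_two h.nonneg h.nonneg (h.meas 0).aestronglyMeasurable
    (h.meas 1).aestronglyMeasurable (h.eLpNorm_le 0) (h.eLpNorm_le 1)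

/-- The function `x ↦ ∫ₓ^∞ c₀ c₁`. -/
noncomputable def tailMul (c : Fin 3 → ℝ → ℂ) (x : ℝ) : ℂ := ∫ y in Ioi x, c 0 y * c 1 y

theorem CoeffBound.continuous_tailMul (h : CoeffBound c M) : Continuous (tailMul c) :=
  (isPrim_integral_Ioi h.mul_bound.1).continuous

theorem CoeffBound.norm_tailMul_le (h : CoeffBound c M) (x : ℝ) : ‖tailMul c x‖ ≤ M * M :=
  norm_integral_Ioi_le h.mul_bound.1 h.mul_bound.2 x

theorem CoeffBound.norm_tailMul_sub_le (hc : CoeffBound c M) (hd : CoeffBound d M)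
    (hcd : CoeffBound (fun k x => c k x - d k x) Δ) (x : ℝ) :
    ‖tailMul c x - tailMul d x‖ ≤ 2 * M * Δ := by
  obtain ⟨i1, n1⟩ := integrable_mul_of_eLpNorm_two hcd.nonneg hc.nonneg
    (hcd.meas 0).aestronglyMeasurable (hc.meas 1).aestronglyMeasurable (hcd.eLpNorm_le 0)
    (hc.eLpNorm_le 1)
  obtain ⟨i2, n2⟩ := integrable_mul_of_eLpNorm_two hd.nonneg hcd.nonneg
    (hd.meas 0).aestronglyMeasurable (hcd.meas 1).aestronglyMeasurable (hd.eLpNorm_le 0)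
    (hcd.eLpNorm_le 1)
  have : tailMul c x - tailMul d x = (∫ y in Ioi x, (c 0 y - d 0 y) * c 1 y) +
      ∫ y in Ioi x, d 0 y * (c 1 y - d 1 y) := by
    rw [tailMul, tailMul, ← integral_sub hc.mul_bound.1.integrableOn hd.mul_bound.1.integrableOn,
      ← integral_add i1.integrableOn i2.integrableOn]
    congr 1; ext y; ring
  rw [this]
  exact (norm_add_le_of_le (norm_integral_Ioi_le i1 n1 x) (norm_integral_Ioi_le i2 n2 x)).trans
    (le_of_eq (by ring))

/-- The density whose oscillatory integral is `2iz` times an entry of the transfer matrix. -/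
noncomputable def decayDensity (c : Fin 3 → ℝ → ℂ) (b : ℝ → ℂ) (x : ℝ) : ℂ :=
  b x + tailMul c x * c 1 x

theorem SmoothBound.stronglyMeasurable_decayDensity (h : SmoothBound c b M) :
    StronglyMeasurable (decayDensity c b) :=
  h.meas_deriv.add (h.continuous_tailMul.stronglyMeasurable.mul (h.meas 1))

theorem eLpNorm_mul_le_of_bound {f g : ℝ → ℂ} {K B : ℝ} (hK : ∀ x, ‖f x‖ ≤ K) (hK0 : 0 ≤ K)
    (hB : eLpNorm g 2 volume ≤ ENNReal.ofReal B) :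
    eLpNorm (fun x => f x * g x) 2 volume ≤ ENNReal.ofReal (K * B) := by
  refine (eLpNorm_le_mul_eLpNorm_of_ae_le_mul (c := K) (g := g) (.of_forall fun x => ?_) 2).trans ?_
  · rw [norm_mul]
    exact mul_le_mul_of_nonneg_right (hK x) (norm_nonneg _)
  · rw [ENNReal.ofReal_mul hK0]
    gcongr

theorem SmoothBound.eLpNorm_decayDensity_le (h : SmoothBound c b M) :
    eLpNorm (decayDensity c b) 2 volume ≤ ENNReal.ofReal (M + M * M * M) := by
  have h0 := h.nonneg
  refine (eLpNorm_add_le h.meas_deriv.aestronglyMeasurable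
    (h.continuous_tailMul.stronglyMeasurable.mul (h.meas 1)).aestronglyMeasurable
    one_le_two).trans ?_
  rw [ENNReal.ofReal_add h0 (by positivity)]
  exact add_le_add h.deriv_le (eLpNorm_mul_le_of_bound h.norm_tailMul_le (by positivity)
    (h.toCoeffBound.eLpNorm_le 1))

theorem SmoothBound.eLpNorm_decayDensity_sub_le (hc : SmoothBound c b M) (hd : SmoothBound d b' M)
    (hcd : SmoothBound (fun k x => c k x - d k x) (fun x => b x - b' x) Δ) :
    eLpNorm (fun x => decayDensity c b x - decayDensity d b' x) 2 volume ≤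
      ENNReal.ofReal (Δ + (2 * M * Δ * M + M * M * Δ)) := by
  have hM := hc.nonneg
  have hΔ := hcd.nonneg
  have e : (fun x => decayDensity c b x - decayDensity d b' x) = fun x => (b x - b' x) +
      ((tailMul c x - tailMul d x) * c 1 x + tailMul d x * (c 1 x - d 1 x)) := by
    ext x; simp only [decayDensity]; ring
  have m1 : StronglyMeasurable fun x => (tailMul c x - tailMul d x) * c 1 x :=
    (hc.continuous_tailMul.sub hd.continuous_tailMul).stronglyMeasurable.mul (hc.meas 1)
  have m2 : StronglyMeasurable fun x => tailMul d x * (c 1 x - d 1 x) :=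
    hd.continuous_tailMul.stronglyMeasurable.mul (hcd.meas 1)
  rw [e]
  refine (eLpNorm_add_le hcd.meas_deriv.aestronglyMeasurable (m1.add m2).aestronglyMeasurable
    one_le_two).trans ?_
  rw [ENNReal.ofReal_add hΔ (by positivity), ENNReal.ofReal_add (by positivity) (by positivity)]
  refine add_le_add hcd.deriv_le ((eLpNorm_add_le m1.aestronglyMeasurable m2.aestronglyMeasurable
    one_le_two).trans (add_le_add ?_ ?_))
  · exact eLpNorm_mul_le_of_bound
      (hc.toCoeffBound.norm_tailMul_sub_le hd.toCoeffBound hcd.toCoeffBound) (by positivity)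
      (hc.toCoeffBound.eLpNorm_le 1)
  · exact eLpNorm_mul_le_of_bound hd.norm_tailMul_le (by positivity)
      (hcd.toCoeffBound.eLpNorm_le 1)

theorem SmoothBound.intervalIntegrable_decayDensity (h : SmoothBound c b M) (x y : ℝ) :
    IntervalIntegrable (decayDensity c b) volume x y := by
  refine (h.prim.1 x y).add (Integrable.intervalIntegrable ?_)
  exact (h.integrable 1).bdd_mul h.continuous_tailMul.aestronglyMeasurable
    (.of_forall h.norm_tailMul_le)

theorem isPrim_phase (ω z : ℝ) : IsPrim (fun x : ℝ => exp (I * (ω * z * x)))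
    (fun x : ℝ => I * (ω * z) * exp (I * (ω * z * x))) := by
  refine isPrim_of_hasDerivAt (fun x => ?_) (by fun_prop)
  have h : HasDerivAt (fun x : ℝ => I * (ω * z * (x : ℂ))) (I * (ω * z)) x := by
    have := ((Complex.ofRealCLM.hasDerivAt (x := x)).const_mul ((ω : ℂ) * z)).const_mul I
    simpa using this
  simpa [mul_comm] using h.cexp

theorem isPrim_sys_zero (h : CoeffBound c M) (z : ℝ) (j : Fin 3) :
    IsPrim (fun x => entry (fwd (osc sysUnit sysFreq c z) x) 0 j) (fun x : ℝ => c 0 x *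
      exp (I * ((2 : ℝ) * z * x)) * entry (fwd (osc sysUnit sysFreq c z) x) 1 j) :=
  (isPrim_entry_fwd (integrable_osc _ _ h.integrable z) 0 j).congr fun x => by
    simp [entry_osc_mul, Fin.sum_univ_three, sysUnit, sysFreq, entry_matUnit_mul]

theorem isPrim_sys_one (h : CoeffBound c M) (z : ℝ) (j : Fin 3) :
    IsPrim (fun x => entry (fwd (osc sysUnit sysFreq c z) x) 1 j) (fun x : ℝ => c 1 x *
      exp (I * ((-2 : ℝ) * z * x)) * entry (fwd (osc sysUnit sysFreq c z) x) 0 j) :=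
  (isPrim_entry_fwd (integrable_osc _ _ h.integrable z) 1 j).congr fun x => by
    simp [entry_osc_mul, Fin.sum_univ_three, sysUnit, sysFreq, entry_matUnit_mul]

/-- The factor `2iz` is absorbed by integrating `c₁ e^{-2izx} N₁` by parts, at the price of a
derivative of `c₁`. The symmetric truncations are needed because the density is only known to be
locally integrable and in `L²`. -/
theorem SmoothBound.tendsto_integral_decayDensity (h : SmoothBound c b M) (z : ℝ) :
    Tendsto (fun n : ℕ => ∫ s : ℝ, ((Ioc (-(n : ℝ)) n).indicator (decayDensity c b) s *
      exp (I * ((-2 : ℝ) * z * s))) • entry (fwd (osc sysUnit sysFreq c z) s) 0 0) atTop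
      (𝓝 (2 * I * z * entry (transfer sysUnit sysFreq c z) 1 0)) := by
  have ic := integrable_osc sysUnit sysFreq h.integrable z
  set N1 : ℝ → ℂ := fun x => entry (fwd (osc sysUnit sysFreq c z) x) 0 0
  set N2 : ℝ → ℂ := fun x => entry (fwd (osc sysUnit sysFreq c z) x) 1 0
  have p1 : IsPrim N1 _ := isPrim_sys_zero h.toCoeffBound z 0
  have p2 : IsPrim N2 _ := isPrim_sys_one h.toCoeffBound z 0
  have t1 : Tendsto N1 atBot (𝓝 1) := by simpa using tendsto_entry_fwd_atBot ic 0 0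
  have t2 : Tendsto N2 atBot (𝓝 0) := by simpa using tendsto_entry_fwd_atBot ic 1 0
  have s1 : Tendsto N1 atTop _ := tendsto_entry_fwd_atTop ic 0 0
  have s2 : Tendsto N2 atTop (𝓝 (entry (transfer sysUnit sysFreq c z) 1 0)) :=
    tendsto_entry_fwd_atTop ic 1 0
  have pγ : IsPrim (tailMul c) _ := isPrim_integral_Ioi h.mul_bound.1
  have gb : Tendsto (tailMul c) atBot _ := tendsto_integral_Ioi_atBot h.mul_bound.1
  have gt : Tendsto (tailMul c) atTop _ := tendsto_integral_Ioi_atTop h.mul_bound.1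
  -- In `Q'` the derivative of the phase cancels `2iz N₂'`, and the term `c₀ c₁ N₂` coming from
  -- `N₁'` cancels the one from the derivative of `tailMul c`. What remains is the density times
  -- phase and `N₁`. The limits of `Q` are `0` at `-∞` and `2iz N₂(+∞)` at `+∞`, since `c₁` vanishes
  -- at both ends and `tailMul c` at `+∞`.
  set Q : ℝ → ℂ := fun x => exp (I * ((-2 : ℝ) * z * x)) * c 1 x * N1 x + 2 * I * z * N2 x +
    tailMul c x * N2 x with hQ
  have pQ : IsPrim Q fun x => (decayDensity c b x * exp (I * ((-2 : ℝ) * z * x))) • N1 x := by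
    refine ((((isPrim_phase (-2) z).mul h.prim).mul p1).add
      ((isPrim_const (2 * I * z)).mul p2)).add (pγ.mul p2) |>.congr fun x => ?_
    have e : exp (I * ((2 : ℝ) * z * x)) * exp (I * ((-2 : ℝ) * z * x)) = 1 := by
      rw [← Complex.exp_add, ← Complex.exp_zero]; congr 1; push_cast; ring
    have e' : c 1 x * c 0 x * N2 x * (exp (I * ((2 : ℝ) * z * x)) *
      exp (I * ((-2 : ℝ) * z * x)) - 1) = 0 := by rw [e]; ring
    simp only [decayDensity, smul_eq_mul]
    push_cast at e' ⊢
    linear_combination e'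
  have hz : ∀ l : Filter ℝ, Tendsto (c 1) l (𝓝 0) →
      Tendsto (fun x : ℝ => exp (I * ((-2 : ℝ) * z * x)) * c 1 x) l (𝓝 0) := fun l hl => by
    rw [tendsto_zero_iff_norm_tendsto_zero] at hl ⊢
    exact hl.congr fun x => by rw [norm_mul, norm_exp_I_mul, one_mul]
  have qb : Tendsto Q atBot (𝓝 0) := by
    have := (((hz _ h.bot).mul t1).add (t2.const_mul (2 * I * z))).add (gb.mul t2)
    simpa only [zero_mul, mul_zero, add_zero, zero_add] using this
  have qt : Tendsto Q atTop (𝓝 (2 * I * z * entry (transfer sysUnit sysFreq c z) 1 0)) := by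
    have := (((hz _ h.top).mul s1).add (s2.const_mul (2 * I * z))).add (gt.mul s2)
    simpa only [zero_mul, mul_zero, add_zero, zero_add] using this
  have hn := tendsto_natCast_atTop_atTop (R := ℝ)
  have hlim := (qt.comp hn).sub (qb.comp (tendsto_neg_atTop_atBot.comp hn))
  rw [sub_zero] at hlim
  refine hlim.congr fun n => ?_
  have hle : -(n : ℝ) ≤ n := by linarith [n.cast_nonneg (α := ℝ)]
  simp only [Function.comp_apply]
  rw [pQ.2 (-(n : ℝ)) n, intervalIntegral.integral_of_le hle, ← integral_indicator measurableSet_Ioc]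
  congr 1; ext s
  by_cases hs : s ∈ Ioc (-(n : ℝ)) n <;> simp [hs, N1]

/-- `L²` Lipschitz continuity of `z` times an entry of the transfer matrix. -/
theorem l2Maj_mul_transfer_sub (hM : 0 ≤ M) :
    ∃ C : ℝ, 0 ≤ C ∧ ∀ (c d : Fin 3 → ℝ → ℂ) (b b' : ℝ → ℂ) (Δ : ℝ), SmoothBound c b M →
      SmoothBound d b' M → SmoothBound (fun k x => c k x - d k x) (fun x => b x - b' x) Δ →
      L2Maj (fun z : ℝ => (z : ℂ) * entry (transfer sysUnit sysFreq c z) 1 0 -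
        z * entry (transfer sysUnit sysFreq d z) 1 0) (C * Δ) := by
  obtain ⟨C, hC, H⟩ := l2Maj_integral_entry_sub (E := sysUnit) (ω := sysFreq) norm_sysUnit_le hM
    (ω₀ := -2) (by norm_num) 0 0
  refine ⟨1 / 2 * (C * (1 + (2 * M * M + M * M) + (M + M * M * M))), by positivity,
    fun c d b b' Δ hc hd hcd => ?_⟩
  have hΔ := hcd.nonneg
  -- The truncated densities are integrable and their `L²` bounds do not depend on `n`, so Fatou's
  -- lemma passes to the limit.
  have key := L2Maj.of_tendsto (fun n : ℕ => H c d
    ((Ioc (-(n : ℝ)) n).indicator (decayDensity c b))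
    ((Ioc (-(n : ℝ)) n).indicator (decayDensity d b')) Δ (M + M * M * M)
    (Δ + (2 * M * Δ * M + M * M * Δ)) hc.toCoeffBound hd.toCoeffBound hcd.toCoeffBound
    ((integrable_indicator_iff measurableSet_Ioc).2 (hc.intervalIntegrable_decayDensity _ _).1)
    (hc.stronglyMeasurable_decayDensity.indicator measurableSet_Ioc)
    ((integrable_indicator_iff measurableSet_Ioc).2 (hd.intervalIntegrable_decayDensity _ _).1)
    (hd.stronglyMeasurable_decayDensity.indicator measurableSet_Ioc)
    (by positivity) (by positivity)
    ((eLpNorm_indicator_le _).trans hd.eLpNorm_decayDensity_le) (by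
      refine le_trans (le_of_eq ?_) ((eLpNorm_indicator_le (s := Ioc (-(n : ℝ)) n) _).trans
        (hc.eLpNorm_decayDensity_sub_le hd hcd))
      congr 1; ext x
      simp only [Set.indicator]
      split_ifs <;> simp))
    (fun z => (hc.tendsto_integral_decayDensity z).sub (hd.tendsto_integral_decayDensity z))
  refine (key.of_le_mul (C := 1 / 2) (by norm_num) fun z => le_of_eq ?_).mono_const
    (le_of_eq (by ring))
  rw [show 2 * I * (z : ℂ) * entry (transfer sysUnit sysFreq c z) 1 0 -
    2 * I * z * entry (transfer sysUnit sysFreq d z) 1 0 = 2 * I *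
    (z * entry (transfer sysUnit sysFreq c z) 1 0 - z * entry (transfer sysUnit sysFreq d z) 1 0)
    by ring, norm_mul]
  simp

theorem smoothBound_zero (hM : 0 ≤ M) : SmoothBound (fun _ _ => 0) (fun _ => 0) M where
  toCoeffBound := coeffBound_zero hM
  prim := isPrim_const 0
  bot := tendsto_const_nhds
  top := tendsto_const_nhds
  meas_deriv := stronglyMeasurable_const
  deriv_le := by simp

/-- `L²` Lipschitz continuity of `z` times a quotient of entries of the transfer matrix. -/
theorem l2Maj_mul_ratio_sub (hM : 0 ≤ M) {a : ℝ} (ha : 0 < a) :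
    ∃ C : ℝ, 0 ≤ C ∧ ∀ (c d : Fin 3 → ℝ → ℂ) (b b' : ℝ → ℂ) (κ κ' : ℂ) (Δ : ℝ),
      SmoothBound c b M → SmoothBound d b' M →
      SmoothBound (fun k x => c k x - d k x) (fun x => b x - b' x) Δ →
      ‖κ‖ ≤ 1 → ‖κ'‖ ≤ 1 → ‖κ - κ'‖ ≤ Δ →
      (∀ z, a ≤ ‖entry (transfer sysUnit sysFreq c z) 0 0‖) →
      (∀ z, a ≤ ‖entry (transfer sysUnit sysFreq d z) 0 0‖) →
      L2Maj (fun z : ℝ => (z : ℂ) * (κ * entry (transfer sysUnit sysFreq c z) 1 0 /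
          entry (transfer sysUnit sysFreq c z) 0 0 -
        κ' * entry (transfer sysUnit sysFreq d z) 1 0 /
          entry (transfer sysUnit sysFreq d z) 0 0)) (C * Δ) := by
  obtain ⟨C, hC, H⟩ := l2Maj_mul_transfer_sub hM
  set K := Real.exp (4 * Fintype.card (Fin 3) * M) ^ 3 * (Fintype.card (Fin 3) * 2) with hK
  have hKpos : 0 ≤ K := by positivity
  set S := 1 + C + K + C * M with hS
  have hSpos : 0 ≤ S := by positivity
  have ha' : 0 ≤ a⁻¹ := (inv_pos.2 ha).le
  refine ⟨a⁻¹ * S + (S * a⁻¹ + S * a⁻¹ ^ 2) * S, by positivity,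
    fun c d b b' κ κ' Δ hc hd hcd hκ hκ' hκκ hα hα' => ?_⟩
  have hΔ := hcd.nonneg
  have h1 := (H c d b b' Δ hc hd hcd).mono_const (K' := S * Δ)
    (mul_le_mul_of_nonneg_right (by nlinarith [mul_nonneg hC hM]) hΔ)
  have h2 := (H d _ b' _ M hd (smoothBound_zero hM) (by simpa using hd)).mono_const (K' := S)
    (by linarith)
  simp only [transfer_zero, entry_one] at h2
  refine ((l2Maj_quotient_sub (β := fun z : ℝ => z * entry (transfer sysUnit sysFreq c z) 1 0)
    (β' := fun z : ℝ => z * entry (transfer sysUnit sysFreq d z) 1 0) ha hSpos hΔ hα hα' hκ hκ'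
    (hκκ.trans (le_mul_of_one_le_left hΔ (by nlinarith [mul_nonneg hC hM]))) (fun z => ?_) h1
    (by simpa using h2)).mono fun z => le_of_eq ?_).mono_const (le_of_eq (by ring))
  · rw [← entry_sub]
    refine (norm_entry_le _ _ _).trans ((norm_transfer_sub_le norm_sysUnit_le hc.toCoeffBound
      hd.toCoeffBound hcd.toCoeffBound z).trans ?_)
    refine le_trans (le_of_eq ?_) (mul_le_mul_of_nonneg_right
      (show K ≤ S by nlinarith [mul_nonneg hC hM]) hΔ)
    rw [hK]; ring
  · congr 1; ring

end Decay

/-! ### Solutions normalised at `-∞` or at `+∞`. -/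

section Flow

variable {W : Type*} [Fintype W] [Nonempty W] [DecidableEq W]
  {P : ℝ → (W → ℂ) →L[ℂ] (W → ℂ)} {ψ : ℝ → W → ℂ} {w : W → ℂ}

/-- Evaluation at a vector, as a real continuous linear map. -/
noncomputable def evalCLM (w : W → ℂ) : ((W → ℂ) →L[ℂ] (W → ℂ)) →L[ℝ] (W → ℂ) :=
  (ContinuousLinearMap.apply ℂ (W → ℂ) w).restrictScalars ℝ

theorem isPrim_fwd_apply (hP : Integrable P) (w : W → ℂ) :
    IsPrim (fun x => fwd P x w) fun x => P x (fwd P x w) :=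
  (isPrim_fwd hP).clm (evalCLM w)

theorem integrable_fwd_apply (hP : Integrable P) (w : W → ℂ) :
    Integrable fun x => P x (fwd P x w) :=
  (evalCLM w).integrable_comp (integrable_mul_fwd hP)

theorem tendsto_fwd_apply_atBot (hP : Integrable P) (w : W → ℂ) :
    Tendsto (fun x => fwd P x w) atBot (𝓝 w) :=
  ((evalCLM w).continuous.tendsto _).comp (tendsto_fwd_atBot hP)

theorem tendsto_fwd_apply_atTop (hP : Integrable P) (w : W → ℂ) :
    Tendsto (fun x => fwd P x w) atTop (𝓝 (fwdTop P w)) :=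
  ((evalCLM w).continuous.tendsto _).comp (tendsto_fwd_atTop hP)

theorem norm_fwd_apply_le (hP : Integrable P) (w : W → ℂ) (x : ℝ) :
    ‖fwd P x w‖ ≤ Real.exp (∫ y, ‖P y‖) * ‖w‖ :=
  (ContinuousLinearMap.le_opNorm _ _).trans
    (mul_le_mul_of_nonneg_right (norm_fwd_le hP le_rfl x) (norm_nonneg _))

/-- Solutions of `ψ' = P ψ` are determined by their limit at `-∞`. -/
theorem IsPrim.eq_fwd_apply (hP : Integrable P) (hψ : IsPrim ψ fun x => P x (ψ x))
    (hi : Integrable fun x => P x (ψ x)) (hw : Tendsto ψ atBot (𝓝 w)) (x : ℝ) :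
    ψ x = fwd P x w := by
  have hL : Integrable fun x => (P x).restrictScalars ℝ :=
    (ContinuousLinearMap.restrictScalarsL ℂ (W → ℂ) (W → ℂ) ℝ ℝ).integrable_comp hP
  refine IsPrim.eq_of_tendsto (L := fun x => (P x).restrictScalars ℝ)
    (K := ‖w‖ + ∫ y, ‖P y (ψ y)‖) hL hψ (isPrim_fwd_apply hP w)
    (fun x => ?_) (norm_fwd_apply_le hP w) hw (tendsto_fwd_apply_atBot hP w) x
  rw [hψ.eq_integral_Iic hi hw x]
  refine norm_add_le_of_le le_rfl ((norm_integral_le_integral_norm _).trans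
    (setIntegral_le_integral hi.norm (.of_forall fun _ => norm_nonneg _)))

theorem eq_integral_Iic_iff (hP : Integrable P) (hi : Integrable fun x => P x (ψ x)) :
    (∀ x, ψ x = w + ∫ y in Iic x, P y (ψ y)) ↔ ∀ x, ψ x = fwd P x w := by
  constructor
  · intro h
    have hp : IsPrim ψ fun x => P x (ψ x) := by
      simpa using ((isPrim_const w).add (isPrim_integral_Iic hi)).congr_left fun x => (h x).symm
    refine hp.eq_fwd_apply hP hi ?_
    have := (tendsto_integral_Iic_atBot hi).const_add w
    rw [add_zero] at this
    exact this.congr fun x => (h x).symm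
  · intro h
    obtain rfl : ψ = fun x => fwd P x w := funext h
    exact (isPrim_fwd_apply hP w).eq_integral_Iic (integrable_fwd_apply hP w)
      (tendsto_fwd_apply_atBot hP w)

theorem bwdTop_apply_fwdTop_apply (hP : Integrable P) (w : W → ℂ) :
    bwdTop P (fwdTop P w) = w := by
  rw [← mul_apply_eq_comp, bwdTop_mul_fwdTop hP]; rfl

theorem fwdTop_apply_bwdTop_apply (hP : Integrable P) (w : W → ℂ) :
    fwdTop P (bwdTop P w) = w := by
  rw [← mul_apply_eq_comp, fwdTop_mul_bwdTop hP]; rfl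

/-- Normalisation at `+∞` reduces to normalisation at `-∞`: the value at `-∞` must be the preimage
of `w` under the transfer operator. -/
theorem eq_integral_Ioi_iff (hP : Integrable P) (hi : Integrable fun x => P x (ψ x)) :
    (∀ x, ψ x = w - ∫ y in Ioi x, P y (ψ y)) ↔ ∀ x, ψ x = fwd P x (bwdTop P w) := by
  constructor
  · intro h
    have hp : IsPrim ψ fun x => P x (ψ x) := by
      simpa using ((isPrim_const w).sub (isPrim_integral_Ioi hi)).congr_left fun x => (h x).symm
    have hb := hp.integral_Iic hi 0
    have e := hp.eq_fwd_apply hP hi hb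
    have ht : Tendsto ψ atTop (𝓝 w) := by
      have := (tendsto_integral_Ioi_atTop hi).const_sub w
      rw [sub_zero] at this
      exact this.congr fun x => (h x).symm
    have ht' := tendsto_nhds_unique (ht.congr e) (tendsto_fwd_apply_atTop hP _)
    intro x
    rw [e x, ht', bwdTop_apply_fwdTop_apply hP]
  · intro h
    obtain rfl : ψ = fun x => fwd P x (bwdTop P w) := funext h
    refine (isPrim_fwd_apply hP _).eq_integral_Ioi (integrable_fwd_apply hP _) ?_
    have := tendsto_fwd_apply_atTop hP (bwdTop P w)
    rwa [fwdTop_apply_bwdTop_apply hP] at this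

end Flow

/-! ### Jost functions and scattering coefficients in the interaction picture. -/

section Jost

/-- The matrix units of the spectral problem. -/
noncomputable def knUnit : Fin 2 → (Fin 2 → ℂ) →L[ℂ] (Fin 2 → ℂ) := ![matUnit 0 1, matUnit 1 0]

/-- The frequencies of the spectral problem. -/
def knFreq : Fin 2 → ℝ := ![2, -2]

/-- The coefficients of the spectral problem. -/
noncomputable def knCoeff (u : ℝ → ℂ) (l : ℂ) : Fin 2 → ℝ → ℂ :=
  ![fun x => l * u x, fun x => -(l * conj (u x))]

/-- The generator of the spectral problem in the interaction picture. -/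
noncomputable def knGen (u : ℝ → ℂ) (l : ℂ) (z : ℝ) : ℝ → (Fin 2 → ℂ) →L[ℂ] (Fin 2 → ℂ) :=
  osc knUnit knFreq (knCoeff u l) z

theorem integrable_conj {u : ℝ → ℂ} (hu : Integrable u) : Integrable fun x => conj (u x) :=
  (Complex.conjCLE : ℂ →L[ℝ] ℂ).integrable_comp hu

theorem integrable_knGen {u : ℝ → ℂ} (hu : Integrable u) (l : ℂ) (z : ℝ) :
    Integrable (knGen u l z) := by
  refine integrable_osc _ _ (fun k => ?_) z
  fin_cases k
  · exact hu.const_mul l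
  · exact ((integrable_conj hu).const_mul l).neg

/-- The diagonal matrix with entries `e^{iσzx}` and `e^{i(σ+2)zx}`. -/
noncomputable def diagPhase (σ z x : ℝ) : Matrix (Fin 2) (Fin 2) ℂ :=
  !![exp (I * (σ * z * x)), 0; 0, exp (I * ((σ + 2 : ℝ) * z * x))]

theorem diagPhase_mulVec (σ z x : ℝ) (v : Fin 2 → ℂ) : diagPhase σ z x *ᵥ v =
    ![exp (I * (σ * z * x)) * v 0, exp (I * ((σ + 2 : ℝ) * z * x)) * v 1] := by
  ext i; fin_cases i <;> simp [diagPhase, Matrix.mulVec, dotProduct, Fin.sum_univ_two]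

theorem exp_mul_exp_neg_eq_one (s z x : ℝ) :
    exp (I * (s * z * x)) * exp (I * (s * z * (-x : ℝ))) = 1 := by
  rw [← Complex.exp_add, ← Complex.exp_zero]; congr 1; push_cast; ring

theorem diagPhase_neg_mulVec (σ z x : ℝ) (v : Fin 2 → ℂ) :
    diagPhase σ z x *ᵥ (diagPhase σ z (-x) *ᵥ v) = v := by
  rw [diagPhase_mulVec, diagPhase_mulVec]
  ext i
  fin_cases i
  · change exp (I * (σ * z * x)) * (exp (I * (σ * z * (-x : ℝ))) * v 0) = v 0
    rw [← mul_assoc, exp_mul_exp_neg_eq_one, one_mul]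
  · change exp (I * ((σ + 2 : ℝ) * z * x)) * (exp (I * ((σ + 2 : ℝ) * z * (-x : ℝ))) * v 1) = v 1
    rw [← mul_assoc, exp_mul_exp_neg_eq_one, one_mul]

theorem diagPhase_mulVec_neg (σ z x : ℝ) (v : Fin 2 → ℂ) :
    diagPhase σ z (-x) *ᵥ (diagPhase σ z x *ᵥ v) = v := by
  simpa using diagPhase_neg_mulVec σ z (-x) v

theorem norm_diagPhase_mulVec_le (σ z x : ℝ) (v : Fin 2 → ℂ) : ‖diagPhase σ z x *ᵥ v‖ ≤ ‖v‖ := by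
  rw [diagPhase_mulVec]
  refine (pi_norm_le_iff_of_nonneg (norm_nonneg _)).2 fun i => ?_
  fin_cases i
  · simp only [Fin.zero_eta, Matrix.cons_val_zero, norm_mul, norm_exp_I_mul, one_mul]
    exact norm_le_pi_norm v 0
  · simp only [Fin.mk_one, Matrix.cons_val_one, norm_mul, norm_exp_I_mul, one_mul,
      Matrix.cons_val_fin_one]
    exact norm_le_pi_norm v 1

/-- Conjugation by the diagonal phases frees the kernel of its dependence on `x`. The two entries of
the phase matrix differ by the frequency `2`, so the resulting generator does not depend on `σ`, and
all Jost functions come from the same flow. -/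
theorem diagPhase_mulVec_potential {u : ℝ → ℂ} (l : ℂ) (σ z x y : ℝ) (v : Fin 2 → ℂ) :
    diagPhase σ z (-x) *ᵥ (l • (diagPhase σ z (x - y) *ᵥ (potential (u y) *ᵥ v))) =
      knGen u l z y (diagPhase σ z (-y) *ᵥ v) := by
  have e0 : exp (I * (σ * z * (-x : ℝ))) * exp (I * (σ * z * (x - y : ℝ))) =
      exp (I * ((2 : ℝ) * z * y)) * exp (I * ((σ + 2 : ℝ) * z * (-y : ℝ))) := by
    rw [← Complex.exp_add, ← Complex.exp_add]; congr 1; push_cast; ring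
  have e1 : exp (I * ((σ + 2 : ℝ) * z * (-x : ℝ))) * exp (I * ((σ + 2 : ℝ) * z * (x - y : ℝ))) =
      exp (I * ((-2 : ℝ) * z * y)) * exp (I * (σ * z * (-y : ℝ))) := by
    rw [← Complex.exp_add, ← Complex.exp_add]; congr 1; push_cast; ring
  simp only [diagPhase_mulVec]
  ext i
  fin_cases i
  · simp [knGen, osc, knUnit, knFreq, knCoeff, matUnit, potential, Matrix.mulVec, dotProduct,
      Fin.sum_univ_two] at e0 ⊢
    linear_combination (l * (u y * v 1)) * e0
  · simp [knGen, osc, knUnit, knFreq, knCoeff, matUnit, potential, Matrix.mulVec, dotProduct,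
      Fin.sum_univ_two] at e1 ⊢
    linear_combination (l * (conj (u y) * v 0)) * e1

/-- `diagPhase` as a continuous linear map. -/
noncomputable def diagPhaseCLM (σ z x : ℝ) : (Fin 2 → ℂ) →L[ℂ] (Fin 2 → ℂ) :=
  LinearMap.toContinuousLinearMap (Matrix.mulVecLin (diagPhase σ z x))

theorem diagPhaseCLM_apply (σ z x : ℝ) (v : Fin 2 → ℂ) :
    diagPhaseCLM σ z x v = diagPhase σ z x *ᵥ v := rfl

theorem continuous_diagPhase_mulVec (σ z : ℝ) {v : ℝ → Fin 2 → ℂ} (hv : Continuous v) :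
    Continuous fun x => diagPhase σ z x *ᵥ v x := by
  unfold diagPhase
  refine Continuous.matrix_mulVec ?_ hv
  refine continuous_matrix fun i j => ?_
  fin_cases i <;> fin_cases j <;> simp <;> fun_prop

variable {u : ℝ → ℂ} {l : ℂ} {z σ : ℝ} {φ : ℝ → Fin 2 → ℂ} {e : Fin 2 → ℂ}

theorem integrable_knGen_apply (hu : Integrable u) (l : ℂ) (σ z : ℝ) (hφ : MemLp φ ⊤ volume) :
    Integrable fun y => knGen u l z y (diagPhase σ z (-y) *ᵥ φ y) := by
  have hm : AEStronglyMeasurable (fun y => diagPhase σ z (-y) *ᵥ φ y) volume := by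
    have : Continuous fun p : ℝ × (Fin 2 → ℂ) => diagPhase σ z (-p.1) *ᵥ p.2 := by
      simp only [diagPhase_mulVec]
      refine continuous_pi fun i => ?_
      fin_cases i <;> simp <;> fun_prop
    exact this.comp_aestronglyMeasurable (f := fun y : ℝ => (y, φ y))
      (AEStronglyMeasurable.prodMk aestronglyMeasurable_id hφ.1)
  have hb : ∀ᵐ y, ‖φ y‖ ≤ (eLpNorm φ ⊤ volume).toReal := by
    filter_upwards [ae_le_eLpNormEssSup (f := φ) (μ := volume)] with y hy
    rw [← toReal_enorm]
    refine ENNReal.toReal_mono hφ.2.ne ?_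
    rwa [eLpNorm_exponent_top]
  have hg := integrable_knGen hu l z
  refine (hg.norm.mul_const (eLpNorm φ ⊤ volume).toReal).mono'
    ((isBoundedBilinearMap_apply (𝕜 := ℂ)).continuous.comp_aestronglyMeasurable (hg.1.prodMk hm)) ?_
  filter_upwards [hb] with y hy
  refine (ContinuousLinearMap.le_opNorm _ _).trans ?_
  gcongr
  exact (norm_diagPhase_mulVec_le _ _ _ _).trans hy

theorem smul_setIntegral_potential (hu : Integrable u) (hφ : MemLp φ ⊤ volume) (s : Set ℝ)
    (x : ℝ) : diagPhase σ z (-x) *ᵥ (l • ∫ y in s, diagPhase σ z (x - y) *ᵥ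
      (potential (u y) *ᵥ φ y)) = ∫ y in s, knGen u l z y (diagPhase σ z (-y) *ᵥ φ y) := by
  have hi := (integrable_knGen_apply hu l σ z hφ).integrableOn (s := s)
  rw [← integral_smul]
  have h1 : ∀ y, l • (diagPhase σ z (x - y) *ᵥ (potential (u y) *ᵥ φ y)) =
      diagPhaseCLM σ z x (knGen u l z y (diagPhase σ z (-y) *ᵥ φ y)) := fun y => by
    rw [← diagPhase_mulVec_potential (u := u) l σ z x y, diagPhaseCLM_apply, diagPhase_neg_mulVec]
  simp only [h1]
  rw [ContinuousLinearMap.integral_comp_comm _ hi, diagPhaseCLM_apply, diagPhase_mulVec_neg]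

theorem diagPhase_inj {σ z x : ℝ} {v w : Fin 2 → ℂ} :
    v = w ↔ diagPhase σ z (-x) *ᵥ v = diagPhase σ z (-x) *ᵥ w := by
  refine ⟨fun h => by rw [h], fun h => ?_⟩
  rw [← diagPhase_neg_mulVec σ z x v, h, diagPhase_neg_mulVec]

/-- The hypothesis `he` says that the phase acts trivially on the normalisation vector; it holds for
`e₁` with `σ = 0` and for `e₂` with `σ = -2`. Boundedness makes the integrand integrable in one
direction and is automatic in the other. -/
theorem jost_Iic_iff (hu : Integrable u) (he : ∀ x, diagPhase σ z x *ᵥ e = e) :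
    (MemLp φ ⊤ volume ∧ ∀ x : ℝ, φ x = e + l • ∫ y in Iic x, diagPhase σ z (x - y) *ᵥ
      (potential (u y) *ᵥ φ y)) ↔
      ∀ x, φ x = diagPhase σ z x *ᵥ fwd (knGen u l z) x e := by
  have hP := integrable_knGen hu l z
  have hbd : ∀ φ : ℝ → Fin 2 → ℂ, (∀ x, φ x = diagPhase σ z x *ᵥ fwd (knGen u l z) x e) →
      MemLp φ ⊤ volume := fun φ h => by
    refine memLp_top_of_bound (Continuous.aestronglyMeasurable ?_)
      (Real.exp (∫ y, ‖knGen u l z y‖) * ‖e‖) (.of_forall fun x => ?_)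
    · rw [funext h]
      exact continuous_diagPhase_mulVec σ z (isPrim_fwd_apply hP e).continuous
    · rw [h x]
      exact (norm_diagPhase_mulVec_le _ _ _ _).trans (norm_fwd_apply_le hP e x)
  have key : ∀ hφ : MemLp φ ⊤ volume, ((∀ x : ℝ, φ x = e + l • ∫ y in Iic x,
      diagPhase σ z (x - y) *ᵥ (potential (u y) *ᵥ φ y)) ↔
      ∀ x, φ x = diagPhase σ z x *ᵥ fwd (knGen u l z) x e) := fun hφ => by
    have h := eq_integral_Iic_iff (w := e) hP (integrable_knGen_apply hu l σ z hφ)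
    refine (forall_congr' fun x => ?_).trans (h.trans (forall_congr' fun x => ?_))
    · rw [diagPhase_inj (σ := σ) (z := z) (x := x), Matrix.mulVec_add,
        smul_setIntegral_potential hu hφ, he]
    · rw [diagPhase_inj (σ := σ) (z := z) (x := x) (v := φ x), diagPhase_mulVec_neg]
  exact ⟨fun h => (key h.1).1 h.2, fun h => ⟨hbd φ h, (key (hbd φ h)).2 h⟩⟩

theorem jost_Ioi_iff (hu : Integrable u) (he : ∀ x, diagPhase σ z x *ᵥ e = e) :
    (MemLp φ ⊤ volume ∧ ∀ x : ℝ, φ x = e - l • ∫ y in Ioi x, diagPhase σ z (x - y) *ᵥ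
      (potential (u y) *ᵥ φ y)) ↔
      ∀ x, φ x = diagPhase σ z x *ᵥ fwd (knGen u l z) x (bwdTop (knGen u l z) e) := by
  have hP := integrable_knGen hu l z
  set w := bwdTop (knGen u l z) e
  have hbd : ∀ φ : ℝ → Fin 2 → ℂ, (∀ x, φ x = diagPhase σ z x *ᵥ fwd (knGen u l z) x w) →
      MemLp φ ⊤ volume := fun φ h => by
    refine memLp_top_of_bound (Continuous.aestronglyMeasurable ?_)
      (Real.exp (∫ y, ‖knGen u l z y‖) * ‖w‖) (.of_forall fun x => ?_)
    · rw [funext h]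
      exact continuous_diagPhase_mulVec σ z (isPrim_fwd_apply hP w).continuous
    · rw [h x]
      exact (norm_diagPhase_mulVec_le _ _ _ _).trans (norm_fwd_apply_le hP w x)
  have key : ∀ hφ : MemLp φ ⊤ volume, ((∀ x : ℝ, φ x = e - l • ∫ y in Ioi x,
      diagPhase σ z (x - y) *ᵥ (potential (u y) *ᵥ φ y)) ↔
      ∀ x, φ x = diagPhase σ z x *ᵥ fwd (knGen u l z) x w) := fun hφ => by
    have h := eq_integral_Ioi_iff (w := e) hP (integrable_knGen_apply hu l σ z hφ)
    refine (forall_congr' fun x => ?_).trans (h.trans (forall_congr' fun x => ?_))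
    · rw [diagPhase_inj (σ := σ) (z := z) (x := x), Matrix.mulVec_sub,
        smul_setIntegral_potential hu hφ, he]
    · rw [diagPhase_inj (σ := σ) (z := z) (x := x) (v := φ x), diagPhase_mulVec_neg]
  exact ⟨fun h => (key h.1).1 h.2, fun h => ⟨hbd φ h, (key (hbd φ h)).2 h⟩⟩

theorem diagPhase_zero (hl : l ^ 2 = z) (s : ℝ) :
    diagPhase 0 z s = !![1, 0; 0, exp (2 * I * l ^ 2 * s)] := by
  simp only [diagPhase, hl, ofReal_zero, zero_mul, mul_zero, Complex.exp_zero, zero_add,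
    ofReal_ofNat]
  congr 6; ring

theorem diagPhase_neg_two (hl : l ^ 2 = z) (s : ℝ) :
    diagPhase (-2) z s = !![exp (-(2 * I * l ^ 2 * s)), 0; 0, 1] := by
  have : (-2 : ℝ) + 2 = 0 := by norm_num
  simp only [diagPhase, hl, this, ofReal_zero, zero_mul, mul_zero, Complex.exp_zero]
  congr 4; push_cast; ring

/-- The scattering pair is the first column of the transfer matrix. -/
theorem isScatteringPair_iff (hu : Integrable u) (hl : l ^ 2 = z) (p : ℂ × ℂ) :
    IsScatteringPair u l p ↔ p = (entry (fwdTop (knGen u l z)) 0 0,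
      entry (fwdTop (knGen u l z)) 1 0) := by
  have hP := integrable_knGen hu l z
  have he1 : ∀ x, diagPhase 0 z x *ᵥ ![1, 0] = ![1, 0] := fun x => by
    rw [diagPhase_mulVec]; simp
  have he2 : ∀ x, diagPhase (-2) z x *ᵥ ![0, 1] = ![0, 1] := fun x => by
    rw [diagPhase_mulVec]; simp
  have h1 : ∀ φ, IsJostFirstMinus u l φ ↔
      ∀ x, φ x = diagPhase 0 z x *ᵥ fwd (knGen u l z) x ![1, 0] := fun φ => by
    rw [← jost_Iic_iff hu he1, IsJostFirstMinus]
    simp only [diagPhase_zero hl, ofReal_sub]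
  have h2 : ∀ φ, IsJostFirstPlus u l φ ↔ ∀ x, φ x =
      diagPhase 0 z x *ᵥ fwd (knGen u l z) x (bwdTop (knGen u l z) ![1, 0]) := fun φ => by
    rw [← jost_Ioi_iff hu he1, IsJostFirstPlus]
    simp only [diagPhase_zero hl, ofReal_sub]
  have h3 : ∀ φ, IsJostSecondPlus u l φ ↔ ∀ x, φ x =
      diagPhase (-2) z x *ᵥ fwd (knGen u l z) x (bwdTop (knGen u l z) ![0, 1]) := fun φ => by
    rw [← jost_Ioi_iff hu he2, IsJostSecondPlus]
    simp only [diagPhase_neg_two hl, ofReal_sub]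
  -- The factor `e^{2iλ²x}` in the scattering relation brings the second Jost function to the same
  -- phase matrix as the first, so the phases can be cancelled from the relation.
  have hphase : ∀ (x : ℝ) v, exp (2 * I * l ^ 2 * x) • (diagPhase (-2) z x *ᵥ v) =
      diagPhase 0 z x *ᵥ v := fun x v => by
    rw [diagPhase_neg_two hl, diagPhase_zero hl]
    ext i
    fin_cases i <;> simp [Matrix.mulVec, dotProduct, Fin.sum_univ_two, ← mul_assoc,
      ← Complex.exp_add]
  have hcomb : ∀ (p : ℂ × ℂ), ![p.1, p.2] = p.1 • ![(1 : ℂ), 0] + p.2 • ![(0 : ℂ), 1] :=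
    fun p => by ext i; fin_cases i <;> simp
  have hrel : ∀ (x : ℝ) (p : ℂ × ℂ),
      p.1 • (diagPhase 0 z x *ᵥ fwd (knGen u l z) x (bwdTop (knGen u l z) ![1, 0])) +
        (p.2 * exp (2 * I * l ^ 2 * x)) •
          (diagPhase (-2) z x *ᵥ fwd (knGen u l z) x (bwdTop (knGen u l z) ![0, 1])) =
      diagPhase 0 z x *ᵥ fwd (knGen u l z) x (bwdTop (knGen u l z) ![p.1, p.2]) := fun x p => by
    rw [mul_smul, hphase, hcomb p]
    simp only [map_add, map_smul, Matrix.mulVec_add, Matrix.mulVec_smul]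
  have hcol : fwdTop (knGen u l z) ![1, 0] =
      ![entry (fwdTop (knGen u l z)) 0 0, entry (fwdTop (knGen u l z)) 1 0] := by
    have : (Pi.single 0 1 : Fin 2 → ℂ) = ![1, 0] := by ext i; fin_cases i <;> simp
    ext i; fin_cases i <;> simp [entry, this]
  constructor
  · rintro ⟨φm, φp, χp, hm, hp, hχ, h⟩
    rw [h1] at hm; rw [h2] at hp; rw [h3] at hχ
    -- Without the phases the relation reads `T(x)e₁ = T(x)S(+∞)(a,b)`; letting `x → +∞` gives
    -- `(a,b) = T(+∞)e₁`.
    have e : ∀ x, fwd (knGen u l z) x ![1, 0] =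
        fwd (knGen u l z) x (bwdTop (knGen u l z) ![p.1, p.2]) := fun x => by
      have := h x
      rw [hm, hp, hχ, hrel] at this
      rw [← diagPhase_mulVec_neg 0 z x (fwd (knGen u l z) x ![1, 0]), this, diagPhase_mulVec_neg]
    have t := tendsto_nhds_unique ((tendsto_fwd_apply_atTop hP _).congr e)
      (tendsto_fwd_apply_atTop hP _)
    rw [fwdTop_apply_bwdTop_apply hP, hcol] at t
    have t0 := congrFun t 0
    have t1 := congrFun t 1
    simp only [Matrix.cons_val_zero, Matrix.cons_val_one, Matrix.cons_val_fin_one] at t0 t1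
    exact Prod.ext t0.symm t1.symm
  · intro hp
    refine ⟨_, _, _, (h1 _).2 fun x => rfl, (h2 _).2 fun x => rfl, (h3 _).2 fun x => rfl,
      fun x => ?_⟩
    rw [hrel, hp, ← hcol, bwdTop_apply_fwdTop_apply hP]

theorem scatA_eq (hu : Integrable u) (hl : l ^ 2 = z) :
    scatA u l = entry (fwdTop (knGen u l z)) 0 0 := by
  have := Classical.epsilon_spec (p := IsScatteringPair u l)
    ⟨_, (isScatteringPair_iff hu hl _).2 rfl⟩
  rw [isScatteringPair_iff hu hl] at this
  rw [scatA, this]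

theorem scatB_eq (hu : Integrable u) (hl : l ^ 2 = z) :
    scatB u l = entry (fwdTop (knGen u l z)) 1 0 := by
  have := Classical.epsilon_spec (p := IsScatteringPair u l)
    ⟨_, (isScatteringPair_iff hu hl _).2 rfl⟩
  rw [isScatteringPair_iff hu hl] at this
  rw [scatB, this]

/-- Allows replacing the potential by its absolutely continuous representative. -/
theorem fwdTop_knGen_congr {v : ℝ → ℂ} (hu : Integrable u) (huv : u =ᵐ[volume] v) (l : ℂ) (z : ℝ) :
    fwdTop (knGen u l z) = fwdTop (knGen v l z) := by
  rw [← sub_eq_zero, fwdTop_sub_fwdTop (integrable_knGen hu l z)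
    (integrable_knGen (hu.congr huv) l z)]
  have : (fun y => bwd (knGen u l z) y * (knGen u l z y - knGen v l z y) * fwd (knGen v l z) y)
      =ᵐ[volume] fun _ => 0 := by
    filter_upwards [huv] with y hy
    simp [knGen, osc, knCoeff, Fin.sum_univ_two, hy]
  rw [integral_congr_ae this]
  simp

end Jost

/-! ### The gauge transformation that removes `λ` from the system. -/

section Gauge

theorem IsPrim.hasDerivAt {F : Type*} [NormedAddCommGroup F] [NormedSpace ℝ F] [CompleteSpace F]
    {φ f : ℝ → F} (h : IsPrim φ f) (hf : Continuous f) (x : ℝ) : HasDerivAt φ (f x) x := by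
  have : φ = fun b => φ 0 + ∫ x in (0 : ℝ)..b, f x := funext fun b => h.eq_add 0 b
  rw [this]
  exact (intervalIntegral.integral_hasDerivAt_right (h.1 0 x)
    (hf.stronglyMeasurableAtFilter _ _) hf.continuousAt).const_add _

theorem IsPrim.conj {φ f : ℝ → ℂ} (h : IsPrim φ f) :
    IsPrim (fun x => conj (φ x)) fun x => conj (f x) :=
  h.clm (Complex.conjCLE : ℂ →L[ℝ] ℂ)

theorem tendsto_conj_zero {φ : ℝ → ℂ} {l : Filter ℝ} (h : Tendsto φ l (𝓝 0)) :
    Tendsto (fun x => conj (φ x)) l (𝓝 0) := by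
  simpa [Function.comp_def] using (Complex.continuous_conj.tendsto _).comp h

/-- The phase `-½ ∫_{-∞}^x |u|²`. -/
noncomputable def gaugePhase (u : ℝ → ℂ) (x : ℝ) : ℝ := -(1 / 2) * ∫ y in Iic x, ‖u y‖ ^ 2

/-- The gauge factor `exp(-(i/2) ∫_{-∞}^x |u|²)`. -/
noncomputable def gauge (u : ℝ → ℂ) (x : ℝ) : ℂ := exp (I * gaugePhase u x)

/-- The gauge factor at `+∞`. -/
noncomputable def gaugeTop (u : ℝ → ℂ) : ℂ := exp (I * (-(1 / 2) * ∫ y, ‖u y‖ ^ 2 : ℝ))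

theorem norm_gauge (u : ℝ → ℂ) (x : ℝ) : ‖gauge u x‖ = 1 := by
  rw [gauge, mul_comm, Complex.norm_exp_ofReal_mul_I]

theorem norm_gaugeTop (u : ℝ → ℂ) : ‖gaugeTop u‖ = 1 := by
  rw [gaugeTop, mul_comm, Complex.norm_exp_ofReal_mul_I]

theorem mul_conj_of_norm_one {w : ℂ} (h : ‖w‖ = 1) : w * conj w = 1 := by
  rw [Complex.mul_conj', h]; simp

variable {u u₁ : ℝ → ℂ}

theorem isPrim_gauge (hu : Continuous u) (hi : Integrable fun x => ‖u x‖ ^ 2) :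
    IsPrim (gauge u) fun x => -(I / 2) * (u x * conj (u x)) * gauge u x := by
  have hc : Continuous fun x => ‖u x‖ ^ 2 := by fun_prop
  have hp : ∀ x, HasDerivAt (gaugePhase u) (-(1 / 2) * ‖u x‖ ^ 2) x := fun x =>
    ((isPrim_integral_Iic hi).hasDerivAt hc x).const_mul _
  have hd : ∀ x, HasDerivAt (gauge u) (-(I / 2) * (u x * conj (u x)) * gauge u x) x := fun x => by
    have := ((hp x).ofReal_comp.const_mul I).cexp
    refine this.congr_deriv ?_
    rw [Complex.mul_conj', gauge]
    push_cast; ring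
  have hgc : Continuous (gauge u) :=
    continuous_iff_continuousAt.2 fun x => (hd x).continuousAt
  refine isPrim_of_hasDerivAt hd ?_
  have := Complex.continuous_conj.comp hu
  exact (continuous_const.mul (hu.mul this)).mul hgc

theorem tendsto_gauge_atBot (hi : Integrable fun x => ‖u x‖ ^ 2) :
    Tendsto (gauge u) atBot (𝓝 1) := by
  have h : Tendsto (gaugePhase u) atBot (𝓝 (-(1 / 2) * 0)) :=
    (tendsto_integral_Iic_atBot hi).const_mul _
  have h2 := ((Complex.continuous_exp.comp
    (continuous_const.mul Complex.continuous_ofReal : Continuous fun t : ℝ => I * (t : ℂ))).tendsto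
      _).comp h
  rw [mul_zero] at h2
  change Tendsto (gauge u) atBot (𝓝 (exp (I * ((0 : ℝ) : ℂ)))) at h2
  rwa [ofReal_zero, mul_zero, Complex.exp_zero] at h2

theorem tendsto_gauge_atTop (hi : Integrable fun x => ‖u x‖ ^ 2) :
    Tendsto (gauge u) atTop (𝓝 (gaugeTop u)) := by
  have h0 := (isPrim_integral_Iic hi).integral_Ioi hi 0
  rw [intervalIntegral.integral_Iic_add_Ioi hi.integrableOn hi.integrableOn] at h0
  have h : Tendsto (gaugePhase u) atTop _ := h0.const_mul _
  exact ((Complex.continuous_exp.comp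
    (continuous_const.mul Complex.continuous_ofReal : Continuous fun t : ℝ => I * (t : ℂ))).tendsto
      _).comp h

/-- The coefficients of the transformed system. -/
noncomputable def sysCoeff (u u₁ : ℝ → ℂ) : Fin 3 → ℝ → ℂ :=
  ![fun x => -(I / 2) * u x * conj (gauge u x) ^ 2,
    fun x => -(gauge u x ^ 2 * (conj (u₁ x) - I / 2 * (u x * conj (u x) * conj (u x)))),
    fun x => conj (u x) * gauge u x]

/-- A potential with an integrable derivative, vanishing at infinity. -/
structure IsPotential (u u₁ : ℝ → ℂ) : Prop where
  prim : IsPrim u u₁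
  int : Integrable u
  int_sq : Integrable fun x => ‖u x‖ ^ 2
  bot : Tendsto u atBot (𝓝 0)
  top : Tendsto u atTop (𝓝 0)
  int_coeff : ∀ k, Integrable (sysCoeff u u₁ k)

theorem isPrim_kn_zero (hu : Integrable u) (l : ℂ) (z : ℝ) :
    IsPrim (fun x => entry (fwd (knGen u l z) x) 0 0) (fun x : ℝ => l * u x *
      exp (I * ((2 : ℝ) * z * x)) * entry (fwd (knGen u l z) x) 1 0) :=
  (isPrim_entry_fwd (integrable_knGen hu l z) 0 0).congr fun x => by
    simp [knGen, entry_osc_mul, Fin.sum_univ_two, knUnit, knFreq, knCoeff, entry_matUnit_mul]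

theorem isPrim_kn_one (hu : Integrable u) (l : ℂ) (z : ℝ) :
    IsPrim (fun x => entry (fwd (knGen u l z) x) 1 0) (fun x : ℝ => -(l * conj (u x)) *
      exp (I * ((-2 : ℝ) * z * x)) * entry (fwd (knGen u l z) x) 0 0) :=
  (isPrim_entry_fwd (integrable_knGen hu l z) 1 0).congr fun x => by
    simp [knGen, entry_osc_mul, Fin.sum_univ_two, knUnit, knFreq, knCoeff, entry_matUnit_mul]

/-- The gauge transformation of the spectral problem to a system that depends on `z = l²` only. -/
theorem transfer_gauge (h : IsPotential u u₁) {l : ℂ} {z : ℝ} (hl : l ^ 2 = z) :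
    entry (fwdTop (knGen u l z)) 0 0 =
      gaugeTop u * entry (transfer sysUnit sysFreq (sysCoeff u u₁) z) 0 0 ∧
    entry (fwdTop (knGen u l z)) 1 0 =
      -(l * entry (transfer sysUnit sysFreq (sysCoeff u u₁) z) 2 0) ∧
    2 * I * l * entry (fwdTop (knGen u l z)) 1 0 =
      conj (gaugeTop u) * entry (transfer sysUnit sysFreq (sysCoeff u u₁) z) 1 0 := by
  have iK := integrable_knGen h.int l z
  have iS := integrable_osc sysUnit sysFreq h.int_coeff z
  set f : ℝ → ℂ := fun x => entry (fwd (knGen u l z) x) 0 0 with hf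
  set n : ℝ → ℂ := fun x => entry (fwd (knGen u l z) x) 1 0 with hn
  have pf : IsPrim f fun x : ℝ => l * u x * exp (I * ((2 : ℝ) * z * x)) * n x :=
    isPrim_kn_zero h.int l z
  have pn : IsPrim n fun x : ℝ => -(l * conj (u x)) * exp (I * ((-2 : ℝ) * z * x)) * f x :=
    isPrim_kn_one h.int l z
  have fb : Tendsto f atBot (𝓝 1) := by simpa using tendsto_entry_fwd_atBot iK 0 0
  have nb : Tendsto n atBot (𝓝 0) := by simpa using tendsto_entry_fwd_atBot iK 1 0
  have ft : Tendsto f atTop _ := tendsto_entry_fwd_atTop iK 0 0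
  have nt : Tendsto n atTop _ := tendsto_entry_fwd_atTop iK 1 0
  have fB : ∀ x, ‖f x‖ ≤ Real.exp (∫ y, ‖knGen u l z y‖) := fun x =>
    (norm_entry_le _ _ _).trans (norm_fwd_le iK le_rfl x)
  have nB : ∀ x, ‖n x‖ ≤ Real.exp (∫ y, ‖knGen u l z y‖) := fun x =>
    (norm_entry_le _ _ _).trans (norm_fwd_le iK le_rfl x)
  have pg := isPrim_gauge h.prim.continuous h.int_sq
  have hg : ∀ x, gauge u x * conj (gauge u x) = 1 := fun x => mul_conj_of_norm_one (norm_gauge u x)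
  have he : ∀ x : ℝ, exp (I * ((2 : ℝ) * z * x)) * exp (I * ((-2 : ℝ) * z * x)) = 1 := fun x => by
    rw [← Complex.exp_add, ← Complex.exp_zero]; congr 1; push_cast; ring
  -- The combination is forced by cancellation in `N2'`: the term `2iλ n'` contributes `-2iz ū
  -- e^{-2izx} f`, which the derivative of the phase removes, and the term `-λ|u|² n` from `f'` is
  -- removed by the derivative of the gauge factor acting on `2iλ n`.
  set N1 : ℝ → ℂ := fun x => f x * conj (gauge u x) with hN1
  set N2 : ℝ → ℂ := fun x => gauge u x * (2 * I * l * n x -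
    conj (u x) * exp (I * ((-2 : ℝ) * z * x)) * f x) with hN2
  have p1 : IsPrim N1 fun x => sysCoeff u u₁ 0 x * exp (I * ((2 : ℝ) * z * x)) * N2 x := by
    refine (pf.mul pg.conj).congr fun x => ?_
    simp only [sysCoeff, Matrix.cons_val_zero, hN2, map_mul, map_neg, map_div₀, Complex.conj_I,
      Complex.conj_conj, map_ofNat]
    linear_combination (-(I / 2) * u x * conj (u x) * f x * conj (gauge u x)) * he x +
      ((I / 2) * u x * conj (gauge u x) * (2 * I * l * n x * exp (I * ((2 : ℝ) * z * x)) -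
      conj (u x) * f x * (exp (I * ((2 : ℝ) * z * x)) * exp (I * ((-2 : ℝ) * z * x))))) * hg x +
      l * u x * exp (I * ((2 : ℝ) * z * x)) * n x * conj (gauge u x) * Complex.I_sq
  have p2 : IsPrim N2 fun x => sysCoeff u u₁ 1 x * exp (I * ((-2 : ℝ) * z * x)) * N1 x := by
    refine (pg.mul (((isPrim_const (2 * I * l)).mul pn).sub
      ((h.prim.conj.mul (isPrim_phase (-2) z)).mul pf))).congr fun x => ?_
    simp only [sysCoeff, Matrix.cons_val_one, Matrix.cons_val_zero, hN1]
    push_cast at he ⊢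
    linear_combination (-2 * I * conj (u x) * exp (I * (-2 * z * x)) * f x * gauge u x) * hl -
      gauge u x * conj (u x) * u x * l * n x * he x -
      u x * conj (u x) * gauge u x * l * n x * Complex.I_sq +
      (conj (u₁ x) * exp (I * (-2 * z * x)) * f x * gauge u x -
        I / 2 * u x * conj (u x) * conj (u x) * gauge u x * exp (I * (-2 * z * x)) * f x) * hg x
  have bN1 : ∀ x, ‖N1 x‖ ≤ Real.exp (∫ y, ‖knGen u l z y‖) := fun x => by
    simp only [hN1, norm_mul, RCLike.norm_conj, norm_gauge, mul_one]
    exact fB x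
  have i2 : ∀ k, Integrable fun x : ℝ => sysCoeff u u₁ k x * exp (I * ((-2 : ℝ) * z * x)) * N1 x :=
    fun k => (integrable_mul_phase (h.int_coeff k) (-2) z).mul_bdd
      (p1.continuous.aestronglyMeasurable) (.of_forall bN1)
  have gb := tendsto_gauge_atBot h.int_sq
  have gt := tendsto_gauge_atTop h.int_sq
  have hphase : ∀ m : Filter ℝ, Tendsto u m (𝓝 0) →
      Tendsto (fun x : ℝ => conj (u x) * exp (I * ((-2 : ℝ) * z * x))) m (𝓝 0) := fun m hm => by
    rw [tendsto_zero_iff_norm_tendsto_zero] at hm ⊢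
    exact hm.congr fun x => by rw [norm_mul, norm_exp_I_mul, mul_one, RCLike.norm_conj]
  have t1 : Tendsto N1 atBot (𝓝 1) := by
    simpa using fb.mul ((Complex.continuous_conj.tendsto _).comp gb)
  have t2 : Tendsto N2 atBot (𝓝 0) := by
    have := gb.mul ((nb.const_mul (2 * I * l)).sub ((hphase _ h.bot).mul fb))
    simpa only [mul_zero, zero_mul, sub_zero] using this
  set N3 : ℝ → ℂ := fun x => ∫ y in Iic x, sysCoeff u u₁ 2 y *
      exp (I * ((-2 : ℝ) * z * y)) * N1 y with hN3
  have p3 : IsPrim N3 fun x => sysCoeff u u₁ 2 x * exp (I * ((-2 : ℝ) * z * x)) * N1 x :=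
    isPrim_integral_Iic (i2 2)
  have t3 : Tendsto N3 atBot (𝓝 0) := tendsto_integral_Iic_atBot (i2 2)
  -- The equation for `N2` bounds it, which in turn makes the right side of the equation for `N1`
  -- integrable, as the uniqueness statement requires.
  have bN2 : ∀ x, ‖N2 x‖ ≤ ∫ x : ℝ, ‖sysCoeff u u₁ 1 x * exp (I * ((-2 : ℝ) * z * x)) * N1 x‖ :=
    fun x => by
      rw [p2.eq_integral_Iic (i2 1) t2 x, zero_add]
      exact (norm_integral_le_integral_norm _).trans
        (setIntegral_le_integral (i2 1).norm (.of_forall fun _ => norm_nonneg _))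
  have i1 : Integrable fun x : ℝ => sysCoeff u u₁ 0 x * exp (I * ((2 : ℝ) * z * x)) * N2 x :=
    (integrable_mul_phase (h.int_coeff 0) 2 z).mul_bdd
      (p2.continuous.aestronglyMeasurable) (.of_forall bN2)
  have hosc : ∀ (x : ℝ) (v : Fin 3 → ℂ), osc sysUnit sysFreq (sysCoeff u u₁) z x v =
      ![sysCoeff u u₁ 0 x * exp (I * ((2 : ℝ) * z * x)) * v 1,
        sysCoeff u u₁ 1 x * exp (I * ((-2 : ℝ) * z * x)) * v 0,
        sysCoeff u u₁ 2 x * exp (I * ((-2 : ℝ) * z * x)) * v 0] := fun x v => by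
    ext i
    fin_cases i <;> simp [osc, Fin.sum_univ_three, sysUnit, sysFreq, matUnit]
  have hvec : ∀ a b c : ℂ, ContinuousLinearMap.single ℝ (fun _ : Fin 3 => ℂ) 0 a +
      ContinuousLinearMap.single ℝ (fun _ : Fin 3 => ℂ) 1 b +
      ContinuousLinearMap.single ℝ (fun _ : Fin 3 => ℂ) 2 c = ![a, b, c] := fun a b c => by
    ext i
    fin_cases i <;> simp
  have pψ : IsPrim (fun x => ![N1 x, N2 x, N3 x])
      fun x => osc sysUnit sysFreq (sysCoeff u u₁) z x ![N1 x, N2 x, N3 x] :=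
    ((((p1.clm (ContinuousLinearMap.single ℝ (fun _ : Fin 3 => ℂ) 0)).add
      (p2.clm (ContinuousLinearMap.single ℝ (fun _ : Fin 3 => ℂ) 1))).add
      (p3.clm (ContinuousLinearMap.single ℝ (fun _ : Fin 3 => ℂ) 2))).congr fun x => by
        rw [hvec, hosc]; rfl).congr_left fun x => hvec _ _ _
  have iψ : Integrable fun x => osc sysUnit sysFreq (sysCoeff u u₁) z x ![N1 x, N2 x, N3 x] := by
    simp only [hosc]
    refine Integrable.of_eval fun i => ?_
    fin_cases i
    exacts [i1, i2 1, i2 2]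
  have tψ : Tendsto (fun x => ![N1 x, N2 x, N3 x]) atBot (𝓝 (Pi.single 0 1)) := by
    refine tendsto_pi_nhds.2 fun i => ?_
    fin_cases i
    exacts [by simpa using t1, by simpa using t2, by simpa using t3]
  have eψ := pψ.eq_fwd_apply iS iψ tψ
  have lim : ∀ i, Tendsto (fun x => ![N1 x, N2 x, N3 x] i) atTop
      (𝓝 (entry (transfer sysUnit sysFreq (sysCoeff u u₁) z) i 0)) := fun i =>
    (tendsto_entry_fwd_atTop iS i 0).congr fun x => by rw [eψ x]; rfl
  have l0 : Tendsto N1 atTop _ := lim 0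
  have l1 : Tendsto N2 atTop _ := lim 1
  have l2 : Tendsto N3 atTop _ := lim 2
  have hG := mul_conj_of_norm_one (norm_gaugeTop u)
  refine ⟨?_, ?_, ?_⟩
  · rw [tendsto_nhds_unique l0 (ft.mul ((Complex.continuous_conj.tendsto _).comp gt))]
    linear_combination (-entry (fwdTop (knGen u l z)) 0 0) * hG
  -- The gauge factors in `c₂ N₁` cancel, so `n` and `-λ N3` have the same derivative and both
  -- vanish at `-∞`. The third component thus records `n / λ` without dividing by `λ`.
  · have hn3 : ∀ x, n x = -(l * N3 x) := fun x => by
      have hd : ∀ x : ℝ, -(l * conj (u x)) * exp (I * ((-2 : ℝ) * z * x)) * f x =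
          -l * (sysCoeff u u₁ 2 x * exp (I * ((-2 : ℝ) * z * x)) * N1 x) := fun x => by
        simp only [sysCoeff, Matrix.cons_val, hN1]
        linear_combination (l * conj (u x) * exp (I * ((-2 : ℝ) * z * x)) * f x) * hg x
      rw [(pn.congr hd).eq_integral_Iic ((i2 2).const_mul (-l)) nb x, integral_const_mul]
      ring
    exact tendsto_nhds_unique (nt.congr hn3) (l2.const_mul l).neg
  · rw [tendsto_nhds_unique l1 (gt.mul ((nt.const_mul (2 * I * l)).sub ((hphase _ h.top).mul ft)))]
    linear_combination (-(2 * I * l * entry (fwdTop (knGen u l z)) 1 0)) * hG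

end Gauge

/-! ### Weak derivatives and absolutely continuous representatives. -/

section WeakDerivative

/-- A test function with vanishing integral is the derivative of a test function. -/
theorem exists_primitive_of_integral_eq_zero {ψ : ℝ → ℝ}
    (hψ : ContDiff ℝ ((⊤ : ℕ∞) : WithTop ℕ∞) ψ) (hc : HasCompactSupport ψ) (h0 : ∫ x, ψ x = 0) :
    ∃ η : ℝ → ℝ, ContDiff ℝ ((⊤ : ℕ∞) : WithTop ℕ∞) η ∧ HasCompactSupport η ∧ deriv η = ψ := by
  have hi : Integrable ψ := hψ.continuous.integrable_of_hasCompactSupport hc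
  have hd := (isPrim_integral_Iic hi).hasDerivAt hψ.continuous
  have hderiv : deriv (fun x => ∫ y in Iic x, ψ y) = ψ := funext fun x => (hd x).deriv
  refine ⟨fun x => ∫ y in Iic x, ψ y, ?_, ?_, hderiv⟩
  · refine contDiff_infty_iff_deriv.2 ⟨fun x => (hd x).differentiableAt, ?_⟩
    rwa [hderiv]
  · obtain ⟨R, hR⟩ := hc.isCompact.isBounded.subset_closedBall 0
    have hz : ∀ y, y ∉ Icc (-R) R → ψ y = 0 := fun y hy => by
      by_contra h
      refine hy ?_
      simpa [Real.closedBall_eq_Icc] using hR (subset_tsupport ψ h)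
    refine HasCompactSupport.intro (isCompact_Icc (a := -R) (b := R)) fun x hx => ?_
    simp only [mem_Icc, not_and_or, not_le] at hx
    rcases hx with hx | hx
    · exact setIntegral_eq_zero_of_forall_eq_zero fun y hy =>
        hz y fun h => absurd (h.1.trans hy) (not_le.2 hx)
    · have h1 : ∫ y in Ioi x, ψ y = 0 := setIntegral_eq_zero_of_forall_eq_zero fun y hy =>
        hz y fun h => absurd (hx.trans hy) (not_lt.2 h.2)
      have h2 := intervalIntegral.integral_Iic_add_Ioi (b := x) hi.integrableOn hi.integrableOn
      rwa [h1, h0, add_zero] at h2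

theorem tendsto_zero_of_hasCompactSupport {F : ℝ → ℂ} (h : HasCompactSupport F) :
    Tendsto F atBot (𝓝 0) ∧ Tendsto F atTop (𝓝 0) := by
  have : Tendsto F (cocompact ℝ) (𝓝 0) := by
    refine tendsto_const_nhds.congr' ?_
    filter_upwards [h.isCompact.compl_mem_cocompact] with x hx
    exact (image_eq_zero_of_notMem_tsupport hx).symm
  exact ⟨this.mono_left _root_.atBot_le_cocompact, this.mono_left _root_.atTop_le_cocompact⟩

/-- Integration by parts against a test function. -/
theorem IsPrim.integral_deriv_smul {G g : ℝ → ℂ} (h : IsPrim G g) (hg : LocallyIntegrable g volume)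
    {η : ℝ → ℝ} (hη : ContDiff ℝ ((⊤ : ℕ∞) : WithTop ℕ∞) η) (hc : HasCompactSupport η) :
    ∫ x, deriv η x • G x = -∫ x, η x • g x := by
  have hη1 : ContDiff ℝ 1 η := hη.of_le (by exact_mod_cast le_top)
  have hηd : Continuous (deriv η) := hη1.continuous_deriv le_rfl
  have pη : IsPrim η (deriv η) := isPrim_of_hasDerivAt
    (fun x => (hη1.differentiable one_ne_zero x).hasDerivAt) hηd
  have i1 : Integrable fun x => deriv η x • G x :=
    (hηd.smul h.continuous).integrable_of_hasCompactSupport (hc.deriv.smul_right)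
  have i2 : Integrable fun x => η x • g x :=
    hg.integrable_smul_left_of_hasCompactSupport hη.continuous hc
  have hp := pη.bilin (ContinuousLinearMap.lsmul ℝ ℝ : ℝ →L[ℝ] ℂ →L[ℝ] ℂ) h
  obtain ⟨t1, t2⟩ := tendsto_zero_of_hasCompactSupport (F := fun x => η x • G x) hc.smul_right
  have := hp.integral_eq (i1.add i2) t1 t2
  simp only [ContinuousLinearMap.lsmul_apply] at this
  rw [integral_add i1 i2, sub_zero] at this
  exact eq_neg_of_add_eq_zero_left this

/-- A function with a weak derivative is almost everywhere equal to a primitive of it. -/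
theorem HasWeakDeriv.exists_isPrim {f g : ℝ → ℂ} (h : HasWeakDeriv f g) :
    ∃ F, f =ᵐ[volume] F ∧ IsPrim F g := by
  obtain ⟨hf, hg, hfg⟩ := h
  have hint : ∀ a b, IntervalIntegrable g volume a b := fun a b =>
    (hg.integrableOn_isCompact isCompact_uIcc).intervalIntegrable
  have pG : IsPrim (fun x => ∫ y in (0 : ℝ)..x, g y) g :=
    ⟨hint, fun a b => intervalIntegral.integral_interval_sub_left (hint 0 b) (hint 0 a)⟩
  set G : ℝ → ℂ := fun x => ∫ y in (0 : ℝ)..x, g y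
  have hGl : LocallyIntegrable G volume := pG.continuous.locallyIntegrable
  set w : ℝ → ℂ := fun x => f x - G x with hw
  have hwl : LocallyIntegrable w volume := hf.sub hGl
  have hw0 : ∀ η : ℝ → ℝ, ContDiff ℝ ((⊤ : ℕ∞) : WithTop ℕ∞) η → HasCompactSupport η →
      ∫ x, deriv η x • w x = 0 := fun η hη hc => by
    have hηd : Continuous (deriv η) :=
      (hη.of_le (by exact_mod_cast le_top) : ContDiff ℝ 1 η).continuous_deriv le_rfl
    simp only [hw, smul_sub]
    rw [integral_sub (hf.integrable_smul_left_of_hasCompactSupport hηd hc.deriv)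
      (hGl.integrable_smul_left_of_hasCompactSupport hηd hc.deriv), hfg η hη hc,
      pG.integral_deriv_smul hg hη hc, sub_self]
  set B : ContDiffBump (0 : ℝ) := default
  set ρ : ℝ → ℝ := B.normed volume
  have hρ : ContDiff ℝ ((⊤ : ℕ∞) : WithTop ℕ∞) ρ := B.contDiff_normed
  have hρc : HasCompactSupport ρ := B.hasCompactSupport_normed
  have hρ1 : ∫ x, ρ x = 1 := B.integral_normed
  set c : ℂ := ∫ x, ρ x • w x
  have hwc : w =ᵐ[volume] fun _ => c := by
    refine ae_eq_of_integral_contDiff_smul_eq hwl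
      (continuous_const.locallyIntegrable) fun χ hχ hχc => ?_
    set m := ∫ x, χ x
    have hχi : Integrable χ := hχ.continuous.integrable_of_hasCompactSupport hχc
    have hρi : Integrable ρ := hρ.continuous.integrable_of_hasCompactSupport hρc
    -- Du Bois-Reymond: subtracting a multiple of a unit bump from `χ` leaves a test function of
    -- mean zero, that is, a derivative of a test function, against which `w` integrates to zero.
    -- Hence `w` acts on `χ` as the constant `c`.
    obtain ⟨η, hη, hηc, hd⟩ := exists_primitive_of_integral_eq_zero
      (ψ := fun x => χ x - m * ρ x) (hχ.sub (contDiff_const.mul hρ))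
      (hχc.sub (hρc.mul_left (f := fun _ => m))) (by
        rw [integral_sub hχi (hρi.const_mul m), integral_const_mul, hρ1, mul_one, sub_self])
    have h0 := hw0 η hη hηc
    rw [hd] at h0
    simp only [sub_smul, mul_smul] at h0
    have hi : Integrable fun x => m • ρ x • w x :=
      (hwl.integrable_smul_left_of_hasCompactSupport hρ.continuous hρc).smul m
    rw [integral_sub (hwl.integrable_smul_left_of_hasCompactSupport hχ.continuous hχc)
      hi, integral_smul, sub_eq_zero] at h0
    rw [h0, integral_smul_const]
  refine ⟨fun x => c + G x, ?_, ?_⟩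
  · filter_upwards [hwc] with x hx
    rw [← hx, hw]; ring
  · simpa using (isPrim_const c).add pG

theorem HasWeakDeriv.sub {f g f' g' : ℝ → ℂ} (h : HasWeakDeriv f g) (h' : HasWeakDeriv f' g') :
    HasWeakDeriv (f - f') (g - g') := by
  refine ⟨h.1.sub h'.1, h.2.1.sub h'.2.1, fun η hη hc => ?_⟩
  have hηd : Continuous (deriv η) :=
    (hη.of_le (by exact_mod_cast le_top) : ContDiff ℝ 1 η).continuous_deriv le_rfl
  simp only [Pi.sub_apply, smul_sub]
  rw [integral_sub (h.1.integrable_smul_left_of_hasCompactSupport hηd hc.deriv)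
    (h'.1.integrable_smul_left_of_hasCompactSupport hηd hc.deriv),
    integral_sub (h.2.1.integrable_smul_left_of_hasCompactSupport hη.continuous hc)
    (h'.2.1.integrable_smul_left_of_hasCompactSupport hη.continuous hc),
    h.2.2 η hη hc, h'.2.2 η hη hc]
  ring

end WeakDerivative

/-! ### Representatives in `H^{1,1}`: behaviour at infinity and Lipschitz bounds for the gauge
factor. -/

section Representative

theorem eq_zero_of_tendsto_of_integrable {f : ℝ → ℂ} {a : ℂ} (hf : Integrable f) {l : Filter ℝ}
    (hl : l = atTop ∨ l = atBot) (h : Tendsto f l (𝓝 a)) : a = 0 := by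
  refine IntegrableAtFilter.eq_zero_of_tendsto (l := l) (μ := volume)
    (hf.integrableAtFilter l) (fun s hs => ?_) h
  rcases hl with rfl | rfl
  · obtain ⟨b, hb⟩ := mem_atTop_sets.1 hs
    exact top_unique (Real.volume_Ici (a := b) ▸ measure_mono fun x hx => hb x hx)
  · obtain ⟨b, hb⟩ := mem_atBot_sets.1 hs
    exact top_unique (Real.volume_Iic (a := b) ▸ measure_mono fun x hx => hb x hx)

/-- `v₁` is the derivative of `v`, and both are bounded by `M` in `L^{2,1}`. -/
structure Rep (v v₁ : ℝ → ℂ) (M : ℝ) : Prop where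
  nonneg : 0 ≤ M
  prim : IsPrim v v₁
  meas : StronglyMeasurable v₁
  norm_le : normL21 v ≤ ENNReal.ofReal M
  norm_deriv_le : normL21 v₁ ≤ ENNReal.ofReal M

variable {v v₁ v₂ w w₁ : ℝ → ℂ} {M Δ : ℝ}

theorem Rep.integrable (h : Rep v v₁ M) : Integrable v :=
  integrable_of_normL21_le h.prim.continuous.aestronglyMeasurable h.norm_le

theorem Rep.integrable_deriv (h : Rep v v₁ M) : Integrable v₁ :=
  integrable_of_normL21_le h.meas.aestronglyMeasurable h.norm_deriv_le

/-- The integrable derivative gives a limit, and integrability of the function forces it to be zero.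
-/
theorem Rep.tendsto_atBot (h : Rep v v₁ M) : Tendsto v atBot (𝓝 0) := by
  have := h.prim.integral_Iic h.integrable_deriv 0
  rwa [eq_zero_of_tendsto_of_integrable h.integrable (.inr rfl) this] at this

theorem Rep.tendsto_atTop (h : Rep v v₁ M) : Tendsto v atTop (𝓝 0) := by
  have := h.prim.integral_Ioi h.integrable_deriv 0
  rwa [eq_zero_of_tendsto_of_integrable h.integrable (.inl rfl) this] at this

theorem Rep.sup_le (h : Rep v v₁ M) (x : ℝ) : ‖v x‖ ≤ 2 * M := by
  rw [h.prim.eq_integral_Iic h.integrable_deriv h.tendsto_atBot x, zero_add]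
  exact (norm_integral_le_integral_norm _).trans
    ((setIntegral_le_integral h.integrable_deriv.norm (.of_forall fun _ => norm_nonneg _)).trans
      (integral_norm_le_of_normL21_le h.meas.aestronglyMeasurable h.nonneg h.norm_deriv_le))

theorem Rep.eLpNorm_le (h : Rep v v₁ M) : eLpNorm v 2 volume ≤ ENNReal.ofReal M :=
  (eLpNorm_le_normL21 _).trans h.norm_le

theorem Rep.integrable_sq (h : Rep v v₁ M) : Integrable fun x => ‖v x‖ ^ 2 := by
  have := (integrable_mul_of_eLpNorm_two h.nonneg h.nonneg
    h.prim.continuous.aestronglyMeasurable h.prim.continuous.aestronglyMeasurable h.eLpNorm_le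
    h.eLpNorm_le).1.norm
  exact this.congr (.of_forall fun x => by simp only [norm_mul, sq])

theorem Rep.integral_abs_sq_sub_le (hv : Rep v v₁ M) (hw : Rep w w₁ M)
    (hd : Rep (fun x => v x - w x) (fun x => v₁ x - w₁ x) Δ) :
    ∫ x, |‖v x‖ ^ 2 - ‖w x‖ ^ 2| ≤ 2 * M * Δ := by
  have cv := hv.prim.continuous.aestronglyMeasurable (μ := volume)
  have cw := hw.prim.continuous.aestronglyMeasurable (μ := volume)
  have cd := hd.prim.continuous.aestronglyMeasurable (μ := volume)
  obtain ⟨i1, n1⟩ := integrable_mul_of_eLpNorm_two hd.nonneg hv.nonneg cd cv hd.eLpNorm_le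
    hv.eLpNorm_le
  obtain ⟨i2, n2⟩ := integrable_mul_of_eLpNorm_two hd.nonneg hw.nonneg cd cw hd.eLpNorm_le
    hw.eLpNorm_le
  calc _ ≤ ∫ x, (‖(v x - w x) * v x‖ + ‖(v x - w x) * w x‖) := by
        refine integral_mono (hv.integrable_sq.sub hw.integrable_sq).abs (i1.norm.add i2.norm)
          fun x => ?_
        simp only [norm_mul, ← mul_add]
        rw [sq_sub_sq, abs_mul, abs_of_nonneg (by positivity : 0 ≤ ‖v x‖ + ‖w x‖), mul_comm]
        exact mul_le_mul_of_nonneg_right (abs_norm_sub_norm_le _ _) (by positivity)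
    _ = _ := integral_add i1.norm i2.norm
    _ ≤ _ := by linarith

theorem norm_exp_I_mul_sub_le (a b : ℝ) : ‖exp (I * a) - exp (I * b)‖ ≤ |a - b| := by
  have : exp (I * a) - exp (I * b) = exp (I * b) * (exp (I * (a - b : ℝ)) - 1) := by
    rw [mul_sub, ← Complex.exp_add, mul_one]; congr 2; push_cast; ring
  rw [this, norm_mul, mul_comm I (b : ℂ), Complex.norm_exp_ofReal_mul_I, one_mul]
  exact Real.norm_exp_I_mul_ofReal_sub_one_le

theorem Rep.norm_gauge_sub_le (hv : Rep v v₁ M) (hw : Rep w w₁ M)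
    (hd : Rep (fun x => v x - w x) (fun x => v₁ x - w₁ x) Δ) (x : ℝ) :
    ‖gauge v x - gauge w x‖ ≤ M * Δ := by
  refine (norm_exp_I_mul_sub_le _ _).trans ?_
  have i := hv.integrable_sq.sub hw.integrable_sq
  rw [gaugePhase, gaugePhase, ← mul_sub, ← integral_sub hv.integrable_sq.integrableOn
    hw.integrable_sq.integrableOn, abs_mul]
  have h1 : |∫ y in Iic x, (‖v y‖ ^ 2 - ‖w y‖ ^ 2)| ≤ 2 * M * Δ :=
    (norm_integral_le_integral_norm _).trans
      ((setIntegral_le_integral i.norm (.of_forall fun _ => norm_nonneg _)).trans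
        (hv.integral_abs_sq_sub_le hw hd))
  rw [abs_neg, abs_of_pos (by norm_num : (0 : ℝ) < 1 / 2)]
  linarith

theorem Rep.norm_gaugeTop_sub_le (hv : Rep v v₁ M) (hw : Rep w w₁ M)
    (hd : Rep (fun x => v x - w x) (fun x => v₁ x - w₁ x) Δ) :
    ‖gaugeTop v - gaugeTop w‖ ≤ M * Δ :=
  le_of_tendsto ((tendsto_gauge_atTop hv.integrable_sq).sub
    (tendsto_gauge_atTop hw.integrable_sq)).norm (.of_forall (hv.norm_gauge_sub_le hw hd))

end Representative

/-! ### A calculus propagating sizes and Lipschitz bounds through products. -/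

section Calculus

/-- Continuous functions bounded by `K` whose difference is bounded by `KΔ`. -/
structure LipSup (f f' : ℝ → ℂ) (K Δ : ℝ) : Prop where
  cont : Continuous f
  cont' : Continuous f'
  bound : ∀ x, ‖f x‖ ≤ K
  bound' : ∀ x, ‖f' x‖ ≤ K
  bound_sub : ∀ x, ‖f x - f' x‖ ≤ K * Δ

/-- Functions bounded by `K` in the weighted `L²` space whose difference is bounded by `KΔ`. -/
structure LipL2 (ρ : ℝ → ℝ) (f f' : ℝ → ℂ) (K Δ : ℝ) : Prop where
  nonneg : 0 ≤ K
  meas : StronglyMeasurable f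
  meas' : StronglyMeasurable f'
  bound : eLpNorm (fun x => ρ x • f x) 2 volume ≤ ENNReal.ofReal K
  bound' : eLpNorm (fun x => ρ x • f' x) 2 volume ≤ ENNReal.ofReal K
  bound_sub : eLpNorm (fun x => ρ x • (f x - f' x)) 2 volume ≤ ENNReal.ofReal (K * Δ)

variable {f f' g g' : ℝ → ℂ} {K L Δ : ℝ} {ρ : ℝ → ℝ}

theorem LipSup.nonneg (h : LipSup f f' K Δ) : 0 ≤ K := (norm_nonneg _).trans (h.bound 0)

theorem lipSup_const {c : ℂ} (hc : ‖c‖ ≤ K) (hΔ : 0 ≤ Δ) :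
    LipSup (fun _ => c) (fun _ => c) K Δ :=
  ⟨continuous_const, continuous_const, fun _ => hc, fun _ => hc, fun _ => by
    rw [sub_self, norm_zero]; exact mul_nonneg ((norm_nonneg _).trans hc) hΔ⟩

theorem LipSup.conj (h : LipSup f f' K Δ) :
    LipSup (fun x => conj (f x)) (fun x => conj (f' x)) K Δ :=
  ⟨Complex.continuous_conj.comp h.cont, Complex.continuous_conj.comp h.cont',
    fun x => (RCLike.norm_conj _).trans_le (h.bound x),
    fun x => (RCLike.norm_conj _).trans_le (h.bound' x), fun x => by
      rw [← map_sub, RCLike.norm_conj]; exact h.bound_sub x⟩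

/-- The factor `2` comes from the two terms of the difference of the products. -/
theorem LipSup.mul (h : LipSup f f' K Δ) (k : LipSup g g' L Δ) :
    LipSup (fun x => f x * g x) (fun x => f' x * g' x) (2 * K * L) Δ := by
  have hK := h.nonneg
  have hL := k.nonneg
  have hKL : K * L ≤ 2 * K * L := by nlinarith [mul_nonneg hK hL]
  refine ⟨h.cont.mul k.cont, h.cont'.mul k.cont', fun x => ?_, fun x => ?_, fun x => ?_⟩
  · rw [norm_mul]
    exact (mul_le_mul (h.bound x) (k.bound x) (norm_nonneg _) hK).trans hKL
  · rw [norm_mul]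
    exact (mul_le_mul (h.bound' x) (k.bound' x) (norm_nonneg _) hK).trans hKL
  · rw [show f x * g x - f' x * g' x = (f x - f' x) * g x + f' x * (g x - g' x) by ring]
    refine (norm_add_le_of_le (r₁ := K * Δ * L) (r₂ := K * (L * Δ)) ?_ ?_).trans
      (le_of_eq (by ring))
    · rw [norm_mul]
      exact mul_le_mul (h.bound_sub x) (k.bound x) (norm_nonneg _)
        ((norm_nonneg _).trans (h.bound_sub x))
    · rw [norm_mul]
      exact mul_le_mul (h.bound' x) (k.bound_sub x) (norm_nonneg _) hK

theorem LipL2.mono (h : LipL2 ρ f f' K Δ) (hΔ : 0 ≤ Δ) (hKL : K ≤ L) : LipL2 ρ f f' L Δ :=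
  ⟨h.nonneg.trans hKL, h.meas, h.meas', h.bound.trans (ENNReal.ofReal_le_ofReal hKL),
    h.bound'.trans (ENNReal.ofReal_le_ofReal hKL),
    h.bound_sub.trans (ENNReal.ofReal_le_ofReal (mul_le_mul_of_nonneg_right hKL hΔ))⟩

theorem LipL2.conj (h : LipL2 ρ f f' K Δ) :
    LipL2 ρ (fun x => conj (f x)) (fun x => conj (f' x)) K Δ := by
  have e : ∀ f : ℝ → ℂ, eLpNorm (fun x => ρ x • conj (f x)) 2 volume =
      eLpNorm (fun x => ρ x • f x) 2 volume := fun f =>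
    eLpNorm_congr_norm_ae (.of_forall fun x => by rw [norm_smul, norm_smul, RCLike.norm_conj])
  refine ⟨h.nonneg, Complex.continuous_conj.comp_stronglyMeasurable h.meas,
    Complex.continuous_conj.comp_stronglyMeasurable h.meas', (e f).trans_le h.bound,
    (e f').trans_le h.bound', ?_⟩
  simp only [← map_sub]
  exact (e fun x => f x - f' x).trans_le h.bound_sub

theorem LipL2.add (h : LipL2 ρ f f' K Δ) (k : LipL2 ρ g g' L Δ) (hρ : Continuous ρ) (hΔ : 0 ≤ Δ) :
    LipL2 ρ (fun x => f x + g x) (fun x => f' x + g' x) (K + L) Δ := by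
  have hK := h.nonneg
  have hL := k.nonneg
  have key : ∀ {f g : ℝ → ℂ} {K L : ℝ}, StronglyMeasurable f → StronglyMeasurable g → 0 ≤ K →
      0 ≤ L → eLpNorm (fun x => ρ x • f x) 2 volume ≤ ENNReal.ofReal K →
      eLpNorm (fun x => ρ x • g x) 2 volume ≤ ENNReal.ofReal L →
      eLpNorm (fun x => ρ x • (f x + g x)) 2 volume ≤ ENNReal.ofReal (K + L) :=
    fun {f g K L} hf hg hK hL h1 h2 => by
      simp only [smul_add]
      rw [ENNReal.ofReal_add hK hL]
      exact (eLpNorm_add_le (hρ.stronglyMeasurable.smul hf).aestronglyMeasurable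
        (hρ.stronglyMeasurable.smul hg).aestronglyMeasurable one_le_two).trans (add_le_add h1 h2)
  refine ⟨add_nonneg hK hL, h.meas.add k.meas, h.meas'.add k.meas',
    key h.meas k.meas hK hL h.bound k.bound, key h.meas' k.meas' hK hL h.bound' k.bound', ?_⟩
  have := key (h.meas.sub h.meas') (k.meas.sub k.meas') (mul_nonneg hK hΔ) (mul_nonneg hL hΔ)
    h.bound_sub k.bound_sub
  simpa only [Pi.sub_apply, add_mul, add_sub_add_comm] using this

theorem LipSup.mul_l2 (h : LipSup f f' K Δ) (k : LipL2 ρ g g' L Δ) (hρ : Continuous ρ)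
    (hΔ : 0 ≤ Δ) :
    LipL2 ρ (fun x => f x * g x) (fun x => f' x * g' x) (2 * K * L) Δ := by
  have hK := h.nonneg
  have hL := k.nonneg
  have hKL : K * L ≤ 2 * K * L := by nlinarith [mul_nonneg hK hL]
  have e : ∀ (f g : ℝ → ℂ), (fun x => ρ x • (f x * g x)) = fun x => f x * (ρ x • g x) :=
    fun f g => funext fun x => (mul_smul_comm _ _ _).symm
  refine ⟨by positivity, h.cont.stronglyMeasurable.mul k.meas,
    h.cont'.stronglyMeasurable.mul k.meas', ?_, ?_, ?_⟩
  · rw [e]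
    exact (eLpNorm_mul_le_of_bound h.bound hK k.bound).trans (ENNReal.ofReal_le_ofReal hKL)
  · rw [e]
    exact (eLpNorm_mul_le_of_bound h.bound' hK k.bound').trans (ENNReal.ofReal_le_ofReal hKL)
  · have : (fun x => ρ x • (f x * g x - f' x * g' x)) = fun x =>
        (f x - f' x) * (ρ x • g x) + f' x * (ρ x • (g x - g' x)) := by
      ext x; simp only [Complex.real_smul]; ring
    have hm := hρ.stronglyMeasurable
    rw [this, show 2 * K * L * Δ = K * Δ * L + K * (L * Δ) by ring,
      ENNReal.ofReal_add (by positivity) (by positivity)]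
    exact (eLpNorm_add_le
      ((h.cont.sub h.cont').stronglyMeasurable.mul (hm.smul k.meas)).aestronglyMeasurable
      (h.cont'.stronglyMeasurable.mul (hm.smul (k.meas.sub k.meas'))).aestronglyMeasurable
      one_le_two).trans (add_le_add
        (eLpNorm_mul_le_of_bound h.bound_sub (by positivity) k.bound)
        (eLpNorm_mul_le_of_bound h.bound' hK k.bound_sub))

theorem LipL2.congr {F F' : ℝ → ℂ} (h : LipL2 ρ f f' K Δ) (hf : ∀ x, F x = f x)
    (hf' : ∀ x, F' x = f' x) : LipL2 ρ F F' K Δ := by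
  obtain rfl := funext hf
  obtain rfl := funext hf'
  exact h

end Calculus

/-! ### Bounds for the coefficients of the transformed system. -/

section Coefficients

/-- The weight of `L^{2,1}`. -/
noncomputable def bracket (x : ℝ) : ℝ := Real.sqrt (1 + x ^ 2)

theorem continuous_bracket : Continuous bracket := by unfold bracket; fun_prop

variable {v v₁ v₂ w w₁ w₂ : ℝ → ℂ} {M Δ : ℝ}

/-- The derivative of the second coefficient of the transformed system. -/
noncomputable def sysDeriv (v v₁ v₂ : ℝ → ℂ) (x : ℝ) : ℂ :=
  2 * I * v x * conj (v x) * gauge v x * gauge v x * conj (v₁ x) +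
    1 / 2 * v x * conj (v x) * gauge v x * gauge v x * conj (v x) * conj (v x) * v x +
    -1 * gauge v x * gauge v x * conj (v₂ x) +
    I / 2 * gauge v x * gauge v x * conj (v x) * conj (v x) * v₁ x

theorem isPrim_sysCoeff_one (hp : IsPrim v v₁) (hi : Integrable fun x => ‖v x‖ ^ 2)
    (hp₁ : IsPrim v₁ v₂) : IsPrim (sysCoeff v v₁ 1) (sysDeriv v v₁ v₂) := by
  have pg := isPrim_gauge hp.continuous hi
  refine ((((pg.mul pg).mul (hp₁.conj.sub ((isPrim_const (I / 2)).mul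
    ((hp.mul hp.conj).mul hp.conj)))).neg).congr fun x => ?_).congr_left fun x => ?_
  · simp only [sysDeriv]
    linear_combination (1 / 2 * v x * conj (v x) * gauge v x * gauge v x * conj (v x) *
      conj (v x) * v x) * (-Complex.I_sq)
  · simp [sysCoeff, sq]

/-- The constant `2M + 2` is chosen to serve all building blocks at once: it exceeds the supremum
bound `2M`, the modulus `1` of the gauge factor and the norm bound `M`, and also the Lipschitz
constants `2`, `M` and `1` belonging to them. -/
theorem Rep.lipSup (hv : Rep v v₁ M) (hw : Rep w w₁ M)
    (hd : Rep (fun x => v x - w x) (fun x => v₁ x - w₁ x) Δ) : LipSup v w (2 * M + 2) Δ :=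
  ⟨hv.prim.continuous, hw.prim.continuous, fun x => (hv.sup_le x).trans (by linarith),
    fun x => (hw.sup_le x).trans (by linarith), fun x => (hd.sup_le x).trans (by
      nlinarith [mul_nonneg hv.nonneg hd.nonneg])⟩

theorem Rep.lipSup_gauge (hv : Rep v v₁ M) (hw : Rep w w₁ M)
    (hd : Rep (fun x => v x - w x) (fun x => v₁ x - w₁ x) Δ) :
    LipSup (gauge v) (gauge w) (2 * M + 2) Δ := by
  have hM := hv.nonneg
  refine ⟨(isPrim_gauge hv.prim.continuous hv.integrable_sq).continuous,
    (isPrim_gauge hw.prim.continuous hw.integrable_sq).continuous,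
    fun x => by rw [norm_gauge]; linarith, fun x => by rw [norm_gauge]; linarith,
    fun x => (hv.norm_gauge_sub_le hw hd x).trans ?_⟩
  nlinarith [mul_nonneg hv.nonneg hd.nonneg, hd.nonneg]

theorem Rep.lipL2 (hv : Rep v v₁ M) (hw : Rep w w₁ M)
    (hd : Rep (fun x => v x - w x) (fun x => v₁ x - w₁ x) Δ) :
    LipL2 bracket v w (2 * M + 2) Δ := by
  have hM := hv.nonneg
  refine ⟨by positivity, hv.prim.continuous.stronglyMeasurable,
    hw.prim.continuous.stronglyMeasurable,
    hv.norm_le.trans (ENNReal.ofReal_le_ofReal (by linarith)),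
    hw.norm_le.trans (ENNReal.ofReal_le_ofReal (by linarith)),
    hd.norm_le.trans (ENNReal.ofReal_le_ofReal ?_)⟩
  nlinarith [mul_nonneg hv.nonneg hd.nonneg, hd.nonneg]

theorem Rep.lipL2_deriv (hv : Rep v v₁ M) (hw : Rep w w₁ M)
    (hd : Rep (fun x => v x - w x) (fun x => v₁ x - w₁ x) Δ) :
    LipL2 bracket v₁ w₁ (2 * M + 2) Δ := by
  have hM := hv.nonneg
  refine ⟨by positivity, hv.meas, hw.meas,
    hv.norm_deriv_le.trans (ENNReal.ofReal_le_ofReal (by linarith)),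
    hw.norm_deriv_le.trans (ENNReal.ofReal_le_ofReal (by linarith)),
    hd.norm_deriv_le.trans (ENNReal.ofReal_le_ofReal ?_)⟩
  nlinarith [mul_nonneg hv.nonneg hd.nonneg, hd.nonneg]

theorem LipL2.unweighted {f f' : ℝ → ℂ} {K : ℝ} (h : LipL2 bracket f f' K Δ) :
    LipL2 (fun _ => 1) f f' K Δ := by
  have e : ∀ f : ℝ → ℂ, eLpNorm (fun x => (1 : ℝ) • f x) 2 volume ≤
      eLpNorm (fun x => bracket x • f x) 2 volume := fun f => by
    simp only [one_smul]
    exact eLpNorm_le_normL21 f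
  exact ⟨h.nonneg, h.meas, h.meas', (e _).trans h.bound, (e _).trans h.bound',
    (e fun x => f x - f' x).trans h.bound_sub⟩

/-- The constant in the bounds for the coefficients of the transformed system. -/
def coeffConst (M : ℝ) : ℝ := 400 * (2 * M + 2) ^ 7

theorem coeffConst_bounds (hM : 0 ≤ M) : (2 * M + 2) ^ 2 ≤ (2 * M + 2) ^ 7 ∧
    (2 * M + 2) ^ 3 ≤ (2 * M + 2) ^ 7 ∧ (2 * M + 2) ^ 5 ≤ (2 * M + 2) ^ 7 ∧
    0 ≤ (2 * M + 2) ^ 7 := by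
  have h1 : 1 ≤ 2 * M + 2 := by linarith
  exact ⟨pow_le_pow_right₀ h1 (by norm_num), pow_le_pow_right₀ h1 (by norm_num),
    pow_le_pow_right₀ h1 (by norm_num), by positivity⟩

theorem Rep.lipL2_sysCoeff (hv : Rep v v₁ M) (hw : Rep w w₁ M)
    (hd : Rep (fun x => v x - w x) (fun x => v₁ x - w₁ x) Δ) (k : Fin 3) :
    LipL2 bracket (sysCoeff v v₁ k) (sysCoeff w w₁ k) (coeffConst M) Δ := by
  have hM := hv.nonneg
  have hΔ := hd.nonneg
  have s := hv.lipSup hw hd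
  have g := hv.lipSup_gauge hw hd
  have l := hv.lipL2 hw hd
  have l1 := hv.lipL2_deriv hw hd
  have hb := continuous_bracket
  obtain ⟨h2, h3, h5, h7⟩ := coeffConst_bounds hM
  have c : ∀ a : ℂ, ‖a‖ ≤ 2 → LipSup (fun _ => a) (fun _ => a) 2 Δ := fun a ha => lipSup_const ha hΔ
  fin_cases k
  · refine (((((c (-(I / 2)) (by norm_num)).mul g.conj).mul g.conj).mul_l2 l hb hΔ).mono hΔ
      (L := coeffConst M) ?_).congr (fun x => ?_) (fun x => ?_)
    · rw [coeffConst]; nlinarith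
    · simp [sysCoeff]; ring
    · simp [sysCoeff]; ring
  · refine ((((((c (-1) (by norm_num)).mul g).mul g).mul_l2 l1.conj hb hΔ).add
      ((((((c (I / 2) (by norm_num)).mul g).mul g).mul s.conj).mul s.conj).mul_l2 l hb hΔ)
      hb hΔ).mono hΔ (L := coeffConst M) ?_).congr (fun x => ?_) (fun x => ?_)
    · rw [coeffConst]; nlinarith
    · simp [sysCoeff]; ring
    · simp [sysCoeff]; ring
  · refine ((g.mul_l2 l.conj hb hΔ).mono hΔ (L := coeffConst M) ?_).congr (fun x => ?_)
      (fun x => ?_)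
    · rw [coeffConst]; nlinarith
    · simp [sysCoeff]; ring
    · simp [sysCoeff]; ring

theorem Rep.coeffBound (hv : Rep v v₁ M) (hw : Rep w w₁ M)
    (hd : Rep (fun x => v x - w x) (fun x => v₁ x - w₁ x) Δ) :
    CoeffBound (sysCoeff v v₁) (coeffConst M) ∧ CoeffBound (sysCoeff w w₁) (coeffConst M) ∧
      CoeffBound (fun k x => sysCoeff v v₁ k x - sysCoeff w w₁ k x) (coeffConst M * Δ) := by
  have h := hv.lipL2_sysCoeff hw hd
  have h0 := (h 0).nonneg
  exact ⟨⟨h0, fun k => (h k).meas, fun k => (h k).bound⟩,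
    ⟨h0, fun k => (h k).meas', fun k => (h k).bound'⟩,
    ⟨mul_nonneg h0 hd.nonneg, fun k => (h k).meas.sub (h k).meas', fun k => (h k).bound_sub⟩⟩

theorem rep_zero (hM : 0 ≤ M) : Rep (fun _ => 0) (fun _ => 0) M := by
  have : normL21 (fun _ => 0) ≤ ENNReal.ofReal M := by
    have : weighted (fun _ => 0) = 0 := by ext x; simp [weighted]
    simp [normL21, this]
  exact ⟨hM, isPrim_const 0, stronglyMeasurable_const, this, this⟩

theorem Rep.isPotential (h : Rep v v₁ M) : IsPotential v v₁ where
  prim := h.prim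
  int := h.integrable
  int_sq := h.integrable_sq
  bot := h.tendsto_atBot
  top := h.tendsto_atTop
  int_coeff := (h.coeffBound (rep_zero h.nonneg) (by simpa using h)).1.integrable

/-- In addition, `v₂` is the derivative of `v₁` and bounded by `M` in `L²`. -/
structure Rep2 (v v₁ v₂ : ℝ → ℂ) (M : ℝ) : Prop extends Rep v v₁ M where
  prim_deriv : IsPrim v₁ v₂
  meas_deriv : StronglyMeasurable v₂
  norm_deriv2_le : eLpNorm v₂ 2 volume ≤ ENNReal.ofReal M

/-- The second derivative is only in `L²`, so the argument is applied to `|v₁|²`: its derivative is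
a sum of products of `L²` functions and hence integrable, so it has a limit, which is zero because
`|v₁|²` is integrable. -/
theorem Rep2.tendsto_deriv (h : Rep2 v v₁ v₂ M) {l : Filter ℝ} (hl : l = atTop ∨ l = atBot) :
    Tendsto v₁ l (𝓝 0) := by
  have h1 : eLpNorm v₁ 2 volume ≤ ENNReal.ofReal M := (eLpNorm_le_normL21 _).trans h.norm_deriv_le
  have c1 := h.prim_deriv.continuous.aestronglyMeasurable (μ := volume)
  have c2 := h.meas_deriv.aestronglyMeasurable (μ := volume)
  have cj : ∀ f : ℝ → ℂ, eLpNorm (fun x => conj (f x)) 2 volume = eLpNorm f 2 volume := fun f =>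
    eLpNorm_congr_norm_ae (.of_forall fun x => RCLike.norm_conj _)
  have mc : ∀ f : ℝ → ℂ, AEStronglyMeasurable f volume →
      AEStronglyMeasurable (fun x => conj (f x)) volume := fun f hf =>
    Complex.continuous_conj.comp_aestronglyMeasurable hf
  have hi := (integrable_mul_of_eLpNorm_two h.nonneg h.nonneg c2 (mc _ c1) h.norm_deriv2_le
    ((cj _).trans_le h1)).1.add (integrable_mul_of_eLpNorm_two h.nonneg h.nonneg c1 (mc _ c2) h1
    ((cj _).trans_le h.norm_deriv2_le)).1
  have hp := h.prim_deriv.mul h.prim_deriv.conj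
  have hsq := (integrable_mul_of_eLpNorm_two h.nonneg h.nonneg c1 (mc _ c1) h1
    ((cj _).trans_le h1)).1
  have key : Tendsto (fun x => v₁ x * conj (v₁ x)) l (𝓝 0) := by
    rcases hl with rfl | rfl
    · have := hp.integral_Ioi hi 0
      rwa [eq_zero_of_tendsto_of_integrable hsq (.inl rfl) this] at this
    · have := hp.integral_Iic hi 0
      rwa [eq_zero_of_tendsto_of_integrable hsq (.inr rfl) this] at this
  have k2 := key.norm
  simp only [norm_mul, RCLike.norm_conj, norm_zero] at k2
  have k3 := (Real.continuous_sqrt.tendsto _).comp k2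
  rw [tendsto_zero_iff_norm_tendsto_zero]
  simpa [Function.comp_def] using k3

theorem Rep2.tendsto_sysCoeff_one (h : Rep2 v v₁ v₂ M) {l : Filter ℝ} (hl : l = atTop ∨ l = atBot) :
    Tendsto (sysCoeff v v₁ 1) l (𝓝 0) := by
  have hv : Tendsto v l (𝓝 0) := by
    rcases hl with rfl | rfl
    exacts [h.toRep.tendsto_atTop, h.toRep.tendsto_atBot]
  have k := ((tendsto_conj_zero (h.tendsto_deriv hl)).sub
    (((hv.mul (tendsto_conj_zero hv)).mul (tendsto_conj_zero hv)).const_mul (I / 2)))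
  simp only [mul_zero, sub_zero] at k
  rw [tendsto_zero_iff_norm_tendsto_zero] at k ⊢
  refine k.congr fun x => ?_
  simp [sysCoeff, norm_gauge]

theorem Rep2.lipL2_sysDeriv (hv : Rep2 v v₁ v₂ M) (hw : Rep2 w w₁ w₂ M)
    (hd : Rep2 (fun x => v x - w x) (fun x => v₁ x - w₁ x) (fun x => v₂ x - w₂ x) Δ) :
    LipL2 (fun _ => 1) (sysDeriv v v₁ v₂) (sysDeriv w w₁ w₂) (coeffConst M) Δ := by
  have hM := hv.nonneg
  have hΔ := hd.nonneg
  have s := hv.toRep.lipSup hw.toRep hd.toRep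
  have g := hv.toRep.lipSup_gauge hw.toRep hd.toRep
  have l := (hv.toRep.lipL2 hw.toRep hd.toRep).unweighted
  have l1 := (hv.toRep.lipL2_deriv hw.toRep hd.toRep).unweighted
  have l2 : LipL2 (fun _ => 1) v₂ w₂ (2 * M + 2) Δ := by
    refine ⟨by positivity, hv.meas_deriv, hw.meas_deriv, ?_, ?_, ?_⟩ <;> simp only [one_smul]
    · exact hv.norm_deriv2_le.trans (ENNReal.ofReal_le_ofReal (by linarith))
    · exact hw.norm_deriv2_le.trans (ENNReal.ofReal_le_ofReal (by linarith))
    · exact hd.norm_deriv2_le.trans (ENNReal.ofReal_le_ofReal (by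
        nlinarith [mul_nonneg hM hΔ]))
  have hb : Continuous fun _ : ℝ => (1 : ℝ) := continuous_const
  obtain ⟨h2, h3, h5, h7⟩ := coeffConst_bounds hM
  have c : ∀ a : ℂ, ‖a‖ ≤ 2 → LipSup (fun _ => a) (fun _ => a) 2 Δ := fun a ha => lipSup_const ha hΔ
  have t1 := (((((c (2 * I) (by norm_num)).mul s).mul s.conj).mul g).mul g).mul_l2 l1.conj hb hΔ
  have t2 := (((((((c (1 / 2) (by norm_num)).mul s).mul s.conj).mul g).mul g).mul s.conj).mul
    s.conj).mul_l2 l hb hΔ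
  have t3 := (((c (-1) (by norm_num)).mul g).mul g).mul_l2 l2.conj hb hΔ
  have t4 := (((((c (I / 2) (by norm_num)).mul g).mul g).mul s.conj).mul s.conj).mul_l2 l1 hb hΔ
  refine ((((t1.add t2 hb hΔ).add t3 hb hΔ).add t4 hb hΔ).mono hΔ (L := coeffConst M) ?_).congr
    (fun x => rfl) (fun x => rfl)
  -- With `K = 2M + 2` the four terms have constants `64K⁵`, `256K⁷`, `16K³` and `64K⁵`; this is the
  -- origin of both the power `7` and `400 = 64 + 256 + 16 + 64`.
  rw [coeffConst]
  nlinarith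

theorem Rep2.smoothBound (hv : Rep2 v v₁ v₂ M) (hw : Rep2 w w₁ w₂ M)
    (hd : Rep2 (fun x => v x - w x) (fun x => v₁ x - w₁ x) (fun x => v₂ x - w₂ x) Δ) :
    SmoothBound (sysCoeff v v₁) (sysDeriv v v₁ v₂) (coeffConst M) ∧
      SmoothBound (sysCoeff w w₁) (sysDeriv w w₁ w₂) (coeffConst M) ∧
      SmoothBound (fun k x => sysCoeff v v₁ k x - sysCoeff w w₁ k x)
        (fun x => sysDeriv v v₁ v₂ x - sysDeriv w w₁ w₂ x) (coeffConst M * Δ) := by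
  obtain ⟨b1, b2, b3⟩ := hv.toRep.coeffBound hw.toRep hd.toRep
  have h := hv.lipL2_sysDeriv hw hd
  have p1 := isPrim_sysCoeff_one hv.prim hv.toRep.integrable_sq hv.prim_deriv
  have p2 := isPrim_sysCoeff_one hw.prim hw.toRep.integrable_sq hw.prim_deriv
  have e1 := h.bound
  have e2 := h.bound'
  have e3 := h.bound_sub
  simp only [one_smul] at e1 e2 e3
  refine ⟨⟨b1, p1, hv.tendsto_sysCoeff_one (.inr rfl), hv.tendsto_sysCoeff_one (.inl rfl),
    h.meas, e1⟩, ⟨b2, p2, hw.tendsto_sysCoeff_one (.inr rfl), hw.tendsto_sysCoeff_one (.inl rfl),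
    h.meas', e2⟩, ⟨b3, p1.sub p2, ?_, ?_, h.meas.sub h.meas', e3⟩⟩
  · simpa using (hv.tendsto_sysCoeff_one (.inr rfl)).sub (hw.tendsto_sysCoeff_one (.inr rfl))
  · simpa using (hv.tendsto_sysCoeff_one (.inl rfl)).sub (hw.tendsto_sysCoeff_one (.inl rfl))

theorem rep2_zero (hM : 0 ≤ M) : Rep2 (fun _ => 0) (fun _ => 0) (fun _ => 0) M :=
  ⟨rep_zero hM, isPrim_const 0, stronglyMeasurable_const, by simp⟩

end Coefficients

/-! ### The reflection coefficients through the transformed system. -/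

section Reflection

/-- The first column of the transfer matrix of the transformed system. -/
noncomputable def sysEntry (v v₁ : ℝ → ℂ) (i : Fin 3) (z : ℝ) : ℂ :=
  entry (transfer sysUnit sysFreq (sysCoeff v v₁) z) i 0

/-- The reflection coefficient `r₋` in terms of the transformed system. -/
noncomputable def reflMinus (v v₁ : ℝ → ℂ) (z : ℝ) : ℂ :=
  conj (gaugeTop v) ^ 2 * sysEntry v v₁ 1 z / sysEntry v v₁ 0 z

/-- The reflection coefficient `r₊` in terms of the transformed system. -/
noncomputable def reflPlus (v v₁ : ℝ → ℂ) (z : ℝ) : ℂ :=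
  -(I / 2) * conj (gaugeTop v) * sysEntry v v₁ 2 z / sysEntry v v₁ 0 z

variable {u v v₁ v₂ w w₁ w₂ : ℝ → ℂ} {M Δ a : ℝ} {l : ℂ} {z : ℝ}

theorem gaugeTop_ne_zero (v : ℝ → ℂ) : gaugeTop v ≠ 0 := Complex.exp_ne_zero _

theorem Rep.scatA_eq (h : Rep v v₁ M) (huv : u =ᵐ[volume] v) (hl : l ^ 2 = z) :
    scatA u l = gaugeTop v * sysEntry v v₁ 0 z := by
  have hu := h.integrable.congr huv.symm
  rw [DNLS.scatA_eq hu hl, fwdTop_knGen_congr hu huv, (transfer_gauge h.isPotential hl).1]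
  rfl

theorem Rep.scatB_eq (h : Rep v v₁ M) (huv : u =ᵐ[volume] v) (hl : l ^ 2 = z) :
    scatB u l = -(l * sysEntry v v₁ 2 z) ∧
      2 * I * l * scatB u l = conj (gaugeTop v) * sysEntry v v₁ 1 z := by
  have hu := h.integrable.congr huv.symm
  rw [DNLS.scatB_eq hu hl, fwdTop_knGen_congr hu huv]
  exact (transfer_gauge h.isPotential hl).2

theorem Rep.quotient_eq (h : Rep v v₁ M) (huv : u =ᵐ[volume] v) (hl : l ^ 2 = z) (hl0 : l ≠ 0) :
    -(scatB u l / (2 * I * l * scatA u l)) = reflPlus v v₁ z ∧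
      2 * I * l * scatB u l / scatA u l = reflMinus v v₁ z := by
  have hG := mul_conj_of_norm_one (norm_gaugeTop v)
  have hG0 := gaugeTop_ne_zero v
  obtain ⟨h1, h2⟩ := h.scatB_eq huv hl
  have hc : conj (gaugeTop v) = (gaugeTop v)⁻¹ := eq_inv_of_mul_eq_one_right hG
  constructor
  · rw [h1, h.scatA_eq huv hl, reflPlus, hc]
    have hI : -(I / 2) = (2 * I)⁻¹ := by
      rw [mul_inv, Complex.inv_I]; ring
    rw [hI, neg_div, neg_neg]
    -- No lower bound on `a` is assumed here: where it vanishes, both quotients are zero by the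
    -- convention for division.
    by_cases h0 : sysEntry v v₁ 0 z = 0
    · simp [h0]
    · field_simp
  · rw [h2, h.scatA_eq huv hl, reflMinus, hc]
    by_cases h0 : sysEntry v v₁ 0 z = 0
    · simp [h0]
    · field_simp

theorem root_sq (z : ℝ) : root z ^ 2 = z := by
  unfold root
  split_ifs with h
  · rw [← ofReal_pow, Real.sq_sqrt h]
  · rw [mul_pow, Complex.I_sq, ← ofReal_pow, Real.sq_sqrt (by linarith)]
    push_cast; ring

theorem root_mem_axes (z : ℝ) : root z ∈ axes := by
  unfold root axes
  split_ifs with h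
  · exact Or.inl (by simp)
  · exact Or.inr (by simp)

theorem root_ne_zero (hz : z ≠ 0) : root z ≠ 0 := fun h => by
  have := root_sq z
  rw [h] at this
  exact hz (by simpa using this.symm)

theorem sq_eq_ofReal_of_mem_axes (h : l ∈ axes) : ∃ z : ℝ, l ^ 2 = z := by
  rcases h with h | h
  · exact ⟨l.re ^ 2, by
      conv_lhs => rw [← Complex.re_add_im l, h]
      push_cast; ring⟩
  · exact ⟨-l.im ^ 2, by
      conv_lhs => rw [← Complex.re_add_im l, h]
      rw [ofReal_zero, zero_add, mul_pow, Complex.I_sq]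
      push_cast; ring⟩

/-- The gauge factor has modulus one, so it does not affect `|a|`. -/
theorem Rep.le_norm_sysEntry (h : Rep v v₁ M) (huv : u =ᵐ[volume] v) {A : ℝ} (hA : ABound u A)
    (z : ℝ) : A ≤ ‖sysEntry v v₁ 0 z‖ := by
  have := hA (root z) (root_mem_axes z)
  rwa [h.scatA_eq huv (root_sq z), norm_mul, norm_gaugeTop, one_mul] at this

theorem Rep.rPlus_eq (h : Rep v v₁ M) (huv : u =ᵐ[volume] v) (hz : z ≠ 0) :
    rPlus u z = reflPlus v v₁ z :=
  (h.quotient_eq huv (root_sq z) (root_ne_zero hz)).1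

theorem Rep.rMinus_eq (h : Rep v v₁ M) (huv : u =ᵐ[volume] v) (hz : z ≠ 0) :
    rMinus u z = reflMinus v v₁ z :=
  (h.quotient_eq huv (root_sq z) (root_ne_zero hz)).2

theorem ae_ne_zero : ∀ᵐ z : ℝ, z ≠ 0 := by
  simp [ae_iff]

/-- Only `z = 0` is excluded: there `root z = 0`, and `rPlus` has the default value `0`. -/
theorem Rep.rPlus_ae (h : Rep v v₁ M) (huv : u =ᵐ[volume] v) :
    rPlus u =ᵐ[volume] reflPlus v v₁ := by
  filter_upwards [ae_ne_zero] with z hz using h.rPlus_eq huv hz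

theorem Rep.rMinus_ae (h : Rep v v₁ M) (huv : u =ᵐ[volume] v) :
    rMinus u =ᵐ[volume] reflMinus v v₁ := by
  filter_upwards [ae_ne_zero] with z hz using h.rMinus_eq huv hz

/-- The two formulas for `b` are compared. The consequence is that the weighted bound for `r₊`
follows from the unweighted bound for `r₋`. -/
theorem Rep.reflMinus_eq (h : Rep v v₁ M) (z : ℝ) :
    reflMinus v v₁ z = 4 * (z * reflPlus v v₁ z) := by
  obtain ⟨h1, h2⟩ := h.scatB_eq (u := v) (ae_eq_refl v) (root_sq z)
  rw [h1] at h2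
  have hz := root_sq z
  have e : conj (gaugeTop v) * sysEntry v v₁ 1 z = -(2 * I * z * sysEntry v v₁ 2 z) := by
    rw [← h2, ← hz]; ring
  rw [reflMinus, reflPlus, sq, mul_assoc, e]
  ring

theorem Rep.continuous_sysEntry (h : Rep v v₁ M) (i : Fin 3) : Continuous (sysEntry v v₁ i) :=
  (continuous_entry i 0).comp
    (continuous_transfer _ _ h.isPotential.int_coeff norm_sysUnit_le)

theorem Rep.continuous_refl (h : Rep v v₁ M) (ha : 0 < a) (hA : ∀ z, a ≤ ‖sysEntry v v₁ 0 z‖) :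
    Continuous (reflPlus v v₁) ∧ Continuous (reflMinus v v₁) := by
  have h0 : ∀ z, sysEntry v v₁ 0 z ≠ 0 := fun z => norm_pos_iff.1 (ha.trans_le (hA z))
  exact ⟨(continuous_const.mul (h.continuous_sysEntry 2)).div (h.continuous_sysEntry 0) h0,
    (continuous_const.mul (h.continuous_sysEntry 1)).div (h.continuous_sysEntry 0) h0⟩

theorem coeffConst_nonneg (hM : 0 ≤ M) : 0 ≤ coeffConst M := by
  unfold coeffConst; positivity

theorem two_mul_le_coeffConst (hM : 0 ≤ M) : 2 * M ≤ coeffConst M := by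
  have h1 : 1 ≤ 2 * M + 2 := by linarith
  have := le_self_pow₀ h1 (n := 7) (by norm_num)
  unfold coeffConst
  linarith

/-- Lipschitz continuity of the reflection coefficients and of their increments in `L²`. -/
theorem l2Maj_refl_sub (hM : 0 ≤ M) (ha : 0 < a) :
    ∃ C : ℝ, 0 ≤ C ∧ ∀ (v v₁ w w₁ : ℝ → ℂ) (Δ : ℝ), Rep v v₁ M → Rep w w₁ M →
      Rep (fun x => v x - w x) (fun x => v₁ x - w₁ x) Δ →
      (∀ z, a ≤ ‖sysEntry v v₁ 0 z‖) → (∀ z, a ≤ ‖sysEntry w w₁ 0 z‖) →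
      (L2Maj (fun z => reflPlus v v₁ z - reflPlus w w₁ z) (C * Δ) ∧
        ∀ η, L2Maj (fun z => (reflPlus v v₁ (z + η) - reflPlus w w₁ (z + η)) -
          (reflPlus v v₁ z - reflPlus w w₁ z)) (C * Δ * |η|)) ∧
      (L2Maj (fun z => reflMinus v v₁ z - reflMinus w w₁ z) (C * Δ) ∧
        ∀ η, L2Maj (fun z => (reflMinus v v₁ (z + η) - reflMinus w w₁ (z + η)) -
          (reflMinus v v₁ z - reflMinus w w₁ z)) (C * Δ * |η|)) := by
  have hK := coeffConst_nonneg hM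
  obtain ⟨C₁, hC₁, H₁⟩ := l2Maj_ratio_sub norm_sysUnit_le abs_sysFreq hK ha
    (i := 1) (j := 0) (by decide)
  obtain ⟨C₂, hC₂, H₂⟩ := l2Maj_ratio_sub norm_sysUnit_le abs_sysFreq hK ha
    (i := 2) (j := 0) (by decide)
  refine ⟨(C₁ + C₂) * coeffConst M, by positivity, fun v v₁ w w₁ Δ hv hw hd hα hα' => ?_⟩
  have hΔ := hd.nonneg
  obtain ⟨b1, b2, b3⟩ := hv.coeffBound hw hd
  have hg := hv.norm_gaugeTop_sub_le hw hd
  have hgc : ‖conj (gaugeTop v) - conj (gaugeTop w)‖ ≤ M * Δ := by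
    rwa [← map_sub, RCLike.norm_conj]
  have n1 : ∀ v, ‖conj (gaugeTop v)‖ = 1 := fun v => by rw [RCLike.norm_conj, norm_gaugeTop]
  have h2M := mul_le_mul_of_nonneg_right (two_mul_le_coeffConst hM) hΔ
  have hMΔ : 0 ≤ M * Δ := mul_nonneg hM hΔ
  have k1 : ‖conj (gaugeTop v) ^ 2 - conj (gaugeTop w) ^ 2‖ ≤ coeffConst M * Δ := by
    rw [sq_sub_sq, norm_mul]
    refine (mul_le_mul (norm_add_le _ _) hgc (norm_nonneg _) (by positivity)).trans ?_
    rw [n1, n1]; linarith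
  have k2 : ‖-(I / 2) * conj (gaugeTop v) - -(I / 2) * conj (gaugeTop w)‖ ≤ coeffConst M * Δ := by
    rw [← mul_sub, norm_mul]
    have : ‖-(I / 2)‖ = 1 / 2 := by simp
    rw [this]; linarith
  have m1 : ∀ v, ‖conj (gaugeTop v) ^ 2‖ ≤ 1 := fun v => by rw [norm_pow, n1]; norm_num
  have m2 : ∀ v, ‖-(I / 2) * conj (gaugeTop v)‖ ≤ 1 := fun v => by
    rw [norm_mul, n1]; norm_num
  obtain ⟨r1, r2⟩ := H₂ _ _ _ _ _ b1 b2 b3 (m2 v) (m2 w) k2 hα hα'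
  obtain ⟨s1, s2⟩ := H₁ _ _ _ _ _ b1 b2 b3 (m1 v) (m1 w) k1 hα hα'
  have e1 : C₂ * (coeffConst M * Δ) ≤ (C₁ + C₂) * coeffConst M * Δ := by
    rw [mul_assoc]; gcongr; linarith
  have e2 : C₁ * (coeffConst M * Δ) ≤ (C₁ + C₂) * coeffConst M * Δ := by
    rw [mul_assoc]; gcongr; linarith
  refine ⟨⟨r1.mono_const e1, fun η => ?_⟩, s1.mono_const e2, fun η => ?_⟩
  · refine ((r2 η).mono fun z => le_of_eq ?_).mono_const
      (mul_le_mul_of_nonneg_right e1 (abs_nonneg η))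
    congr 1
    exact sub_sub_sub_comm _ _ _ _
  · refine ((s2 η).mono fun z => le_of_eq ?_).mono_const
      (mul_le_mul_of_nonneg_right e2 (abs_nonneg η))
    congr 1
    exact sub_sub_sub_comm _ _ _ _

/-- Lipschitz continuity of the reflection coefficients with weight `z` in `L²`. -/
theorem l2Maj_mul_refl_sub (hM : 0 ≤ M) (ha : 0 < a) :
    ∃ C : ℝ, 0 ≤ C ∧ ∀ (v v₁ v₂ w w₁ w₂ : ℝ → ℂ) (Δ : ℝ), Rep2 v v₁ v₂ M → Rep2 w w₁ w₂ M →
      Rep2 (fun x => v x - w x) (fun x => v₁ x - w₁ x) (fun x => v₂ x - w₂ x) Δ →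
      (∀ z, a ≤ ‖sysEntry v v₁ 0 z‖) → (∀ z, a ≤ ‖sysEntry w w₁ 0 z‖) →
      L2Maj (fun z : ℝ => (z : ℂ) * (reflPlus v v₁ z - reflPlus w w₁ z)) (C * Δ) ∧
      L2Maj (fun z : ℝ => (z : ℂ) * (reflMinus v v₁ z - reflMinus w w₁ z)) (C * Δ) := by
  have hK := coeffConst_nonneg hM
  obtain ⟨C₁, hC₁, H₁⟩ := l2Maj_refl_sub hM ha
  obtain ⟨C₂, hC₂, H₂⟩ := l2Maj_mul_ratio_sub hK ha
  refine ⟨C₁ + C₂ * coeffConst M, by positivity,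
    fun v v₁ v₂ w w₁ w₂ Δ hv hw hd hα hα' => ⟨?_, ?_⟩⟩
  · have hΔ := hd.nonneg
    -- Here `z r₊ = r₋ / 4`, so one derivative of the potential suffices; the second derivative
    -- enters only in the bound for `z r₋`.
    refine ((H₁ v v₁ w w₁ Δ hv.toRep hw.toRep hd.toRep hα hα').2.1.mono fun z => ?_).mono_const ?_
    · rw [hv.toRep.reflMinus_eq, hw.toRep.reflMinus_eq, ← mul_sub, ← mul_sub, norm_mul 4,
        Complex.norm_ofNat]
      linarith [norm_nonneg ((z : ℂ) * (reflPlus v v₁ z - reflPlus w w₁ z))]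
    · exact mul_le_mul_of_nonneg_right (le_add_of_nonneg_right (by positivity)) hΔ
  · have hΔ := hd.nonneg
    obtain ⟨b1, b2, b3⟩ := hv.smoothBound hw hd
    have hgc : ‖conj (gaugeTop v) - conj (gaugeTop w)‖ ≤ M * Δ := by
      rw [← map_sub, RCLike.norm_conj]
      exact hv.toRep.norm_gaugeTop_sub_le hw.toRep hd.toRep
    have n1 : ∀ v, ‖conj (gaugeTop v)‖ = 1 := fun v => by rw [RCLike.norm_conj, norm_gaugeTop]
    have h2M := mul_le_mul_of_nonneg_right (two_mul_le_coeffConst hM) hΔ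
    have hMΔ : 0 ≤ M * Δ := mul_nonneg hM hΔ
    have k1 : ‖conj (gaugeTop v) ^ 2 - conj (gaugeTop w) ^ 2‖ ≤ coeffConst M * Δ := by
      rw [sq_sub_sq, norm_mul]
      refine (mul_le_mul (norm_add_le _ _) hgc (norm_nonneg _) (by positivity)).trans ?_
      rw [n1, n1]; linarith
    have m1 : ∀ v, ‖conj (gaugeTop v) ^ 2‖ ≤ 1 := fun v => by rw [norm_pow, n1]; norm_num
    refine (H₂ _ _ _ _ _ _ _ b1 b2 b3 (m1 v) (m1 w) k1 hα hα').mono_const ?_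
    rw [add_mul, mul_assoc]
    linarith [mul_nonneg hC₁ hΔ]

theorem sysCoeff_zero : sysCoeff (fun _ => 0) (fun _ => 0) = fun _ _ => 0 := by
  ext k x
  fin_cases k <;> simp [sysCoeff]

theorem sysEntry_zero (i : Fin 3) (z : ℝ) :
    sysEntry (fun _ => 0) (fun _ => 0) i z = if i = 0 then 1 else 0 := by
  rw [sysEntry, sysCoeff_zero, transfer_zero, entry_one]

theorem reflPlus_zero (z : ℝ) : reflPlus (fun _ => 0) (fun _ => 0) z = 0 := by
  simp [reflPlus, sysEntry_zero]

theorem reflMinus_zero (z : ℝ) : reflMinus (fun _ => 0) (fun _ => 0) z = 0 := by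
  simp [reflMinus, sysEntry_zero]

end Reflection

/-! ### From `L²` majorants to norms, and from function classes to representatives. -/

section Norms

/-- Continuity supplies the measurability that majorants do not give, and the increments supply the
weak derivative. -/
theorem memH1_of_l2Maj {f F : ℝ → ℂ} {K : ℝ} (hF : Continuous F) (hfF : f =ᵐ[volume] F)
    (h : L2Maj F K) (hη : ∀ η, L2Maj (fun z => F (z + η) - F z) (K * |η|)) :
    MemH1 f ∧ normH1 f ≤ ENNReal.ofReal (2 * K) := by
  have hm : MemLp F 2 volume := h.memLp hF.aestronglyMeasurable
  obtain ⟨g, hg, hg2, hgK⟩ := exists_hasWeakDeriv_of_increment h.1 hm fun t => (hη t).eLpNorm_le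
  have hg' : HasWeakDeriv f g := hg.congr_ae hfF.symm (ae_eq_refl g)
  refine ⟨⟨(memLp_congr_ae hfF).2 hm, g, hg', hg2⟩, ?_⟩
  rw [normH1, eLpNorm_congr_ae hfF, eLpNorm_congr_ae hg'.weakDeriv_ae, two_mul,
    ENNReal.ofReal_add h.1 h.1]
  exact add_le_add h.eLpNorm_le hgK

theorem weighted_congr_ae {f F : ℝ → ℂ} (h : f =ᵐ[volume] F) :
    weighted f =ᵐ[volume] weighted F := by
  filter_upwards [h] with x hx
  simp only [weighted, hx]

theorem normL21_congr_ae {f F : ℝ → ℂ} (h : f =ᵐ[volume] F) : normL21 f = normL21 F :=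
  eLpNorm_congr_ae (weighted_congr_ae h)

theorem memL21_of_l2Maj {f F : ℝ → ℂ} {K L : ℝ} (hF : Continuous F) (hfF : f =ᵐ[volume] F)
    (h : L2Maj F K) (hz : L2Maj (fun z : ℝ => (z : ℂ) * F z) L) :
    MemL21 f ∧ normL21 f ≤ ENNReal.ofReal (K + L) := by
  have hw : L2Maj (weighted F) (K + L) := h.of_le_add hz fun z => by
    rw [norm_weighted, norm_mul, Complex.norm_real, Real.norm_eq_abs, ← one_add_mul]
    exact mul_le_mul_of_nonneg_right (sqrt_one_add_sq_le z) (norm_nonneg _)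
  refine ⟨(memLp_congr_ae (weighted_congr_ae hfF)).2
    (hw.memLp (aestronglyMeasurable_weighted hF.aestronglyMeasurable)), ?_⟩
  rw [normL21_congr_ae hfF]
  exact hw.eLpNorm_le

variable {u u' v v₁ v₂ w w₁ w₂ : ℝ → ℂ} {M Δ : ℝ}

theorem MemH11.hasWeakDeriv (h : MemH11 u) : HasWeakDeriv u (weakDeriv u) := by
  obtain ⟨_, g, hg, _⟩ := h
  exact hasWeakDeriv_weakDeriv hg

theorem MemH11.memL21_weakDeriv (h : MemH11 u) : MemL21 (weakDeriv u) := by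
  obtain ⟨_, g, hg, hg1⟩ := h
  exact (memLp_congr_ae (weighted_congr_ae hg.weakDeriv_ae)).2 hg1

/-- A potential in `H^{1,1}` has a continuous representative. -/
theorem MemH11.exists_rep (h : MemH11 u) : ∃ v v₁ M, u =ᵐ[volume] v ∧ Rep v v₁ M := by
  have hw := h.hasWeakDeriv
  have hm := hw.2.1.aestronglyMeasurable
  obtain ⟨v, huv, hv⟩ := (hw.congr_ae (ae_eq_refl u) hm.ae_eq_mk).exists_isPrim
  have f1 : normL21 u ≠ ⊤ := h.1.2.ne
  have f2 : normL21 (weakDeriv u) ≠ ⊤ := h.memL21_weakDeriv.2.ne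
  refine ⟨v, hm.mk _, (normL21 u + normL21 (weakDeriv u)).toReal, huv, ENNReal.toReal_nonneg, hv,
    hm.stronglyMeasurable_mk, ?_, ?_⟩ <;> rw [ENNReal.ofReal_toReal (ENNReal.add_ne_top.2 ⟨f1, f2⟩)]
  · rw [← normL21_congr_ae huv]
    exact le_self_add
  · rw [← normL21_congr_ae hm.ae_eq_mk]
    exact le_add_self

/-- `v` is a representative of `u` with derivatives `v₁` and `v₂`. -/
structure IsRep2 (u v v₁ v₂ : ℝ → ℂ) : Prop where
  ae : u =ᵐ[volume] v
  prim : IsPrim v v₁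
  ae_deriv : weakDeriv u =ᵐ[volume] v₁
  prim_deriv : IsPrim v₁ v₂
  meas : StronglyMeasurable v₂
  weak : HasWeakDeriv u v₁
  weak_deriv : HasWeakDeriv (weakDeriv u) v₂

/-- The representatives are built from the top: `v₂` is a measurable version of the second
derivative, `v₁` a primitive of it, and `v` a primitive of this very `v₁`, so that the chain of
primitives holds exactly and not only almost everywhere. -/
theorem MemH2.exists_isRep2 (h : MemH2 u) : ∃ v v₁ v₂, IsRep2 u v v₁ v₂ := by
  obtain ⟨_, g, hg, _, g₂, hg₂, _⟩ := h
  have h2 : HasWeakDeriv (weakDeriv u) g₂ := hg₂.congr_ae hg.weakDeriv_ae.symm (ae_eq_refl g₂)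
  have hm := hg₂.2.1.aestronglyMeasurable
  have h2' := h2.congr_ae (ae_eq_refl _) hm.ae_eq_mk
  obtain ⟨v₁, e1, p1⟩ := h2'.exists_isPrim
  have h1 : HasWeakDeriv u v₁ := (hasWeakDeriv_weakDeriv hg).congr_ae (ae_eq_refl u) e1
  obtain ⟨v, e0, p0⟩ := h1.exists_isPrim
  exact ⟨v, v₁, _, e0, p0, e1, p1, hm.stronglyMeasurable_mk, h1, h2'⟩

theorem IsRep2.sub (h : IsRep2 u v v₁ v₂) (h' : IsRep2 u' w w₁ w₂) :
    IsRep2 (u - u') (fun x => v x - w x) (fun x => v₁ x - w₁ x) (fun x => v₂ x - w₂ x) := by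
  have h1 : HasWeakDeriv (u - u') (fun x => v₁ x - w₁ x) := h.weak.sub h'.weak
  have e : weakDeriv u - weakDeriv u' =ᵐ[volume] weakDeriv (u - u') :=
    (h.ae_deriv.sub h'.ae_deriv).trans h1.weakDeriv_ae.symm
  exact ⟨h.ae.sub h'.ae, h.prim.sub h'.prim, h1.weakDeriv_ae, h.prim_deriv.sub h'.prim_deriv,
    h.meas.sub h'.meas, h1, (h.weak_deriv.sub h'.weak_deriv).congr_ae e (ae_eq_refl _)⟩

theorem IsRep2.rep2 (h : IsRep2 u v v₁ v₂) (hM : 0 ≤ M)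
    (hu : normH2 u + normH11 u ≤ ENNReal.ofReal M) : Rep2 v v₁ v₂ M := by
  rw [normH2, normH1, normH11, normL21_congr_ae h.ae, normL21_congr_ae h.ae_deriv,
    eLpNorm_congr_ae h.weak_deriv.weakDeriv_ae] at hu
  refine ⟨⟨hM, h.prim, h.prim_deriv.continuous.stronglyMeasurable, le_trans ?_ hu,
    le_trans ?_ hu⟩, h.prim_deriv, h.meas, le_trans ?_ hu⟩
  · exact le_self_add.trans le_add_self
  · exact le_add_self.trans le_add_self
  · exact (le_add_self.trans le_add_self).trans le_self_add

end Norms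

/-! ### Assembly of the statements for potentials given as classes. -/

section Main

variable {u u' : ℝ → ℂ}

theorem norm_ne_top (h2 : MemH2 u) (h : MemH11 u) : normH2 u + normH11 u ≠ ⊤ := by
  have h1 := h.memL21_weakDeriv.2.ne
  obtain ⟨hu, g, hg, hg2, g₂, hg₂, hg₂2⟩ := h2
  have e := hg.weakDeriv_ae
  have e2 : weakDeriv (weakDeriv u) =ᵐ[volume] g₂ :=
    (hg₂.congr_ae e.symm (ae_eq_refl g₂)).weakDeriv_ae
  rw [normH2, normH1, normH11, eLpNorm_congr_ae e, eLpNorm_congr_ae e2]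
  exact ENNReal.add_ne_top.2 ⟨ENNReal.add_ne_top.2 ⟨hu.2.ne,
    ENNReal.add_ne_top.2 ⟨hg2.2.ne, hg₂2.2.ne⟩⟩, ENNReal.add_ne_top.2 ⟨h.1.2.ne, h1⟩⟩

theorem existsUnique_isScatteringPair (h : MemH11 u) {l : ℂ} (hl : l ∈ axes) :
    ∃! p : ℂ × ℂ, IsScatteringPair u l p := by
  obtain ⟨v, v₁, M, huv, hv⟩ := h.exists_rep
  obtain ⟨z, hz⟩ := sq_eq_ofReal_of_mem_axes hl
  have hu := hv.integrable.congr huv.symm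
  exact ⟨_, (isScatteringPair_iff hu hz _).2 rfl, fun p hp => (isScatteringPair_iff hu hz p).1 hp⟩

theorem memH1_refl {A : ℝ} (hA : 0 < A) (h : MemH11 u) (hu : ABound u A) :
    MemH1 (rPlus u) ∧ MemH1 (rMinus u) := by
  obtain ⟨v, v₁, M, huv, hv⟩ := h.exists_rep
  -- The comparison potential is zero, where `a = 1`, so the common lower bound must not exceed `1`.
  have ha : 0 < min A 1 := lt_min hA one_pos
  have hb : ∀ z, min A 1 ≤ ‖sysEntry v v₁ 0 z‖ := fun z =>
    (min_le_left _ _).trans (hv.le_norm_sysEntry huv hu z)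
  obtain ⟨C, _, H⟩ := l2Maj_refl_sub hv.nonneg ha
  obtain ⟨⟨p, p'⟩, m, m'⟩ := H v v₁ _ _ M hv (rep_zero hv.nonneg) (by simpa using hv) hb
    fun z => by simp [sysEntry_zero]
  simp only [reflPlus_zero, reflMinus_zero, sub_zero] at p p' m m'
  obtain ⟨c, c'⟩ := hv.continuous_refl ha hb
  exact ⟨(memH1_of_l2Maj c (hv.rPlus_ae huv) p p').1, (memH1_of_l2Maj c' (hv.rMinus_ae huv) m m').1⟩

theorem memL21_refl {A : ℝ} (hA : 0 < A) (h2 : MemH2 u) (h : MemH11 u) (hu : ABound u A) :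
    MemL21 (rPlus u) ∧ MemL21 (rMinus u) := by
  obtain ⟨v, v₁, v₂, hr⟩ := h2.exists_isRep2
  set M := (normH2 u + normH11 u).toReal
  have hM : 0 ≤ M := ENNReal.toReal_nonneg
  have hv : Rep2 v v₁ v₂ M := hr.rep2 hM (ENNReal.ofReal_toReal (norm_ne_top h2 h)).ge
  have ha : 0 < min A 1 := lt_min hA one_pos
  have hb : ∀ z, min A 1 ≤ ‖sysEntry v v₁ 0 z‖ := fun z =>
    (min_le_left _ _).trans (hv.toRep.le_norm_sysEntry hr.ae hu z)
  have h0 : ∀ z, min A 1 ≤ ‖sysEntry (fun _ => 0) (fun _ => 0) 0 z‖ := fun z => by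
    simp [sysEntry_zero]
  obtain ⟨C, _, H⟩ := l2Maj_refl_sub hM ha
  obtain ⟨D, _, H'⟩ := l2Maj_mul_refl_sub hM ha
  obtain ⟨⟨p, _⟩, m, _⟩ := H v v₁ _ _ M hv.toRep (rep_zero hM) (by simpa using hv.toRep) hb h0
  obtain ⟨p', m'⟩ := H' v v₁ v₂ _ _ _ M hv (rep2_zero hM) (by simpa using hv) hb h0
  simp only [reflPlus_zero, reflMinus_zero, sub_zero] at p p' m m'
  obtain ⟨c, c'⟩ := hv.toRep.continuous_refl ha hb
  exact ⟨(memL21_of_l2Maj c (hv.toRep.rPlus_ae hr.ae) p p').1,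
    (memL21_of_l2Maj c' (hv.toRep.rMinus_ae hr.ae) m m').1⟩

theorem refl_lipschitz {A : ℝ} (hA : 0 < A) (U : ℝ≥0) : ∃ C : ℝ≥0, ∀ u v : ℝ → ℂ,
    MemH2 u → MemH2 v →
    normH2 u + normH11 u ≤ U → normH2 v + normH11 v ≤ U → ABound u A → ABound v A →
    (normH1 (rPlus u - rPlus v) + normL21 (rPlus u - rPlus v)) +
      (normH1 (rMinus u - rMinus v) + normL21 (rMinus u - rMinus v))
      ≤ C * (normH2 (u - v) + normH11 (u - v)) := by
  obtain ⟨C, hC, H⟩ := l2Maj_refl_sub U.coe_nonneg hA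
  obtain ⟨D, hD, H'⟩ := l2Maj_mul_refl_sub U.coe_nonneg hA
  -- Each reflection coefficient costs `2C` in `H¹` and `C + D` in `L^{2,1}`. The added `1` keeps
  -- the constant nonzero, so that the estimate also holds if the right-hand norm is infinite.
  refine ⟨(2 * (2 * C + (C + D))).toNNReal + 1, fun u u' h2 h2' hu hu' hA hA' => ?_⟩
  set X := normH2 (u - u') + normH11 (u - u')
  rcases eq_or_ne X ⊤ with hX | hX
  · rw [hX, ENNReal.mul_top (by simp)]
    exact le_top
  obtain ⟨v, v₁, v₂, hr⟩ := h2.exists_isRep2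
  obtain ⟨w, w₁, w₂, hr'⟩ := h2'.exists_isRep2
  have hv : Rep2 v v₁ v₂ U := hr.rep2 U.coe_nonneg (by rwa [ENNReal.ofReal_coe_nnreal])
  have hw : Rep2 w w₁ w₂ U := hr'.rep2 U.coe_nonneg (by rwa [ENNReal.ofReal_coe_nnreal])
  have hd := (hr.sub hr').rep2 ENNReal.toReal_nonneg (ENNReal.ofReal_toReal hX).ge
  set Δ := X.toReal
  have hΔ : 0 ≤ Δ := ENNReal.toReal_nonneg
  have hb := hv.toRep.le_norm_sysEntry hr.ae hA
  have hb' := hw.toRep.le_norm_sysEntry hr'.ae hA'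
  obtain ⟨⟨p, q⟩, m, n⟩ := H v v₁ w w₁ Δ hv.toRep hw.toRep hd.toRep hb hb'
  obtain ⟨p', m'⟩ := H' v v₁ v₂ w w₁ w₂ Δ hv hw hd hb hb'
  obtain ⟨c, d⟩ := hv.toRep.continuous_refl ‹0 < A› hb
  obtain ⟨c', d'⟩ := hw.toRep.continuous_refl ‹0 < A› hb'
  have e : rPlus u - rPlus u' =ᵐ[volume] fun z => reflPlus v v₁ z - reflPlus w w₁ z :=
    (hv.toRep.rPlus_ae hr.ae).sub (hw.toRep.rPlus_ae hr'.ae)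
  have e' : rMinus u - rMinus u' =ᵐ[volume] fun z => reflMinus v v₁ z - reflMinus w w₁ z :=
    (hv.toRep.rMinus_ae hr.ae).sub (hw.toRep.rMinus_ae hr'.ae)
  have b1 := (memH1_of_l2Maj (c.sub c') e p q).2
  have b2 := (memL21_of_l2Maj (c.sub c') e p p').2
  have b3 := (memH1_of_l2Maj (d.sub d') e' m n).2
  have b4 := (memL21_of_l2Maj (d.sub d') e' m m').2
  refine (add_le_add (add_le_add b1 b2) (add_le_add b3 b4)).trans ?_
  rw [← ENNReal.ofReal_add (by positivity) (by positivity),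
    ← ENNReal.ofReal_add (by positivity) (by positivity),
    show 2 * (C * Δ) + (C * Δ + D * Δ) + (2 * (C * Δ) + (C * Δ + D * Δ)) =
      2 * (2 * C + (C + D)) * Δ by ring, ENNReal.ofReal_mul (by positivity),
    ENNReal.ofReal_toReal hX]
  gcongr
  rw [ENNReal.coe_add]
  exact le_self_add

end Main

end DNLS

theorem lemma3p2 :
    -- the scattering coefficients and the scattering data are well defined
    (∀ u : ℝ → ℂ, MemH11 u →
      (∀ l ∈ axes, ∃! p : ℂ × ℂ, IsScatteringPair u l p) ∧
      (∀ (l : ℂ) (z : ℝ), l ≠ 0 → l ^ 2 = (z : ℂ) →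
        rPlus u z = -(scatB u l / (2 * I * l * scatA u l)) ∧
        rMinus u z = 2 * I * l * scatB u l / scatA u l)) ∧
    -- membership in `H¹`
    (∀ (u : ℝ → ℂ) (A : ℝ), 0 < A → MemH11 u → ABound u A →
      MemH1 (rPlus u) ∧ MemH1 (rMinus u)) ∧
    -- membership in `L^{2,1}`
    (∀ (u : ℝ → ℂ) (A : ℝ), 0 < A → MemH2 u → MemH11 u → ABound u A →
      MemL21 (rPlus u) ∧ MemL21 (rMinus u)) ∧
    -- Lipschitz continuity
    (∀ (A : ℝ) (U : ℝ≥0), 0 < A → ∃ C : ℝ≥0, ∀ u v : ℝ → ℂ,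
      MemH2 u → MemH11 u → MemH2 v → MemH11 v →
      normH2 u + normH11 u ≤ U → normH2 v + normH11 v ≤ U →
      ABound u A → ABound v A →
      (normH1 (rPlus u - rPlus v) + normL21 (rPlus u - rPlus v)) +
        (normH1 (rMinus u - rMinus v) + normL21 (rMinus u - rMinus v))
        ≤ C * (normH2 (u - v) + normH11 (u - v))) := by
  refine ⟨fun u hu => ⟨fun l hl => existsUnique_isScatteringPair hu hl, fun l z hl0 hl => ?_⟩,
    fun u A hA hu hb => memH1_refl hA hu hb, fun u A hA h2 hu hb => memL21_refl hA h2 hu hb,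
    fun A U hA => ?_⟩
  · obtain ⟨v, v₁, M, huv, hv⟩ := hu.exists_rep
    have hz : z ≠ 0 := fun h => hl0 (by simpa [h] using hl)
    obtain ⟨h1, h2⟩ := hv.quotient_eq huv hl hl0
    exact ⟨(hv.rPlus_eq huv hz).trans h1.symm, (hv.rMinus_eq huv hz).trans h2.symm⟩
  · obtain ⟨C, hC⟩ := refl_lipschitz hA U
    exact ⟨C, fun u v hu _ hv _ hUu hUv hAu hAv => hC u v hu hv hUu hUv hAu hAv⟩
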